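/- Let $A<0$, $B\in\mathbb{R}$, $D_c>0$ and $\Sigma_0>0$. Let $w,v$ be independent standard Brownian motions, independent of $x_0\sim\mathcal{N}(0,\Sigma_0)$, and let $x$ be the scalar stable source $dx_t=Ax_t\,dt+B\,dw_t$, $t\ge 0$. Discrete time. For $\tau>0$ put $A_\tau=e^{A\tau}$, $B_\tau=\bigl(\int_0^\tau e^{2A\lambda}B^2\,d\lambda\bigr)^{1/2}$, $Q_{A,\tau}=\int_0^\tau e^{2At}\,dt$, $\overline{b}_\tau=\int_0^\tau B_t^2\,dt$ and $D_{d,\tau}=D_c\tau-\overline{b}_\tau$. For $D,Q>0$ let $$R(D,Q,\tau)=\inf\ \limsup_{K\to\infty}\tfrac1K I\bigl(x(0),\dots,x(K-1);\hat x(0),\dots,\hat x(K-1)\bigr)\quad\text{s.t.}\quad \limsup_{K\to\infty}\tfrac1K\sum_{k=0}^{K-1}\mathbb{E}\bigl[Q\,(x(k)-\hat x(k))^2\bigr]\le D,$$ where mutual information is in bits, the infimum is over all sequences of stochastic kernels $\mathbb{P}[\hat x(k)\mid \hat x(0),\dots,\hat x(k-1),x(0),\dots,x(k)]$, $k\ge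 0$, and the joint law is the one induced by these kernels and the sampled source $x(k+1)=A_\tau x(k)+B_\tau w(k)$, $x(0)\sim\mathcal{N}(0,\Sigma_0)$, with $w(k)\sim\mathcal{N}(0,1)$ independent of the past $(x(0),\dots,x(k),\hat x(0),\dots,\hat x(k))$. Continuous time. For a measurable gain $C_t$ let $dy_t=C_tx_t\,dt+dv_t$, $y_0=0$, and $\hat x_t=\mathbb{E}[x_t\mid y_s,\,0\le s\le t]$. Let $$\mathcal{I}^c(D)=\inf_{C}\ \limsup_{T\to\infty}\tfrac1T I\bigl(x_{[0,T]};\hat x_{[0,T]}\bigr)\quad\text{s.t.}\quad\limsup_{T\to\infty}\tfrac1T\int_0^T\mathbb{E}\bigl[(x_t-\hat x_t)^2\bigr]dt\le D,$$ in bits, the infimum being over the measurable $C$ for which the Riccati equation $\dot X_t=2AX_t-C_t^2X_t^2+B^2$ (a.e.), $X_0=\Sigma_0$, has a locally absolutely continuous solution with $X_t>0$ for all $t\ge 0$. Then for all sufficiently small $\tau>0$ we have $D_{d,\tau}>0$ and $Q_{A,\tau}>0$, and the function $f(\tau)=R(D_{d,\tau},Q_{A,\tau},\tau)/\tau$ satisfies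 $$\lim_{\tau\to0^+}f(\tau)=\mathcal{I}^c(D_c)=(\log_2 e)\max\Bigl\{0,\;A+\frac{B^2}{2D_c}\Bigr\};$$ moreover $f$, extended to $\tau=0$ by this limit, has a local minimum on $[0,\infty)$ at $\tau=0$ (that is, $f(\tau)\ge\mathcal{I}^c(D_c)$ for all sufficiently small $\tau>0$). In particular the discrete-time and continuous-time bounds on the bitrate coincide as $\tau\to0$: with $\theta^{-1}$ the inverse of the bijection $\theta(x)=x+(1+x)\log_2(1+x)-x\log_2x$ of $[0,\infty)$ (where $0\log_2 0=0$), $$\lim_{\tau\to0^+}\Bigl[\tfrac1\tau\theta^{-1}\bigl(R(D_{d,\tau},Q_{A,\tau},\tau)\bigr)-\tfrac1\tau\theta^{-1}\bigl(\tau\,\mathcal{I}^c(D_c)\bigr)\Bigr]=0.$$ -/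

import Mathlib

open MeasureTheory ProbabilityTheory Filter
open scoped NNReal ENNReal Topology

noncomputable section

namespace GaussMarkov

/-! ### Mutual information in bits -/

/-- The mutual information `I(X; Y)`, in bits: the Kullback-Leibler divergence (Mathlib's `klDiv`
is in nats) of the joint law from the product of the marginal laws. It is `∞` where the divergence
is infinite. -/
def mutualInfo {Ω E F : Type*} [MeasurableSpace Ω] [MeasurableSpace E] [MeasurableSpace F]
    (P : Measure Ω) (X : Ω → E) (Y : Ω → F) : ℝ≥0∞ :=
  InformationTheory.klDiv (P.map fun ω => (X ω, Y ω)) ((P.map X).prod (P.map Y))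
    / ENNReal.ofReal (Real.log 2)

/-! ### The sampled source -/

/-- `A_s = e^{A s}`. -/
def Ad (A s : ℝ) : ℝ := Real.exp (A * s)

/-- `B_s = (∫₀ˢ e^{Aλ} B B e^{Aλ} dλ)^{1/2}`. -/
def Bd (A B s : ℝ) : ℝ :=
  Real.sqrt (∫ l in (0 : ℝ)..s, Real.exp (A * l) * B * B * Real.exp (A * l))

/-- `Q_{A,τ} = ∫₀^τ e^{A t} e^{A t} dt`. -/
def Qd (A τ : ℝ) : ℝ := ∫ t in (0 : ℝ)..τ, Ad A t * Ad A t

/-- `b_τ = ∫₀^τ B_t B_t dt`. -/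
def bbar (A B τ : ℝ) : ℝ := ∫ t in (0 : ℝ)..τ, Bd A B t * Bd A B t

/-- `D_{d,τ} = D_c τ - b_τ`. -/
def Dd (A B Dc τ : ℝ) : ℝ := Dc * τ - bbar A B τ

/-! ### The discrete-time causal rate-distortion function -/

/-- A causal reconstruction policy: for every `k`, a conditional law of `x̂(k)` given
`(x̂(0:k-1), x(0:k))`. -/
structure ReconPolicy where
  /-- the kernel at step `k` -/
  kern : ∀ k : ℕ, Kernel ((Fin k → ℝ) × (Fin (k + 1) → ℝ)) ℝ
  /-- every kernel is stochastic -/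
  markov : ∀ k, IsMarkovKernel (kern k)

/-- `P` is the joint law of `((x(k))ₖ, (x̂(k))ₖ)` induced by the source
`x(k+1) = a x(k) + b w(k)`, `x(0) ∼ N(0, S0)`, `w(k) ∼ N(0, 1)`, with `b w(k)` independent of
`(x(0:k), x̂(0:k))`, and by the reconstruction policy `κ`. -/
structure IsInducedLaw (a b : ℝ) (S0 : ℝ≥0) (κ : ReconPolicy)
    (P : Measure ((ℕ → ℝ) × (ℕ → ℝ))) : Prop where
  prob : IsProbabilityMeasure P
  init : P.map (fun ω => ω.1 0) = gaussianReal 0 S0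
  noise_law : ∀ k : ℕ,
    P.map (fun ω => ω.1 (k + 1) - a * ω.1 k) = gaussianReal 0 (Real.toNNReal (b ^ 2))
  noise_indep : ∀ k : ℕ,
    IndepFun (fun ω => ω.1 (k + 1) - a * ω.1 k)
      (fun ω => ((fun i : Fin (k + 1) => ω.1 i), (fun i : Fin (k + 1) => ω.2 i))) P
  recon : ∀ k : ℕ,
    P.map (fun ω => (((fun i : Fin k => ω.2 i), (fun i : Fin (k + 1) => ω.1 i)), ω.2 k))
      = (P.map fun ω => ((fun i : Fin k => ω.2 i), (fun i : Fin (k + 1) => ω.1 i))) ⊗ₘ κ.kern k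

/-- `limsup_K (1/K) ∑_{k<K} E[Q (x(k) - x̂(k))²]`. -/
def dtDistortion (Q : ℝ) (P : Measure ((ℕ → ℝ) × (ℕ → ℝ))) : ℝ≥0∞ :=
  limsup (fun K : ℕ =>
    (∑ k ∈ Finset.range K, ∫⁻ ω, ENNReal.ofReal (Q * (ω.1 k - ω.2 k) ^ 2) ∂P) / (K : ℝ≥0∞)) atTop

/-- `limsup_K (1/K) I(x(0:K-1); x̂(0:K-1))`, in bits per sample. -/
def dtInfoRate (P : Measure ((ℕ → ℝ) × (ℕ → ℝ))) : ℝ≥0∞ :=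
  limsup (fun K : ℕ =>
    mutualInfo P (fun ω (i : Fin K) => ω.1 i) (fun ω (i : Fin K) => ω.2 i) / (K : ℝ≥0∞)) atTop

/-- The discrete-time causal rate-distortion function `R(D, Q, τ)` (meant for `D, Q, τ > 0`) of the
source with parameters `A`, `B`, `x₀ ∼ N(0, S0)`, sampled with period `τ`: the infimum of the
information rate over all causal reconstruction policies with distortion at most `D`. -/
def dtRDF (A B : ℝ) (S0 : ℝ≥0) (D Q τ : ℝ) : ℝ≥0∞ :=
  sInf {r | ∃ (κ : ReconPolicy) (P : Measure ((ℕ → ℝ) × (ℕ → ℝ))),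
    IsInducedLaw (Ad A τ) (Bd A B τ) S0 κ P ∧
      dtDistortion Q P ≤ ENNReal.ofReal D ∧ r = dtInfoRate P}

/-- `f(τ) = R(D_{d,τ}, Q_{A,τ}, τ) / τ`. -/
def normRate (A B : ℝ) (S0 : ℝ≥0) (Dc τ : ℝ) : ℝ≥0∞ :=
  dtRDF A B S0 (Dd A B Dc τ) (Qd A τ) τ / ENNReal.ofReal τ

/-! ### The continuous-time information-distortion function -/

/-- The source and the noises in continuous time: `w`, `v` are standard Brownian motions,
`x 0 ∼ N(0, S0)`, these three are mutually independent, and `x` solves `dx = A x dt + B dw`.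
All processes have continuous paths. -/
structure IsModel {Ω : Type*} [MeasurableSpace Ω] (μ : Measure Ω) (A B : ℝ) (S0 : ℝ≥0)
    (x w v : ℝ≥0 → Ω → ℝ) : Prop where
  brownian_w : IsBrownianReal w μ
  brownian_v : IsBrownianReal v μ
  measurable_x : ∀ t, Measurable (x t)
  measurable_w : ∀ t, Measurable (w t)
  measurable_v : ∀ t, Measurable (v t)
  continuous_x : ∀ ω, Continuous fun t => x t ω
  continuous_w : ∀ ω, Continuous fun t => w t ω
  continuous_v : ∀ ω, Continuous fun t => v t ω
  init : μ.map (x 0) = gaussianReal 0 S0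
  indep_init : IndepFun (x 0) (fun ω t => w t ω) μ
  indep_obs : IndepFun (fun ω => (x 0 ω, fun t => w t ω)) (fun ω t => v t ω) μ
  sde : ∀ᵐ ω ∂μ, ∀ t : ℝ≥0,
    x t ω = x 0 ω + (∫ s in (0 : ℝ)..t, A * x s.toNNReal ω) + B * w t ω

/-- The admissible sensor gains: measurable `C` for which the Riccati equation
`X' = A X + X A - X C C X + B B`, `X 0 = S0`, has a positive solution on `[0, ∞)` in the sense of
Carathéodory. -/
def IsAdmissibleGain (A B : ℝ) (S0 : ℝ≥0) (C : ℝ → ℝ) : Prop :=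
  Measurable C ∧ ∃ X : ℝ → ℝ,
    (∀ T : ℝ, 0 ≤ T → AbsolutelyContinuousOnInterval X 0 T) ∧
    X 0 = S0 ∧ (∀ t, 0 ≤ t → 0 < X t) ∧
    ∀ᵐ t ∂(volume.restrict (Set.Ici (0 : ℝ))),
      HasDerivAt X (A * X t + X t * A - X t * C t * C t * X t + B * B) t

section

variable {Ω : Type*} [MeasurableSpace Ω]

/-- The observation process `dy = C x dt + dv`, `y 0 = 0`. -/
def obs (C : ℝ → ℝ) (x v : ℝ≥0 → Ω → ℝ) (t : ℝ≥0) (ω : Ω) : ℝ :=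
  (∫ s in (0 : ℝ)..t, C s * x s.toNNReal ω) + v t ω

/-- The σ-algebra generated by the observations `y_s`, `0 ≤ s ≤ t`. -/
abbrev obsAlgebra (C : ℝ → ℝ) (x v : ℝ≥0 → Ω → ℝ) (t : ℝ≥0) : MeasurableSpace Ω :=
  ⨆ s : Set.Iic t, MeasurableSpace.comap (obs C x v s) inferInstance

/-- The MMSE estimate `x̂_t = E[x_t | y_s, 0 ≤ s ≤ t]`. -/
def estimate (μ : Measure Ω) (C : ℝ → ℝ) (x v : ℝ≥0 → Ω → ℝ) (t : ℝ≥0) : Ω → ℝ :=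
  μ[x t | obsAlgebra C x v t]

/-- `limsup_T (1/T) ∫₀ᵀ E[(x_t - x̂_t)²] dt`. -/
def ctDistortion (μ : Measure Ω) (C : ℝ → ℝ) (x v : ℝ≥0 → Ω → ℝ) : ℝ≥0∞ :=
  limsup (fun T : ℝ≥0 =>
    (∫⁻ t in Set.Ioc (0 : ℝ) T,
      ∫⁻ ω, ENNReal.ofReal ((x t.toNNReal ω - estimate μ C x v t.toNNReal ω) ^ 2) ∂μ)
        / (T : ℝ≥0∞)) atTop

/-- `limsup_T (1/T) I(x_{[0,T]}; x̂_{[0,T]})`, in bits per unit of time. -/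
def ctInfoRate (μ : Measure Ω) (C : ℝ → ℝ) (x v : ℝ≥0 → Ω → ℝ) : ℝ≥0∞ :=
  limsup (fun T : ℝ≥0 =>
    mutualInfo μ (fun ω (s : Set.Iic T) => x s ω)
      (fun ω (s : Set.Iic T) => estimate μ C x v s ω) / (T : ℝ≥0∞)) atTop

/-- The continuous-time information-distortion function `I^c(D)`: the infimum of the information
rate over all admissible sensor gains with distortion at most `D`. -/
def ctInfoDistortion (μ : Measure Ω) (A B : ℝ) (S0 : ℝ≥0) (x v : ℝ≥0 → Ω → ℝ) (D : ℝ) : ℝ≥0∞ :=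
  sInf {r | ∃ C : ℝ → ℝ, IsAdmissibleGain A B S0 C ∧
    ctDistortion μ C x v ≤ ENNReal.ofReal D ∧ r = ctInfoRate μ C x v}

end

/-! ### The lower bounds on the bitrate -/

/-- `θ(x) = x + (1 + x) log₂ (1 + x) - x log₂ x` on `[0, ∞)`, with `0 log₂ 0 = 0`. -/
def theta (x : ℝ) : ℝ := x + (1 + x) * Real.logb 2 (1 + x) - x * Real.logb 2 x

/-- The inverse of `θ : [0, ∞) → [0, ∞)`. -/
def thetaInv (y : ℝ) : ℝ := Function.invFunOn theta (Set.Ici 0) y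

/-- The discrete-time lower bound `θ⁻¹(R(D_{d,τ}, Q_{A,τ}, τ)) / τ`. -/
def dtBound (A B : ℝ) (S0 : ℝ≥0) (Dc τ : ℝ) : ℝ :=
  thetaInv (dtRDF A B S0 (Dd A B Dc τ) (Qd A τ) τ).toReal / τ

/-- The continuous-time lower bound `θ⁻¹(τ r) / τ`, where `r` is the value of `I^c(D_c)`. -/
def ctBound (r : ℝ≥0∞) (τ : ℝ) : ℝ := thetaInv (τ * r.toReal) / τ

end GaussMarkov

end

/-! All rate estimates, in discrete and in continuous time, rest on two inequalities for relative
entropy.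

Lower bounds. Given an error variance p, take the backward Gaussian channel that produces x(k) from
x(k+1) and the reconstruction y(k), namely the one-step smoothing law for filtered variance p. For a
fixed y, the product of these densities with a terminal density is a probability density in the
source path, so the logarithm of its ratio to the source density is admissible in the
Donsker-Varadhan inequality (`le_klDiv_of_causal`). Causality makes the driving noise independent of
x(k) - y(k), and the expectation is then affine in the mean squared errors V: it is the tangent at p
of ½ log (a² + v / V). Hence a bound on the average error suffices, and neither linearity nor
Gaussianity of the reconstruction is needed. Applied to samples of (x, x̂) at period δ → 0, the same
inequality bounds the continuous-time information (`IsModel.le_ctInfoRate`).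

Upper bounds. A Gaussian channel with feedback carries at most the sum of the mean squared
innovations over twice the noise variance, whatever causal predictor defines the innovations
(`klDiv_gaussianChannel_le`). In discrete time a stationary linear filter with filtered variance p
and predicted variance q yields ½ (q / p - 1) (`dtRDF_le_of_lt`). In continuous time the gain is
constant and solves the algebraic Riccati equation at D_c. A suboptimal recursive filter on ever
finer grids bounds the distortion and the information of the sampled observations, and lower
semicontinuity of the divergence along a generating filtration (`klDiv_le_of_forall_trim_le`) passes
to the whole observation (`IsModel.mutualInfo_le_of_const`).

Stochastic integration is avoided: the source equation holds path by path, so x(t+s) - e^{As} x(t)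
is a limit of Euler schemes driven by the increments of w after t, which gives its Gaussian law and
its independence of the past (`IsModel.map_increment`, `IsModel.indepFun_increment`).

Comparison. Let ρ(τ) be `varRatio`. When 2A + B²/D_c > 0 and τ is small, the sampled rate in nats
lies between ½ log ρ and ½ (ρ - 1), and (ρ - 1) / τ tends to 2A + B²/D_c, which gives the limit. The
expansions of ρ and of exp ((2A + B²/D_c) τ) agree up to second order, and at third order ρ is
larger by s (s + 2A)² / 12 with s = B²/D_c (`eventually_exp_le_varRatio`); this sign is the local
minimum. When 2A + B²/D_c ≤ 0 all rates vanish. The last limit holds because θ⁻¹(y) = o(y) at zero,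
so both bitrate bounds tend to zero separately. -/

namespace GaussMarkov

open InformationTheory

/-! ### Variational and limiting properties of the Kullback-Leibler divergence -/

section KL

variable {α β : Type*} [MeasurableSpace α] [MeasurableSpace β]

lemma rnDeriv_toReal_pos_ae {μ ν : Measure α} [SigmaFinite μ] [SigmaFinite ν] (h : μ ≪ ν) :
    ∀ᵐ x ∂μ, 0 < (μ.rnDeriv ν x).toReal := by
  filter_upwards [Measure.rnDeriv_pos h, h.ae_le (Measure.rnDeriv_lt_top μ ν)] with x h0 h1
  exact ENNReal.toReal_pos h0.ne' h1.ne

/-- One half of the Donsker-Varadhan variational formula. -/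
lemma ofReal_integral_le_klDiv {μ ν : Measure α} [IsProbabilityMeasure μ] [IsProbabilityMeasure ν]
    {h : α → ℝ} (hm : Measurable h) (hh : Integrable h μ)
    (hν : ∫⁻ x, ENNReal.ofReal (Real.exp (h x)) ∂ν ≤ 1) :
    ENNReal.ofReal (∫ x, h x ∂μ) ≤ klDiv μ ν := by
  by_cases hac : μ ≪ ν
  swap; · simp [klDiv_of_not_ac hac]
  by_cases hint : Integrable (llr μ ν) μ
  swap; · simp [klDiv_of_not_integrable hint]
  rw [klDiv_of_ac_of_integrable hac hint]
  simp only [probReal_univ, add_sub_cancel_right]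
  apply ENNReal.ofReal_le_ofReal
  set f := μ.rnDeriv ν with hf
  have hpos : ∀ᵐ x ∂μ, 0 < (f x).toReal := rnDeriv_toReal_pos_ae hac
  have hfm : Measurable f := Measure.measurable_rnDeriv μ ν
  -- With f = dμ/dν one has log g = h - log f μ-almost everywhere and ∫ g dμ ≤ ∫ exp h dν ≤ 1, so
  -- integrating log g ≤ g - 1 gives the claim.
  set g : α → ℝ := fun x => Real.exp (h x) / (f x).toReal
  have hg0 : ∀ x, 0 ≤ g x := fun x => by positivity
  have hgm : Measurable g := by fun_prop
  have hgl : ∫⁻ x, ENNReal.ofReal (g x) ∂μ ≤ 1 := by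
    rw [← lintegral_rnDeriv_mul hac (by fun_prop)]
    refine le_trans (lintegral_mono_ae ?_) hν
    filter_upwards [Measure.rnDeriv_lt_top μ ν] with x hx
    by_cases h0 : f x = 0
    · simp [← hf, h0]
    · rw [← hf] at hx ⊢
      nth_rw 1 [← ENNReal.ofReal_toReal hx.ne]
      rw [← ENNReal.ofReal_mul (by positivity)]
      apply ENNReal.ofReal_le_ofReal
      have : (f x).toReal ≠ 0 := (ENNReal.toReal_pos h0 hx.ne).ne'
      simp only [g]
      field_simp
      exact le_rfl
  have hgi : Integrable g μ := by
    refine ⟨hgm.aestronglyMeasurable, ?_⟩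
    rw [hasFiniteIntegral_iff_ofReal (ae_of_all _ hg0)]
    exact hgl.trans_lt (by simp)
  have hgr : ∫ x, g x ∂μ ≤ 1 := by
    rw [integral_eq_lintegral_of_nonneg_ae (ae_of_all _ hg0) hgm.aestronglyMeasurable]
    exact ENNReal.toReal_le_of_le_ofReal zero_le_one (by simpa using hgl)
  have key : ∫ x, h x ∂μ ≤ ∫ x, (llr μ ν x + (g x - 1)) ∂μ := by
    refine integral_mono_ae hh (hint.add (hgi.sub (integrable_const _))) ?_
    filter_upwards [hpos] with x hx
    have h1 : Real.log (g x) ≤ g x - 1 := Real.log_le_sub_one_of_pos (by positivity)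
    rw [Real.log_div (Real.exp_pos _).ne' hx.ne', Real.log_exp] at h1
    simp only [llr]
    linarith
  have hgi1 : Integrable (fun x => g x - 1) μ := hgi.sub (integrable_const _)
  rw [integral_add hint hgi1, integral_sub hgi (integrable_const _)] at key
  simp at key
  linarith

/-- Among the product measures `μ.fst ⊗ Q`, the divergence of `μ` is least for `Q = μ.snd`. -/
lemma klDiv_prod_snd_le (μ : Measure (α × β)) [IsProbabilityMeasure μ] (Q : Measure β)
    [IsProbabilityMeasure Q] :
    klDiv μ (μ.fst.prod μ.snd) ≤ klDiv μ (μ.fst.prod Q) := by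
  by_cases hac : μ ≪ μ.fst.prod Q
  swap; · simp [klDiv_of_not_ac hac]
  by_cases hint : Integrable (llr μ (μ.fst.prod Q)) μ
  swap; · simp [klDiv_of_not_integrable hint]
  have hQm : (μ.fst.prod Q).map Prod.snd = Q := by
    rw [Measure.map_snd_prod]; simp
  have hYQ : μ.snd ≪ Q := by
    have := hac.map measurable_snd
    rwa [hQm] at this
  have hYint : Integrable (llr μ.snd Q) μ.snd := by
    have := integrable_llr_map hac measurable_snd hint
    rwa [hQm] at this
  set h := μ.snd.rnDeriv Q with hh
  have hhm : Measurable h := Measure.measurable_rnDeriv _ _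
  have hprod : μ.fst.prod μ.snd = (μ.fst.prod Q).withDensity (fun p => h p.2) := by
    conv_lhs => rw [← Measure.withDensity_rnDeriv_eq μ.snd Q hYQ, ← withDensity_one (μ := μ.fst)]
    rw [prod_withDensity (by fun_prop) (by fun_prop)]
    simp [hh]
  have hpos : ∀ᵐ p ∂μ, h p.2 ≠ 0 := by
    have := Measure.rnDeriv_pos hYQ
    have h2 := ae_of_ae_map measurable_snd.aemeasurable this
    filter_upwards [h2] with p hp using hp.ne'
  -- The density h of `μ.snd` with respect to `Q` may vanish, but only on a μ-null set; elsewhere `μ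
  -- ≪ μ.fst.prod Q` transfers.
  have hac' : μ ≪ μ.fst.prod μ.snd := by
    rw [hprod]
    intro S hS
    obtain ⟨T, hST, hT, hT0⟩ := exists_measurable_superset_of_null hS
    refine measure_mono_null hST ?_
    rw [withDensity_apply _ hT, setLIntegral_eq_zero_iff hT (by fun_prop)] at hT0
    have h3 := hac.ae_le hT0
    have h4 : ∀ᵐ p ∂μ, p ∉ T := by
      filter_upwards [h3, hpos] with p hp hp2 hpT using hp2 (hp hpT)
    simpa [ae_iff] using h4
  have hacQ : μ.fst.prod μ.snd ≪ μ.fst.prod Q := Measure.AbsolutelyContinuous.prod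
    Measure.AbsolutelyContinuous.rfl hYQ
  have hd : (μ.fst.prod μ.snd).rnDeriv (μ.fst.prod Q) =ᵐ[μ] fun p => h p.2 := by
    apply hac.ae_le
    rw [hprod]
    exact Measure.rnDeriv_withDensity _ (by fun_prop)
  have hc : (fun p => μ.rnDeriv (μ.fst.prod μ.snd) p * (μ.fst.prod μ.snd).rnDeriv (μ.fst.prod Q) p)
      =ᵐ[μ] μ.rnDeriv (μ.fst.prod Q) := by
    apply hac.ae_le
    exact Measure.rnDeriv_mul_rnDeriv hac'
  -- Chain rule for densities. The subtracted term integrates to the divergence of `μ.snd` from `Q`,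
  -- which is nonnegative.
  have hl : llr μ (μ.fst.prod μ.snd) =ᵐ[μ]
      fun p => llr μ (μ.fst.prod Q) p - llr μ.snd Q p.2 := by
    filter_upwards [hd, hc, hpos, rnDeriv_toReal_pos_ae hac',
      ae_of_ae_map measurable_snd.aemeasurable (rnDeriv_toReal_pos_ae hYQ)] with p h1 h2 h3 h4 h5
    simp only [llr]
    have h6 : (h p.2).toReal ≠ 0 := h5.ne'
    rw [← h2, h1, ENNReal.toReal_mul, Real.log_mul h4.ne' h6]
    simp [hh]
  have hYint' : Integrable (fun p : α × β => llr μ.snd Q p.2) μ :=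
    hYint.comp_measurable measurable_snd
  have hint' : Integrable (llr μ (μ.fst.prod μ.snd)) μ :=
    (integrable_congr hl).2 (hint.sub hYint')
  rw [klDiv_of_ac_of_integrable hac hint, klDiv_of_ac_of_integrable hac' hint']
  simp only [probReal_univ, add_sub_cancel_right]
  apply ENNReal.ofReal_le_ofReal
  rw [integral_congr_ae hl, integral_sub hint hYint']
  have : ∫ p : α × β, llr μ.snd Q p.2 ∂μ = ∫ y, llr μ.snd Q y ∂μ.snd := by
    rw [Measure.snd, integral_map measurable_snd.aemeasurable]
    exact (Measurable.aestronglyMeasurable (by fun_prop))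
  have h0 := integral_llr_add_sub_measure_univ_nonneg hYQ hYint
  simp at h0
  linarith

/-- Lower semicontinuity of the divergence along a filtration that generates the σ-algebra. -/
lemma klDiv_le_of_forall_trim_le {α : Type*} {m0 : MeasurableSpace α} {μ ν : Measure α}
    [IsProbabilityMeasure μ] [IsProbabilityMeasure ν] (ℱ : Filtration ℕ m0)
    (hsup : ⨆ n, ℱ n = m0) {c : ℝ≥0∞} (hc : c ≠ ∞)
    (h : ∀ n, klDiv (μ.trim (ℱ.le n)) (ν.trim (ℱ.le n)) ≤ c) : klDiv μ ν ≤ c := by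
  have hac : ∀ n, μ.trim (ℱ.le n) ≪ ν.trim (ℱ.le n) := fun n =>
    (klDiv_ne_top_iff.1 ((h n).trans_lt hc.lt_top).ne).1
  set F : ℕ → α → ℝ≥0∞ := fun n => (μ.trim (ℱ.le n)).rnDeriv (ν.trim (ℱ.le n)) with hF
  have hFm : ∀ n, Measurable[ℱ n] (F n) := fun n => Measure.measurable_rnDeriv _ _
  have hFm' : ∀ n, Measurable (F n) := fun n => (hFm n).mono (ℱ.le n) le_rfl
  have hFset : ∀ n A, MeasurableSet[ℱ n] A → ∫⁻ x in A, F n x ∂ν = μ A := by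
    intro n A hA
    rw [← trim_measurableSet_eq (ℱ.le n) hA, ← Measure.setLIntegral_rnDeriv (hac n),
      restrict_trim (ℱ.le n) _ hA, lintegral_trim (ℱ.le n) (hFm n)]
  have hFtop : ∀ n, ∀ᵐ x ∂ν, F n x < ∞ := fun n =>
    ae_of_ae_trim (ℱ.le n) (Measure.rnDeriv_lt_top _ _)
  set f : ℕ → α → ℝ := fun n x => (F n x).toReal with hf
  have hfm : ∀ n, StronglyMeasurable[ℱ n] (f n) := fun n => (hFm n).ennreal_toReal.stronglyMeasurable
  have hfm' : ∀ n, Measurable (f n) := fun n => (hFm' n).ennreal_toReal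
  have hf0 : ∀ n x, 0 ≤ f n x := fun n x => ENNReal.toReal_nonneg
  have hof : ∀ n, ∀ᵐ x ∂ν, ENNReal.ofReal (f n x) = F n x := by
    intro n
    filter_upwards [hFtop n] with x hx using ENNReal.ofReal_toReal hx.ne
  have hkl : ∀ n, ∫⁻ x, ENNReal.ofReal (klFun (f n x)) ∂ν ≤ c := by
    intro n
    refine le_trans (le_of_eq ?_) (h n)
    rw [klDiv_eq_lintegral_klFun_of_ac (hac n), lintegral_trim (ℱ.le n)]
    have := (hfm n).measurable
    exact (measurable_klFun.comp this).ennreal_ofReal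
  have hfint : ∀ n, Integrable (f n) ν := by
    intro n
    refine ⟨(hfm' n).aestronglyMeasurable, ?_⟩
    rw [hasFiniteIntegral_iff_ofReal (ae_of_all _ (hf0 n)), lintegral_congr_ae (hof n)]
    have := hFset n Set.univ MeasurableSet.univ
    rw [Measure.restrict_univ] at this
    rw [this]; simp
  have hfset : ∀ n A, MeasurableSet[ℱ n] A → ∫ x in A, f n x ∂ν = μ.real A := by
    intro n A hA
    rw [integral_eq_lintegral_of_nonneg_ae (ae_of_all _ (hf0 n)) (hfm' n).aestronglyMeasurable,
      lintegral_congr_ae (ae_restrict_of_ae (hof n)), hFset n A hA, measureReal_def]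
  have hmart : Martingale f ℱ ν := by
    refine martingale_of_setIntegral_eq_succ hfm hfint fun n s hs => ?_
    rw [hfset n s hs, hfset (n + 1) s (ℱ.mono (Nat.le_succ n) s hs)]
  -- Fenchel-Young inequality for x log x - x. It turns the uniform bound on the divergences into
  -- uniform integrability of the densities.
  have young : ∀ x t : ℝ, 0 ≤ x → t * x ≤ klFun x + Real.exp t := by
    intro x t hx
    rcases hx.eq_or_lt with rfl | hx
    · simpa [klFun_zero] using add_nonneg zero_le_one (Real.exp_pos t).le
    · rw [klFun_apply]
      have h1 := Real.log_le_sub_one_of_pos (show 0 < Real.exp t / x by positivity)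
      rw [Real.log_div (by positivity) hx.ne', Real.log_exp, le_sub_iff_add_le, le_div_iff₀ hx] at h1
      nlinarith
  have hUI : UniformIntegrable f 1 ν := by
    refine ⟨fun n => (hfm' n).aestronglyMeasurable, ?_, 1, fun n => ?_⟩
    · intro ε hε
      -- On a set of measure at most exp (-t) the inequality `young` bounds the integral of the
      -- density by (c + 1) / t = ε / 2.
      set t : ℝ := 2 * (c.toReal + 1) / ε with ht
      have ht0 : 0 < t := by positivity
      refine ⟨Real.exp (-t), Real.exp_pos _, fun n s hs hsδ => ?_⟩
      rw [eLpNorm_one_eq_lintegral_enorm]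
      have e1 : ∀ x, ‖s.indicator (f n) x‖ₑ = s.indicator (fun x => ENNReal.ofReal (f n x)) x := by
        intro x
        by_cases hx : x ∈ s
        · simp [hx, Real.enorm_of_nonneg (hf0 n x)]
        · simp [hx]
      simp_rw [e1]
      rw [lintegral_indicator hs]
      have e2 : ENNReal.ofReal t * ∫⁻ x in s, ENNReal.ofReal (f n x) ∂ν
          ≤ ENNReal.ofReal (c.toReal + 1) := by
        rw [← lintegral_const_mul _ (hfm' n).ennreal_ofReal]
        calc ∫⁻ x in s, ENNReal.ofReal t * ENNReal.ofReal (f n x) ∂ν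
            ≤ ∫⁻ x in s, (ENNReal.ofReal (klFun (f n x)) + ENNReal.ofReal (Real.exp t)) ∂ν := by
              refine lintegral_mono fun x => ?_
              rw [← ENNReal.ofReal_mul ht0.le, ← ENNReal.ofReal_add (klFun_nonneg (hf0 n x))
                (Real.exp_pos _).le]
              exact ENNReal.ofReal_le_ofReal (young _ _ (hf0 n x))
          _ ≤ c + ENNReal.ofReal (Real.exp t) * ν s := by
              rw [lintegral_add_right _ measurable_const]
              refine add_le_add ((setLIntegral_le_lintegral _ _).trans (hkl n)) ?_
              simp
          _ ≤ ENNReal.ofReal c.toReal + ENNReal.ofReal (Real.exp t) * ENNReal.ofReal (Real.exp (-t)) := by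
              rw [ENNReal.ofReal_toReal hc]
              gcongr
          _ = ENNReal.ofReal (c.toReal + 1) := by
              rw [← ENNReal.ofReal_mul (Real.exp_pos _).le, ← Real.exp_add, add_neg_cancel,
                Real.exp_zero, ← ENNReal.ofReal_add ENNReal.toReal_nonneg zero_le_one]
      have e3 : ENNReal.ofReal (c.toReal + 1) ≤ ENNReal.ofReal t * ENNReal.ofReal ε := by
        rw [← ENNReal.ofReal_mul ht0.le, ht]
        apply ENNReal.ofReal_le_ofReal
        rw [div_mul_cancel₀ _ hε.ne']
        have : 0 ≤ c.toReal := ENNReal.toReal_nonneg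
        linarith
      exact (ENNReal.mul_le_mul_iff_right (by simpa using ht0) (by simp)).1 (e2.trans e3)
    · rw [eLpNorm_one_eq_lintegral_enorm]
      have : ∀ x, ‖f n x‖ₑ = ENNReal.ofReal (f n x) := fun x => Real.enorm_of_nonneg (hf0 n x)
      simp_rw [this]
      rw [lintegral_congr_ae (hof n)]
      have := hFset n Set.univ MeasurableSet.univ
      rw [Measure.restrict_univ] at this
      rw [this]; simp
  obtain ⟨R, hR⟩ := hUI.2.2
  -- A uniformly integrable martingale is closed by its limit, so g is the density of μ on each `ℱ
  -- n`, hence on the generated σ-algebra. Fatou's lemma then bounds the divergence.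
  set g := Filtration.limitProcess f ℱ ν with hg
  have hgm : Measurable g := (Filtration.stronglyMeasurable_limit_process' (f := f)).measurable
  have hgint : Integrable g ν := (Filtration.memLp_limitProcess_of_eLpNorm_bdd hUI.1 hR).integrable le_rfl
  have hlim : ∀ᵐ x ∂ν, Tendsto (fun n => f n x) atTop (𝓝 (g x)) :=
    hmart.submartingale.ae_tendsto_limitProcess hR
  have hg0 : 0 ≤ᵐ[ν] g := by
    filter_upwards [hlim] with x hx using ge_of_tendsto' hx fun n => hf0 n x
  have hgset : ∀ n A, MeasurableSet[ℱ n] A → ∫⁻ x in A, ENNReal.ofReal (g x) ∂ν = μ A := by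
    intro n A hA
    rw [← ofReal_integral_eq_lintegral_ofReal hgint.integrableOn (ae_restrict_of_ae hg0),
      ← setIntegral_condExp (ℱ.le n) hgint hA, ← setIntegral_congr_ae (ℱ.le n _ hA)
        ((hmart.ae_eq_condExp_limitProcess hUI n).mono fun x hx _ => hx), hfset n A hA]
    simp
  have hμ : μ = ν.withDensity fun x => ENNReal.ofReal (g x) := by
    have hfin : IsFiniteMeasure (ν.withDensity fun x => ENNReal.ofReal (g x)) :=
      isFiniteMeasure_withDensity_ofReal hgint.2
    refine ext_of_generate_finite {s | ∃ n, MeasurableSet[ℱ n] s} ?_ ?_ ?_ ?_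
    · exact hsup.symm.trans (MeasurableSpace.measurableSpace_iSup_eq _)
    · rw [Set.ofPred_exists]
      exact isPiSystem_iUnion_of_monotone _ (fun n ↦ (ℱ n).isPiSystem_measurableSet)
        fun _ _ ↦ ℱ.mono
    · rintro s ⟨n, hn⟩
      rw [withDensity_apply _ (ℱ.le n _ hn), hgset n s hn]
    · rw [withDensity_apply _ MeasurableSet.univ, hgset 0 _ MeasurableSet.univ]
  have hμν : μ ≪ ν := by rw [hμ]; exact withDensity_absolutelyContinuous _ _
  rw [klDiv_eq_lintegral_klFun_of_ac hμν]
  have hd : (fun x => ENNReal.ofReal (klFun (μ.rnDeriv ν x).toReal)) =ᵐ[ν]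
      fun x => liminf (fun n => ENNReal.ofReal (klFun (f n x))) atTop := by
    have h1 : μ.rnDeriv ν =ᵐ[ν] fun x => ENNReal.ofReal (g x) := by
      conv_lhs => rw [hμ]
      exact Measure.rnDeriv_withDensity _ (by fun_prop)
    filter_upwards [h1, hg0, hlim] with x h1 h2 h3
    rw [h1, ENNReal.toReal_ofReal h2]
    refine (Tendsto.liminf_eq ?_).symm
    exact (ENNReal.continuous_ofReal.tendsto _).comp ((continuous_klFun.tendsto _).comp h3)
  rw [lintegral_congr_ae hd]
  refine (lintegral_liminf_le fun n => ?_).trans ?_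
  · exact (measurable_klFun.comp (hfm' n)).ennreal_ofReal
  · refine liminf_le_of_le (by isBoundedDefault) fun b hb => ?_
    obtain ⟨n, hn⟩ := hb.exists
    exact hn.trans (hkl n)

end KL

end GaussMarkov

namespace GaussMarkov

open InformationTheory

/-! ### Information through an additive Gaussian channel with feedback -/

section GaussianChannel

variable {Ω E F : Type*} [MeasurableSpace Ω] [MeasurableSpace E] [MeasurableSpace F]

/-- The Gaussian kernel with mean `m p` and constant variance `s`. -/
noncomputable def shiftKernel (m : E → ℝ) (s : ℝ≥0) : Kernel E ℝ :=
  (Kernel.id ×ₖ Kernel.const E (gaussianReal 0 s)).map fun q : E × ℝ => m q.1 + q.2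

lemma shiftKernel_apply {m : E → ℝ} (hm : Measurable m) (s : ℝ≥0) (p : E) :
    shiftKernel m s p = gaussianReal (m p) s := by
  rw [shiftKernel, Kernel.map_apply _ (by fun_prop), Kernel.prod_apply, Kernel.id_apply,
    Kernel.const_apply, Measure.dirac_prod, Measure.map_map (by fun_prop) (by fun_prop)]
  have := gaussianReal_map_const_add (μ := 0) (v := s) (m p)
  rw [zero_add] at this
  rw [← this]
  rfl

lemma isMarkovKernel_shiftKernel {m : E → ℝ} (hm : Measurable m) (s : ℝ≥0) :
    IsMarkovKernel (shiftKernel m s) :=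
  ⟨fun p => by rw [shiftKernel_apply hm]; infer_instance⟩

/-- The kernel is the image of an independent noise under a shear. This reduces integrals over the
composition product to Fubini on a product measure. -/
lemma compProd_shiftKernel {m : E → ℝ} (hm : Measurable m) (s : ℝ≥0) (μ : Measure E)
    [SFinite μ] :
    μ ⊗ₘ shiftKernel m s
      = (μ.prod (gaussianReal 0 s)).map fun q : E × ℝ => (q.1, m q.1 + q.2) := by
  have := isMarkovKernel_shiftKernel hm s
  ext S hS
  have hmeas : Measurable fun q : E × ℝ => (q.1, m q.1 + q.2) := by fun_prop
  rw [Measure.compProd_apply hS, Measure.map_apply hmeas hS, Measure.prod_apply (hmeas hS)]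
  refine lintegral_congr fun p => ?_
  have h1 := gaussianReal_map_const_add (μ := 0) (v := s) (m p)
  rw [zero_add] at h1
  rw [shiftKernel_apply hm, ← h1,
    Measure.map_apply (by fun_prop) (hS.preimage measurable_prodMk_left)]
  rfl

/-- The joint law of an input and of its output after adding independent Gaussian noise. -/
lemma map_prodMk_add_noise {P : Measure Ω} [IsProbabilityMeasure P] {X : Ω → E} (hX : Measurable X)
    {m : E → ℝ} (hm : Measurable m) {s : ℝ≥0} {n : Ω → ℝ} (hn : Measurable n)
    (hlaw : P.map n = gaussianReal 0 s) (hind : IndepFun X n P) :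
    P.map (fun ω => (X ω, m (X ω) + n ω)) = (P.map X) ⊗ₘ shiftKernel m s := by
  have := Measure.isProbabilityMeasure_map (μ := P) hX.aemeasurable
  rw [compProd_shiftKernel hm, ← hlaw, ← (indepFun_iff_map_prod_eq_prod_map_map hX.aemeasurable
    hn.aemeasurable).1 hind, Measure.map_map (by fun_prop) (by fun_prop)]
  rfl

/-- Two Gaussian laws with equal variance have an explicit likelihood ratio, and its logarithm has
mean (m - m')² / (2 s) under the first law; this is averaged over the input. -/
lemma klDiv_shiftKernel_le (μ : Measure E) [IsProbabilityMeasure μ] {m m' : E → ℝ}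
    (hm : Measurable m) (hm' : Measurable m') {s : ℝ≥0} (hs : s ≠ 0)
    (hint : MemLp (fun p => m p - m' p) 2 μ) :
    klDiv (μ ⊗ₘ shiftKernel m s) (μ ⊗ₘ shiftKernel m' s)
      ≤ ENNReal.ofReal ((∫ p, (m p - m' p) ^ 2 ∂μ) / (2 * s)) := by
  have i1 := isMarkovKernel_shiftKernel hm s
  have i2 := isMarkovKernel_shiftKernel hm' s
  have hs0 : (0 : ℝ) < s := lt_of_le_of_ne s.2 (by exact_mod_cast hs.symm)
  set g : E × ℝ → ℝ := fun q => ((q.2 - m' q.1) ^ 2 - (q.2 - m q.1) ^ 2) / (2 * s) with hg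
  have hgm : Measurable g := by fun_prop
  have hdens : μ ⊗ₘ shiftKernel m s
      = (μ ⊗ₘ shiftKernel m' s).withDensity fun q => ENNReal.ofReal (Real.exp (g q)) := by
    ext S hS
    rw [withDensity_apply _ hS, ← lintegral_indicator hS, Measure.compProd_apply hS,
      Measure.lintegral_compProd (Measurable.indicator (by fun_prop) hS)]
    refine lintegral_congr fun p => ?_
    have hSm : Measurable fun y => S.indicator
        (fun q => ENNReal.ofReal (Real.exp (g q))) (p, y) :=
      (Measurable.indicator (by fun_prop) hS).comp measurable_prodMk_left
    rw [shiftKernel_apply hm, shiftKernel_apply hm', gaussianReal_of_var_ne_zero _ hs,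
      gaussianReal_of_var_ne_zero _ hs, withDensity_apply _ (hS.preimage measurable_prodMk_left),
      lintegral_withDensity_eq_lintegral_mul _ (measurable_gaussianPDF _ _)
        hSm,
      ← lintegral_indicator (hS.preimage measurable_prodMk_left)]
    refine lintegral_congr fun y => ?_
    by_cases hy : (p, y) ∈ S
    · simp only [Pi.mul_apply, Set.indicator, Set.mem_preimage, hy, if_true]
      rw [gaussianPDF, gaussianPDF, ← ENNReal.ofReal_mul (gaussianPDFReal_nonneg _ _ _)]
      congr 1
      rw [gaussianPDFReal, gaussianPDFReal, mul_assoc _ (Real.exp (-(y - m' p) ^ 2 / (2 * ↑s))),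
        ← Real.exp_add]
      congr 2
      simp only [hg]
      field_simp
      ring
    · simp [hy]
  have hac : μ ⊗ₘ shiftKernel m s ≪ μ ⊗ₘ shiftKernel m' s := by
    rw [hdens]; exact withDensity_absolutelyContinuous _ _
  have hllr : llr (μ ⊗ₘ shiftKernel m s) (μ ⊗ₘ shiftKernel m' s) =ᵐ[μ ⊗ₘ shiftKernel m s] g := by
    have h1 : (μ ⊗ₘ shiftKernel m s).rnDeriv (μ ⊗ₘ shiftKernel m' s) =ᵐ[μ ⊗ₘ shiftKernel m' s]
        fun q => ENNReal.ofReal (Real.exp (g q)) := by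
      conv_lhs => rw [hdens]
      exact Measure.rnDeriv_withDensity _ (by fun_prop)
    filter_upwards [hac.ae_le h1] with q hq
    rw [llr, hq, ENNReal.toReal_ofReal (Real.exp_pos _).le, Real.log_exp]
  have hT : Measurable fun q : E × ℝ => (q.1, m q.1 + q.2) := by fun_prop
  -- Written in terms of the noise z = y - m, the log-likelihood ratio has a cross term linear in z,
  -- which is centred.
  have hgT : (fun q : E × ℝ => g (q.1, m q.1 + q.2))
      = fun q => (m q.1 - m' q.1) ^ 2 / (2 * s) + (m q.1 - m' q.1) * q.2 / s := by
    funext q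
    simp only [hg]
    field_simp
    ring
  have I1 : Integrable (fun q : E × ℝ => (m q.1 - m' q.1) ^ 2 / (2 * s))
      (μ.prod (gaussianReal 0 s)) := (hint.integrable_sq.div_const _).comp_fst _
  have I2 : Integrable (fun q : E × ℝ => (m q.1 - m' q.1) * q.2 / s)
      (μ.prod (gaussianReal 0 s)) :=
    ((hint.integrable (by norm_num)).mul_prod
      (f := fun p => m p - m' p) (g := fun z : ℝ => z)
      ((memLp_id_gaussianReal 1).integrable (by norm_num))).div_const _
  have hgi : Integrable g (μ ⊗ₘ shiftKernel m s) := by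
    rw [compProd_shiftKernel hm, integrable_map_measure hgm.aestronglyMeasurable hT.aemeasurable]
    exact (integrable_congr (ae_of_all _ fun q => congrFun hgT q)).2 (I1.add I2)
  have hgint : ∫ q, g q ∂(μ ⊗ₘ shiftKernel m s) = (∫ p, (m p - m' p) ^ 2 ∂μ) / (2 * s) := by
    rw [compProd_shiftKernel hm, integral_map hT.aemeasurable hgm.aestronglyMeasurable]
    rw [hgT, integral_add I1 I2, integral_div, integral_div,
      integral_prod_mul (fun p => m p - m' p) (fun z : ℝ => z), integral_id_gaussianReal,
      integral_fun_fst (μ := μ) (ν := gaussianReal 0 s) (fun p => (m p - m' p) ^ 2)]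
    simp
  rw [klDiv_of_ac_of_integrable hac ((integrable_congr hllr).2 hgi), integral_congr_ae hllr, hgint]
  simp

lemma prod_compProd_assoc (μ : Measure E) [IsProbabilityMeasure μ] (Q : Measure F)
    [IsProbabilityMeasure Q] {m : F → ℝ} (hm : Measurable m) (s : ℝ≥0) :
    ((μ.prod Q) ⊗ₘ shiftKernel (fun p : E × F => m p.2) s).map (fun q => (q.1.1, (q.1.2, q.2)))
      = μ.prod (Q ⊗ₘ shiftKernel m s) := by
  have i2 := isMarkovKernel_shiftKernel hm s
  rw [compProd_shiftKernel (by fun_prop), compProd_shiftKernel hm, Measure.map_map (by fun_prop)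
    (by fun_prop)]
  conv_rhs => rw [← Measure.map_id (μ := μ)]
  rw [Measure.map_prod_map _ _ (by fun_prop) (by fun_prop), ← Measure.prodAssoc_prod,
    Measure.map_map (by fun_prop) (by fun_prop)]
  rfl

/-- Adding one output of a Gaussian channel to `Y` increases the divergence from a product measure
by at most the mean squared innovation over twice the noise variance. -/
lemma exists_klDiv_le_of_add_noise {P : Measure Ω} [IsProbabilityMeasure P] {X : Ω → E}
    {Y : Ω → F} (hX : Measurable X) (hY : Measurable Y) {m : E × F → ℝ} (hm : Measurable m)
    {m' : F → ℝ} (hm' : Measurable m') {s : ℝ≥0} (hs : s ≠ 0) {n : Ω → ℝ} (hn : Measurable n)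
    (hlaw : P.map n = gaussianReal 0 s) (hind : IndepFun (fun ω => (X ω, Y ω)) n P)
    (hint : MemLp (fun ω => m (X ω, Y ω) - m' (Y ω)) 2 P)
    (Q : Measure F) [IsProbabilityMeasure Q] :
    ∃ Q' : Measure (F × ℝ), IsProbabilityMeasure Q' ∧
      klDiv (P.map fun ω => (X ω, (Y ω, m (X ω, Y ω) + n ω))) ((P.map X).prod Q')
        ≤ klDiv (P.map fun ω => (X ω, Y ω)) ((P.map X).prod Q)
          + ENNReal.ofReal ((∫ ω, (m (X ω, Y ω) - m' (Y ω)) ^ 2 ∂P) / (2 * s)) := by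
  have i0 := isMarkovKernel_shiftKernel hm' s
  have i1 := isMarkovKernel_shiftKernel hm s
  have i2 := isMarkovKernel_shiftKernel (m := fun p : E × F => m' p.2) (by fun_prop) s
  have i3 := Measure.isProbabilityMeasure_map (μ := P) hX.aemeasurable
  have hXY : Measurable fun ω => (X ω, Y ω) := by fun_prop
  have i4 := Measure.isProbabilityMeasure_map (μ := P) hXY.aemeasurable
  have hT : Measurable fun q : (E × F) × ℝ => (q.1.1, (q.1.2, q.2)) := by fun_prop
  -- The reference law of the new output sees only Y, through the predictor m'. The chain rule then
  -- leaves the conditional divergence of two Gaussian kernels with the same variance.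
  refine ⟨Q ⊗ₘ shiftKernel m' s, inferInstance, ?_⟩
  have e1 : (P.map fun ω => (X ω, (Y ω, m (X ω, Y ω) + n ω)))
      = ((P.map fun ω => (X ω, Y ω)) ⊗ₘ shiftKernel m s).map
        (fun q : (E × F) × ℝ => (q.1.1, (q.1.2, q.2))) := by
    rw [← map_prodMk_add_noise hXY hm hn hlaw hind, Measure.map_map hT (by fun_prop)]
    rfl
  rw [e1, ← prod_compProd_assoc _ _ hm']
  refine (klDiv_map_le _ _ hT).trans ?_
  rw [klDiv_compProd_eq_add]
  gcongr
  have hint' : MemLp (fun p : E × F => m p - m' p.2) 2 (P.map fun ω => (X ω, Y ω)) :=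
    (memLp_map_measure_iff (Measurable.aestronglyMeasurable (by fun_prop)) hXY.aemeasurable).2 hint
  refine (klDiv_shiftKernel_le _ hm (by fun_prop) hs hint').trans (le_of_eq ?_)
  rw [integral_map hXY.aemeasurable (Measurable.aestronglyMeasurable (by fun_prop))]

lemma measurable_fin_snoc (n : ℕ) :
    Measurable fun q : (Fin n → ℝ) × ℝ => (Fin.snoc q.1 q.2 : Fin (n + 1) → ℝ) := by
  refine measurable_pi_lambda _ fun i => ?_
  refine Fin.lastCases ?_ (fun j => ?_) i
  · simpa using measurable_snd
  · simpa [Function.comp_def] using (measurable_pi_apply j).comp measurable_fst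

/-- The information that the outputs `Y k = m k (X, Y 0, …, Y (k-1)) + n k` of a Gaussian channel
with feedback carry about `X`, bounded by the mean squared error of any causal predictor `m'`. -/
theorem klDiv_gaussianChannel_le {P : Measure Ω} [IsProbabilityMeasure P] {X : Ω → E}
    (hX : Measurable X) {Y : ℕ → Ω → ℝ} {n : ℕ → Ω → ℝ}
    (hn : ∀ k, Measurable (n k)) {m : ∀ k : ℕ, E × (Fin k → ℝ) → ℝ} (hm : ∀ k, Measurable (m k))
    {m' : ∀ k : ℕ, (Fin k → ℝ) → ℝ} (hm' : ∀ k, Measurable (m' k)) {s : ℝ≥0} (hs : s ≠ 0)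
    (hY : ∀ k ω, Y k ω = m k (X ω, fun i => Y i ω) + n k ω)
    (hlaw : ∀ k, P.map (n k) = gaussianReal 0 s)
    (hind : ∀ k, IndepFun (fun ω => (X ω, fun i : Fin k => Y i ω)) (n k) P)
    (hint : ∀ k, MemLp (fun ω => m k (X ω, fun i => Y i ω) - m' k (fun i => Y i ω)) 2 P) (N : ℕ) :
    klDiv (P.map fun ω => (X ω, fun i : Fin N => Y i ω))
        ((P.map X).prod (P.map fun ω (i : Fin N) => Y i ω))
      ≤ ENNReal.ofReal (∑ k ∈ Finset.range N,
          (∫ ω, (m k (X ω, fun i => Y i ω) - m' k (fun i => Y i ω)) ^ 2 ∂P) / (2 * s)) := by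
  have hYm : ∀ N : ℕ, Measurable fun ω (i : Fin N) => Y i ω := by
    intro N
    induction N with
    | zero => exact measurable_pi_lambda _ fun i => i.elim0
    | succ N ih =>
      refine measurable_pi_lambda _ fun i => ?_
      refine Fin.lastCases ?_ (fun j => ?_) i
      · simp only [Fin.val_last]
        have : Y N = fun ω => m N (X ω, fun i => Y i ω) + n N ω := funext (hY N)
        rw [this]
        exact ((hm N).comp (hX.prodMk ih)).add (hn N)
      · simpa [Function.comp_def] using (measurable_pi_apply j).comp ih
  -- The induction produces a reference law Q that need not be the law of the outputs. The true
  -- marginal is put in at the end by `klDiv_prod_snd_le`.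
  have key : ∀ N : ℕ, ∃ Q : Measure (Fin N → ℝ), IsProbabilityMeasure Q ∧
      klDiv (P.map fun ω => (X ω, fun i : Fin N => Y i ω)) ((P.map X).prod Q)
      ≤ ENNReal.ofReal (∑ k ∈ Finset.range N,
          (∫ ω, (m k (X ω, fun i => Y i ω) - m' k (fun i => Y i ω)) ^ 2 ∂P) / (2 * s)) := by
    intro N
    have i3 := Measure.isProbabilityMeasure_map (μ := P) hX.aemeasurable
    induction N with
    | zero =>
      refine ⟨Measure.dirac 0, inferInstance, ?_⟩
      have : (fun ω => (X ω, fun i : Fin 0 => Y i ω)) = (fun e => (e, 0)) ∘ X := by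
        funext ω
        exact Prod.ext rfl (Subsingleton.elim _ _)
      rw [this, ← Measure.map_map (by fun_prop) hX, Measure.prod_dirac, klDiv_self]
      simp
    | succ N ih =>
      obtain ⟨Q, hQ, hle⟩ := ih
      obtain ⟨Q', hQ', hle'⟩ := exists_klDiv_le_of_add_noise hX (hYm N) (hm N) (hm' N) hs (hn N)
        (hlaw N) (hind N) (hint N) Q
      have hsn : Measurable (Prod.map id (fun q : (Fin N → ℝ) × ℝ =>
        (Fin.snoc q.1 q.2 : Fin (N + 1) → ℝ)) : E × _ → _) :=
          measurable_id.prodMap (measurable_fin_snoc N)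
      refine ⟨Q'.map (fun q => Fin.snoc q.1 q.2),
        Measure.isProbabilityMeasure_map (measurable_fin_snoc N).aemeasurable, ?_⟩
      have hYN : Measurable fun ω => (X ω, (fun i : Fin N => Y i ω,
          m N (X ω, fun i => Y i ω) + n N ω)) :=
        hX.prodMk ((hYm N).prodMk (((hm N).comp (hX.prodMk (hYm N))).add (hn N)))
      have e1 : (P.map fun ω => (X ω, fun i : Fin (N + 1) => Y i ω))
          = (P.map fun ω => (X ω, ((fun i : Fin N => Y i ω),
            m N (X ω, fun i => Y i ω) + n N ω))).map (Prod.map id fun q => Fin.snoc q.1 q.2) := by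
        rw [Measure.map_map hsn hYN]
        congr 1
        funext ω
        refine Prod.ext rfl (funext fun i => ?_)
        refine Fin.lastCases ?_ (fun j => ?_) i
        · simp [hY N ω]
        · simp
      have i5 := Measure.isProbabilityMeasure_map (μ := P) hYN.aemeasurable
      rw [e1]
      conv_lhs => rw [← Measure.map_id (μ := P.map X)]
      rw [Measure.map_prod_map _ _ measurable_id (measurable_fin_snoc N)]
      refine (klDiv_map_le _ _ hsn).trans (hle'.trans ?_)
      rw [Finset.sum_range_succ, ENNReal.ofReal_add]
      · gcongr
      · exact Finset.sum_nonneg fun k _ => by positivity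
      · positivity
  obtain ⟨Q, hQ, hle⟩ := key N
  have hJ : Measurable fun ω => (X ω, fun i : Fin N => Y i ω) := hX.prodMk (hYm N)
  have i6 := Measure.isProbabilityMeasure_map (μ := P) hJ.aemeasurable
  have := klDiv_prod_snd_le (P.map fun ω => (X ω, fun i : Fin N => Y i ω)) Q
  rw [Measure.fst_map_prodMk (hYm N), Measure.snd_map_prodMk hX] at this
  exact this.trans hle

end GaussianChannel

end GaussMarkov

namespace GaussMarkov

open InformationTheory

/-! ### Information lower bound for causal reconstructions of a Gauss-Markov sequence -/

section LowerBound

lemma log_gaussianPDFReal {v : ℝ≥0} (hv : v ≠ 0) (t : ℝ) :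
    Real.log (gaussianPDFReal 0 v t) = -(Real.log (2 * Real.pi * v)) / 2 - t ^ 2 / (2 * v) := by
  have hv0 : (0 : ℝ) < v := lt_of_le_of_ne v.2 (by exact_mod_cast hv.symm)
  rw [gaussianPDFReal, Real.log_mul (by positivity) (Real.exp_pos _).ne', Real.log_exp,
    Real.log_inv, Real.log_sqrt (by positivity)]
  ring

lemma exp_log_gaussianPDFReal {v : ℝ≥0} (hv : v ≠ 0) (t : ℝ) :
    Real.exp (Real.log (gaussianPDFReal 0 v t)) = gaussianPDFReal 0 v t :=
  Real.exp_log (gaussianPDFReal_pos _ _ _ hv)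

/-- Extension of a finite sequence by zero. -/
@[irreducible] def extendZero {N : ℕ} (u : Fin N → ℝ) (k : ℕ) : ℝ := if h : k < N then u ⟨k, h⟩ else 0

lemma measurable_extendZero (N k : ℕ) : Measurable fun u : Fin N → ℝ => extendZero u k := by
  unfold extendZero
  split_ifs <;> fun_prop

lemma measurable_extendZero_comp {α : Type*} [MeasurableSpace α] {N : ℕ} {u : α → Fin N → ℝ}
    (hu : Measurable u) (k : ℕ) : Measurable fun q => extendZero (u q) k :=
  (measurable_extendZero N k).comp hu

lemma extendZero_apply {N k : ℕ} (h : k < N) (f : ℕ → ℝ) :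
    extendZero (fun i : Fin N => f i) k = f k := by
  simp [extendZero, h]

/-- Logarithm of the likelihood ratio of the backward test channel, with gain `J` and variance `R`,
to the source with pole `a`, noise variance `v` and initial variance `S`. -/
noncomputable def logRatio (a J : ℝ) (R v S : ℝ≥0) (n : ℕ) (u w : ℕ → ℝ) : ℝ :=
  ∑ k ∈ Finset.range n, (Real.log (gaussianPDFReal 0 R (u k - w k - J * (u (k + 1) - a * w k)))
    - Real.log (gaussianPDFReal 0 v (u (k + 1) - a * u k)))
  - Real.log (gaussianPDFReal 0 S (u 0))

lemma logRatio_succ (a J : ℝ) (R v S : ℝ≥0) (n : ℕ) (u w : ℕ → ℝ) :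
    logRatio a J R v S (n + 1) u w = logRatio a J R v S n u w
      + (Real.log (gaussianPDFReal 0 R (u n - w n - J * (u (n + 1) - a * w n)))
    - Real.log (gaussianPDFReal 0 v (u (n + 1) - a * u n))) := by
  rw [logRatio, Finset.sum_range_succ, logRatio]
  ring

lemma logRatio_congr {a J : ℝ} {R v S : ℝ≥0} {n : ℕ} {u w u' w' : ℕ → ℝ}
    (hu : ∀ k ≤ n, u k = u' k) (hw : ∀ k < n, w k = w' k) :
    logRatio a J R v S n u w = logRatio a J R v S n u' w' := by
  unfold logRatio
  rw [hu 0 (Nat.zero_le _)]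
  congr 1
  refine Finset.sum_congr rfl fun k hk => ?_
  have hk' := Finset.mem_range.1 hk
  rw [hu k hk'.le, hu (k + 1) hk', hw k hk']

variable {Ω : Type*} [MeasurableSpace Ω] {P : Measure Ω}

lemma measurable_logRatio {a J : ℝ} {R v S : ℝ≥0} {n : ℕ} {α : Type*} [MeasurableSpace α]
    {u w : ℕ → α → ℝ} (hu : ∀ k, Measurable (u k)) (hw : ∀ k, Measurable (w k)) :
    Measurable fun p => logRatio a J R v S n (fun k => u k p) (fun k => w k p) := by
  unfold logRatio
  have h1 : ∀ V, Measurable fun t => Real.log (gaussianPDFReal 0 V t) := fun V =>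
    Real.measurable_log.comp (measurable_gaussianPDFReal _ _)
  refine Measurable.sub (Finset.measurable_sum _ fun k _ => Measurable.sub ?_ ?_) ?_
  · exact (h1 R).comp (((hu k).sub (hw k)).sub (((hu (k+1)).sub ((hw k).const_mul a)).const_mul J))
  · exact (h1 v).comp ((hu (k+1)).sub ((hu k).const_mul a))
  · exact (h1 S).comp (hu 0)

lemma lintegral_gaussianReal {v : ℝ≥0} (hv : v ≠ 0) {f : ℝ → ℝ≥0∞} (hf : Measurable f) :
    ∫⁻ t, f t ∂(gaussianReal 0 v) = ∫⁻ t, ENNReal.ofReal (gaussianPDFReal 0 v t) * f t := by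
  rw [gaussianReal_of_var_ne_zero _ hv,
    lintegral_withDensity_eq_lintegral_mul _ (measurable_gaussianPDF _ _) hf]
  rfl

lemma lintegral_gaussianPDFReal_sub {R : ℝ≥0} (hR : R ≠ 0) (c : ℝ) :
    ∫⁻ t, ENNReal.ofReal (gaussianPDFReal 0 R (t - c)) = 1 := by
  rw [lintegral_sub_right_eq_self (fun t => ENNReal.ofReal (gaussianPDFReal 0 R t)) c]
  exact lintegral_gaussianPDFReal_eq_one 0 hR

lemma measurable_fin_of_measurable {x : ℕ → Ω → ℝ} (hx : ∀ k, Measurable (x k)) (N : ℕ) :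
    Measurable fun ω (i : Fin N) => x i ω :=
  measurable_pi_lambda _ fun i => hx i

/-- The backward test channel has total mass one against the law of the source. -/
lemma lintegral_exp_logRatio [IsProbabilityMeasure P] {x : ℕ → Ω → ℝ} (hx : ∀ k, Measurable (x k)) {a : ℝ} (J : ℝ)
    {R v S : ℝ≥0} (hR : R ≠ 0) (hv : v ≠ 0) (hS : S ≠ 0) (hx0 : P.map (x 0) = gaussianReal 0 S)
    (hlaw : ∀ k, P.map (fun ω => x (k + 1) ω - a * x k ω) = gaussianReal 0 v)
    (hind : ∀ k, IndepFun (fun ω => x (k + 1) ω - a * x k ω) (fun ω (i : Fin (k + 1)) => x i ω) P)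
    (w : ℕ → ℝ) (n : ℕ) {ψ : ℝ → ℝ≥0∞} (hψ : Measurable ψ) :
    ∫⁻ ω, ENNReal.ofReal (Real.exp (logRatio a J R v S n (fun k => x k ω) w)) * ψ (x n ω) ∂P
      = ∫⁻ t, ψ t := by
  have hφ : ∀ V, Measurable fun t => gaussianPDFReal 0 V t := fun V =>
    measurable_gaussianPDFReal _ _
  have hlφ : ∀ V, Measurable fun t => Real.log (gaussianPDFReal 0 V t) := fun V =>
    Real.measurable_log.comp (measurable_gaussianPDFReal _ _)
  induction n generalizing ψ with
  | zero =>
    have h1 : ∀ ω, ENNReal.ofReal (Real.exp (logRatio a J R v S 0 (fun k => x k ω) w)) * ψ (x 0 ω)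
        = (fun t => ENNReal.ofReal (Real.exp (-Real.log (gaussianPDFReal 0 S t))) * ψ t) (x 0 ω) := by
      intro ω; simp [logRatio]
    have hm1 : Measurable fun t =>
        ENNReal.ofReal (Real.exp (-Real.log (gaussianPDFReal 0 S t))) * ψ t :=
      ((hlφ S).neg.exp.ennreal_ofReal).mul hψ
    simp_rw [h1]
    rw [← lintegral_map hm1 (hx 0), hx0, lintegral_gaussianReal hS hm1]
    refine lintegral_congr fun t => ?_
    have hp := gaussianPDFReal_pos 0 S t hS
    rw [← mul_assoc, ← ENNReal.ofReal_mul hp.le, Real.exp_neg, Real.exp_log hp,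
      mul_inv_cancel₀ hp.ne', ENNReal.ofReal_one, one_mul]
  | succ n ih =>
    set W : Ω → ℝ := fun ω => x (n + 1) ω - a * x n ω with hW
    have hWm : Measurable W := (hx (n + 1)).sub ((hx n).const_mul a)
    set Xn : Ω → (Fin (n + 1) → ℝ) := fun ω i => x i ω with hXn
    have hXm : Measurable Xn := measurable_fin_of_measurable hx (n + 1)
    set A : (Fin (n + 1) → ℝ) → ℝ≥0∞ := fun u =>
      ENNReal.ofReal (Real.exp (logRatio a J R v S n (extendZero u) w)) with hA
    have hAm : Measurable A := by
      refine (Measurable.exp ?_).ennreal_ofReal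
      exact measurable_logRatio (u := fun k u => extendZero u k) (w := fun k _ => w k)
        (fun k => measurable_extendZero _ k) (fun k => measurable_const)
    obtain ⟨Bf, hBf⟩ : ∃ B : ℝ → ℝ → ℝ≥0∞, B = fun s t => ENNReal.ofReal (Real.exp
      (Real.log (gaussianPDFReal 0 R (s - w n - J * (a * s + t - a * w n)))
        - Real.log (gaussianPDFReal 0 v t))) * ψ (a * s + t) := ⟨_, rfl⟩
    have hBm : Measurable fun q : ℝ × ℝ => Bf q.1 q.2 := by
      rw [hBf]
      refine ((((hlφ R).comp ?_).sub ((hlφ v).comp measurable_snd)).exp.ennreal_ofReal).mul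
        (hψ.comp ?_) <;> fun_prop
    have hBs : ∀ s, Measurable (Bf s) := fun s => hBm.comp measurable_prodMk_left
    have hAx : ∀ ω, A (Xn ω)
        = ENNReal.ofReal (Real.exp (logRatio a J R v S n (fun k => x k ω) w)) := by
      intro ω
      simp only [hA]
      rw [logRatio_congr (u' := fun k => x k ω) (w' := w)]
      · intro k hk
        exact extendZero_apply (N := n + 1) (k := k) (by omega) (fun k => x k ω)
      · exact fun _ _ => rfl
    have hsplit : ∀ ω, ENNReal.ofReal (Real.exp (logRatio a J R v S (n + 1) (fun k => x k ω) w))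
        * ψ (x (n + 1) ω) = (fun q : (Fin (n + 1) → ℝ) × ℝ =>
          A q.1 * Bf (extendZero q.1 n) q.2) (Xn ω, W ω) := by
      intro ω
      have e : extendZero (Xn ω) n = x n ω :=
        extendZero_apply (N := n + 1) (k := n) (by omega) (fun k => x k ω)
      simp only [hAx, e, hBf]
      rw [logRatio_succ, Real.exp_add, ENNReal.ofReal_mul (Real.exp_pos _).le, mul_assoc]
      simp only [hW]
      rw [add_sub_cancel]
    have hgm : Measurable fun q : (Fin (n + 1) → ℝ) × ℝ => A q.1 * Bf (extendZero q.1 n) q.2 := by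
      have h1 : Measurable fun q : (Fin (n + 1) → ℝ) × ℝ => (extendZero q.1 n, q.2) :=
        (measurable_extendZero_comp measurable_fst n).prodMk measurable_snd
      have h2 : Measurable fun q : (Fin (n + 1) → ℝ) × ℝ => A q.1 := hAm.comp measurable_fst
      have h3 : Measurable fun q : (Fin (n + 1) → ℝ) × ℝ => Bf (extendZero q.1 n) q.2 :=
        hBm.comp h1
      exact h2.mul h3
    have hXW : Measurable fun ω => (Xn ω, W ω) := hXm.prodMk hWm
    refine (lintegral_congr hsplit).trans ((lintegral_map hgm hXW).symm.trans ?_)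
    rw [(indepFun_iff_map_prod_eq_prod_map_map hXm.aemeasurable hWm.aemeasurable).1 (hind n).symm,
      hlaw n, lintegral_prod _ hgm.aemeasurable]
    -- The innovation law cancels the source density, and the last backward factor is absorbed into
    -- the test function; this is why ψ is arbitrary. The induction hypothesis turns the expectation
    -- into a Lebesgue integral, in which the backward density has mass one in s.
    set ψ' : ℝ → ℝ≥0∞ := fun s =>
      ∫⁻ t, ENNReal.ofReal (gaussianPDFReal 0 R (s - w n - J * (t - a * w n))) * ψ t with hψ'
    have hjm : Measurable fun q : ℝ × ℝ =>
        ENNReal.ofReal (gaussianPDFReal 0 R (q.1 - w n - J * (q.2 - a * w n))) * ψ q.2 :=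
      (((hφ R).comp (by fun_prop)).ennreal_ofReal).mul (hψ.comp measurable_snd)
    have hψ'm : Measurable ψ' := hjm.lintegral_prod_right'
    have hinner : ∀ s, ∫⁻ t, Bf s t ∂(gaussianReal 0 v) = ψ' s := by
      intro s
      rw [lintegral_gaussianReal hv (hBs s), hψ']
      simp only
      conv_rhs => rw [← lintegral_add_left_eq_self _ (a * s)]
      refine lintegral_congr fun t => ?_
      simp only [hBf]
      rw [← mul_assoc, ← ENNReal.ofReal_mul (gaussianPDFReal_nonneg _ _ _), Real.exp_sub,
        exp_log_gaussianPDFReal hR, exp_log_gaussianPDFReal hv,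
        mul_div_cancel₀ _ (gaussianPDFReal_pos _ _ _ hv).ne']
    have hstep : ∀ u : Fin (n + 1) → ℝ, ∫⁻ t, A u * Bf (extendZero u n) t ∂(gaussianReal 0 v)
        = A u * ψ' (extendZero u n) := by
      intro u
      rw [lintegral_const_mul _ (hBs _), hinner]
    simp_rw [hstep]
    have hAψ : Measurable fun u => A u * ψ' (extendZero u n) :=
      hAm.mul (hψ'm.comp (measurable_extendZero _ n))
    rw [lintegral_map hAψ hXm]
    have e : ∀ ω, extendZero (Xn ω) n = x n ω := fun ω =>
      extendZero_apply (N := n + 1) (k := n) (by omega) (fun k => x k ω)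
    simp_rw [hAx, e]
    rw [ih hψ'm, hψ', lintegral_lintegral_swap hjm.aemeasurable]
    refine lintegral_congr fun t => ?_
    have hm2 : Measurable fun s =>
        ENNReal.ofReal (gaussianPDFReal 0 R (s - w n - J * (t - a * w n))) :=
      ((hφ R).comp (by fun_prop)).ennreal_ofReal
    rw [lintegral_mul_const _ hm2]
    have : ∀ s, s - w n - J * (t - a * w n) = s - (w n + J * (t - a * w n)) := fun s => by ring
    simp_rw [this]
    rw [lintegral_gaussianPDFReal_sub hR, one_mul]

lemma memLp_of_map_gaussian {X : Ω → ℝ} (hX : Measurable X) {v : ℝ≥0}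
    (h : P.map X = gaussianReal 0 v) : MemLp X 2 P := by
  have : MemLp id 2 (P.map X) := h ▸ memLp_id_gaussianReal 2
  exact (memLp_map_measure_iff measurable_id.aestronglyMeasurable hX.aemeasurable).1 this

lemma integral_of_map_gaussian {X : Ω → ℝ} (hX : Measurable X) {v : ℝ≥0}
    (h : P.map X = gaussianReal 0 v) : ∫ ω, X ω ∂P = 0 := by
  have := integral_map (μ := P) (f := fun t : ℝ => t) hX.aemeasurable
    measurable_id.aestronglyMeasurable
  rw [← this, h, integral_id_gaussianReal]

lemma integral_sq_of_map_gaussian {X : Ω → ℝ} (hX : Measurable X) {v : ℝ≥0}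
    (h : P.map X = gaussianReal 0 v) : ∫ ω, X ω ^ 2 ∂P = v := by
  have h1 := variance_of_integral_eq_zero hX.aemeasurable (integral_of_map_gaussian hX h)
  rw [← h1]
  have h2 := variance_id_gaussianReal (μ := 0) (v := v)
  rw [← h, variance_map (by fun_prop) hX.aemeasurable] at h2
  exact_mod_cast h2

/-- The second moment of the sum of two orthogonal random variables. -/
lemma integral_sq_add_of_indepFun {X Y : Ω → ℝ} (hX : MemLp X 2 P) (hY : MemLp Y 2 P)
    (h0 : ∫ ω, Y ω ∂P = 0) (hind : IndepFun X Y P) (c d : ℝ) :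
    ∫ ω, (c * X ω + d * Y ω) ^ 2 ∂P = c ^ 2 * ∫ ω, X ω ^ 2 ∂P + d ^ 2 * ∫ ω, Y ω ^ 2 ∂P := by
  have e : ∀ ω, (c * X ω + d * Y ω) ^ 2
      = c ^ 2 * X ω ^ 2 + d ^ 2 * Y ω ^ 2 + 2 * c * d * (X ω * Y ω) := fun ω => by ring
  simp_rw [e]
  have i3 : Integrable (fun ω => X ω * Y ω) P := hX.integrable_mul hY
  have i4 : Integrable (fun ω => c ^ 2 * X ω ^ 2 + d ^ 2 * Y ω ^ 2) P :=
    (hX.integrable_sq.const_mul _).add (hY.integrable_sq.const_mul _)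
  rw [integral_add i4 (i3.const_mul _), integral_add (hX.integrable_sq.const_mul _) (hY.integrable_sq.const_mul _),
    integral_const_mul, integral_const_mul, integral_const_mul,
    hind.integral_fun_mul_eq_mul_integral hX.1 hY.1, h0]
  ring

lemma memLp_source {x : ℕ → Ω → ℝ} (hx : ∀ k, Measurable (x k)) {a : ℝ} {v S : ℝ≥0}
    (hx0 : P.map (x 0) = gaussianReal 0 S)
    (hlaw : ∀ k, P.map (fun ω => x (k + 1) ω - a * x k ω) = gaussianReal 0 v) (k : ℕ) :
    MemLp (x k) 2 P := by
  induction k with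
  | zero => exact memLp_of_map_gaussian (hx 0) hx0
  | succ k ih =>
    have h1 := memLp_of_map_gaussian ((hx (k + 1)).sub ((hx k).const_mul a)) (hlaw k)
    have h2 := h1.add (ih.const_mul a)
    refine h2.ae_eq (ae_of_all _ fun ω => ?_)
    simp

/-- Stability keeps the second moment bounded, so the terminal term of the information bound
disappears after division by the number of samples. -/
lemma integral_sq_source_le [IsProbabilityMeasure P] {x : ℕ → Ω → ℝ} (hx : ∀ k, Measurable (x k)) {a : ℝ} (ha : a ^ 2 < 1)
    {v S : ℝ≥0} (hx0 : P.map (x 0) = gaussianReal 0 S)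
    (hlaw : ∀ k, P.map (fun ω => x (k + 1) ω - a * x k ω) = gaussianReal 0 v)
    (hind : ∀ k, IndepFun (fun ω => x (k + 1) ω - a * x k ω) (x k) P) (k : ℕ) :
    ∫ ω, x k ω ^ 2 ∂P ≤ S + v / (1 - a ^ 2) := by
  have h1 : 0 < 1 - a ^ 2 := by linarith
  have hq : (0 : ℝ) ≤ v / (1 - a ^ 2) := by positivity
  induction k with
  | zero => rw [integral_sq_of_map_gaussian (hx 0) hx0]; linarith
  | succ k ih =>
    have hm : Measurable fun ω => x (k + 1) ω - a * x k ω := (hx (k + 1)).sub ((hx k).const_mul a)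
    have h2 := integral_sq_add_of_indepFun (memLp_source hx hx0 hlaw k)
      (memLp_of_map_gaussian hm (hlaw k)) (integral_of_map_gaussian hm (hlaw k)) (hind k).symm a 1
    rw [integral_sq_of_map_gaussian hm (hlaw k)] at h2
    have e : ∀ ω, a * x k ω + 1 * (x (k + 1) ω - a * x k ω) = x (k + 1) ω := fun ω => by ring
    simp_rw [e] at h2
    rw [h2]
    have h3 : a ^ 2 * ∫ ω, x k ω ^ 2 ∂P ≤ a ^ 2 * (S + v / (1 - a ^ 2)) := by gcongr
    have h4 : a ^ 2 * (S + v / (1 - a ^ 2)) + v ≤ S + v / (1 - a ^ 2) := by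
      have : a ^ 2 * (v / (1 - a ^ 2)) + v = v / (1 - a ^ 2) := by field_simp; ring
      have hS : (0:ℝ) ≤ S := S.2
      nlinarith
    linarith

/-- Lower bound on the information that any causal reconstruction `y` carries about a Gauss-Markov
source `x`, in terms of the mean squared errors. -/
theorem le_klDiv_of_causal [IsProbabilityMeasure P] {x y : ℕ → Ω → ℝ} (hx : ∀ k, Measurable (x k))
    (hy : ∀ k, Measurable (y k)) {a : ℝ} {v S : ℝ≥0} (hv : v ≠ 0) (hS : S ≠ 0)
    (hx0 : P.map (x 0) = gaussianReal 0 S)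
    (hlaw : ∀ k, P.map (fun ω => x (k + 1) ω - a * x k ω) = gaussianReal 0 v)
    (hind : ∀ k, IndepFun (fun ω => x (k + 1) ω - a * x k ω)
      (fun ω => ((fun i : Fin (k + 1) => x i ω), (fun i : Fin (k + 1) => y i ω))) P)
    (he : ∀ k, MemLp (fun ω => x k ω - y k ω) 2 P) {p : ℝ} (hp : 0 < p) (n : ℕ) :
    ENNReal.ofReal (n * (Real.log ((a ^ 2 * p + v) / p) / 2)
        - v / (2 * (a ^ 2 * p + v) * p)
          * (∑ k ∈ Finset.range n, ∫ ω, (x k ω - y k ω) ^ 2 ∂P - n * p)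
        + (Real.log S + 1 - ∫ ω, x n ω ^ 2 ∂P) / 2)
      ≤ klDiv (P.map fun ω => ((fun i : Fin (n + 1) => x i ω), (fun i : Fin (n + 1) => y i ω)))
        ((P.map fun ω (i : Fin (n + 1)) => x i ω).prod (P.map fun ω (i : Fin (n + 1)) => y i ω)) := by
  have hv0 : (0 : ℝ) < v := lt_of_le_of_ne v.2 (by exact_mod_cast hv.symm)
  have hS0 : (0 : ℝ) < S := lt_of_le_of_ne S.2 (by exact_mod_cast hS.symm)
  -- If x k - y k had variance p, the prediction variance would be pm, and J and R would be the gain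
  -- and the conditional variance of one-step smoothing from x (k + 1).
  set pm : ℝ := a ^ 2 * p + v with hpm
  have hpm0 : 0 < pm := by positivity
  set J : ℝ := a * p / pm with hJ
  set R : ℝ≥0 := ⟨p * v / pm, by positivity⟩ with hR
  have hRv : (R : ℝ) = p * v / pm := rfl
  have hR0 : (0 : ℝ) < R := by rw [hRv]; positivity
  have hRne : R ≠ 0 := by exact_mod_cast hR0.ne'
  have hXm := measurable_fin_of_measurable hx (n + 1)
  have hYm := measurable_fin_of_measurable hy (n + 1)
  -- The backward recursion needs some law of the last sample; a standard Gaussian is an arbitrary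
  -- choice that costs only a bounded term.
  set h : (Fin (n + 1) → ℝ) × (Fin (n + 1) → ℝ) → ℝ := fun q =>
    logRatio a J R v S n (extendZero q.1) (extendZero q.2)
      + Real.log (gaussianPDFReal 0 1 (extendZero q.1 n)) with hh
  have hhm : Measurable h := by
    have m1 : ∀ k, Measurable fun q : (Fin (n + 1) → ℝ) × (Fin (n + 1) → ℝ) => extendZero q.1 k :=
      fun k => measurable_extendZero_comp measurable_fst k
    have m2 : ∀ k, Measurable fun q : (Fin (n + 1) → ℝ) × (Fin (n + 1) → ℝ) => extendZero q.2 k :=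
      fun k => measurable_extendZero_comp measurable_snd k
    have m3 : Measurable fun q : (Fin (n + 1) → ℝ) × (Fin (n + 1) → ℝ) =>
      Real.log (gaussianPDFReal 0 1 (extendZero q.1 n)) :=
      Real.measurable_log.comp ((measurable_gaussianPDFReal 0 1).comp (m1 n))
    exact (measurable_logRatio m1 m2).add m3
  have hind' : ∀ k, IndepFun (fun ω => x (k + 1) ω - a * x k ω)
      (fun ω (i : Fin (k + 1)) => x i ω) P := fun k =>
    (hind k).comp measurable_id measurable_fst
  have hXY : Measurable fun ω => ((fun i : Fin (n + 1) => x i ω), (fun i : Fin (n + 1) => y i ω)) :=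
    hXm.prodMk hYm
  have j1 := Measure.isProbabilityMeasure_map (μ := P) hXm.aemeasurable
  have j2 := Measure.isProbabilityMeasure_map (μ := P) hYm.aemeasurable
  have j3 := Measure.isProbabilityMeasure_map (μ := P) hXY.aemeasurable
  have hhx : ∀ ω w, h ((fun i : Fin (n + 1) => x i ω), w)
      = logRatio a J R v S n (fun k => x k ω) (extendZero w)
        + Real.log (gaussianPDFReal 0 1 (x n ω)) := by
    intro ω w
    simp only [hh]
    rw [logRatio_congr (u' := fun k => x k ω) (w' := extendZero w)
      (fun k hk => extendZero_apply (N := n + 1) (k := k) (by omega) (fun k => x k ω)) (fun _ _ => rfl),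
      extendZero_apply (N := n + 1) (k := n) (by omega) (fun k => x k ω)]
  have hmass : ∫⁻ q, ENNReal.ofReal (Real.exp (h q))
      ∂((P.map fun ω (i : Fin (n + 1)) => x i ω).prod (P.map fun ω (i : Fin (n + 1)) => y i ω))
      ≤ 1 := by
    rw [lintegral_prod_symm _ (by fun_prop)]
    have : ∀ w, ∫⁻ u, ENNReal.ofReal (Real.exp (h (u, w)))
        ∂(P.map fun ω (i : Fin (n + 1)) => x i ω) = 1 := by
      intro w
      rw [lintegral_map (by fun_prop) hXm]
      simp_rw [hhx, Real.exp_add, ENNReal.ofReal_mul (Real.exp_pos _).le,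
        exp_log_gaussianPDFReal one_ne_zero]
      rw [lintegral_exp_logRatio hx J hRne hv hS hx0 hlaw hind' (extendZero w) n
        (ψ := fun t => ENNReal.ofReal (gaussianPDFReal 0 1 t))
        (measurable_gaussianPDFReal _ _).ennreal_ofReal]
      exact lintegral_gaussianPDFReal_eq_one 0 one_ne_zero
    simp_rw [this]
    simp
  have hxL := memLp_source hx hx0 hlaw
  set W : ℕ → Ω → ℝ := fun k ω => x (k + 1) ω - a * x k ω with hW
  have hWm : ∀ k, Measurable (W k) := fun k => (hx (k + 1)).sub ((hx k).const_mul a)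
  have hWL : ∀ k, MemLp (W k) 2 P := fun k => memLp_of_map_gaussian (hWm k) (hlaw k)
  have hWe : ∀ k, IndepFun (fun ω => x k ω - y k ω) (W k) P := by
    intro k
    have hm : Measurable fun q : (Fin (k + 1) → ℝ) × (Fin (k + 1) → ℝ) =>
      q.1 (Fin.last k) - q.2 (Fin.last k) := by fun_prop
    exact ((hind k).comp measurable_id hm).symm
  -- Since 1 - J a = v / pm, the backward residual is a combination of x k - y k and the noise W k,
  -- which are independent by causality.
  have hterm : ∀ k ω, Real.log (gaussianPDFReal 0 R (x k ω - y k ω - J * (x (k + 1) ω - a * y k ω)))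
      - Real.log (gaussianPDFReal 0 v (x (k + 1) ω - a * x k ω))
      = Real.log (pm / p) / 2 - (1 / (2 * R)) * ((v / pm) * (x k ω - y k ω) + (-J) * W k ω) ^ 2
        + (1 / (2 * v)) * (W k ω) ^ 2 := by
    intro k ω
    rw [log_gaussianPDFReal hRne, log_gaussianPDFReal hv]
    have e1 : x k ω - y k ω - J * (x (k + 1) ω - a * y k ω)
        = (v / pm) * (x k ω - y k ω) + (-J) * W k ω := by
      simp only [hW, hJ]
      field_simp
      rw [hpm]; ring
    have e2 : Real.log (pm / p) = Real.log (2 * Real.pi * v) - Real.log (2 * Real.pi * R) := by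
      rw [← Real.log_div (by positivity) (by positivity), hRv]
      congr 1
      field_simp
    rw [e1, e2]
    simp only [hW]
    ring
  have hI1 : ∀ k, Integrable (fun ω => ((v / pm) * (x k ω - y k ω) + (-J) * W k ω) ^ 2) P :=
    fun k => (((he k).const_mul _).add ((hWL k).const_mul _)).integrable_sq
  have hI2 : ∀ k, Integrable (fun ω => (W k ω) ^ 2) P := fun k => (hWL k).integrable_sq
  have hIt : ∀ k, Integrable (fun ω => Real.log (gaussianPDFReal 0 R
      (x k ω - y k ω - J * (x (k + 1) ω - a * y k ω)))
      - Real.log (gaussianPDFReal 0 v (x (k + 1) ω - a * x k ω))) P := by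
    intro k
    simp_rw [hterm]
    exact ((integrable_const _).sub ((hI1 k).const_mul _)).add ((hI2 k).const_mul _)
  -- The result is affine in the mean squared error: the tangent at p of the convex function V ↦ ½
  -- log (a² + v / V). Hence only the sum of the errors matters.
  have hterm_int : ∀ k, ∫ ω, (Real.log (gaussianPDFReal 0 R
      (x k ω - y k ω - J * (x (k + 1) ω - a * y k ω)))
      - Real.log (gaussianPDFReal 0 v (x (k + 1) ω - a * x k ω))) ∂P
      = Real.log (pm / p) / 2 - v / (2 * pm * p) * (∫ ω, (x k ω - y k ω) ^ 2 ∂P - p) := by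
    intro k
    simp_rw [hterm]
    have hI4 : Integrable (fun ω => Real.log (pm / p) / 2
        - (1 / (2 * R)) * ((v / pm) * (x k ω - y k ω) + (-J) * W k ω) ^ 2) P :=
      (integrable_const _).sub ((hI1 k).const_mul _)
    rw [integral_add hI4 ((hI2 k).const_mul _),
      integral_sub (integrable_const _) ((hI1 k).const_mul _), integral_const_mul,
      integral_const_mul, integral_sq_add_of_indepFun (he k) (hWL k)
        (integral_of_map_gaussian (hWm k) (hlaw k)) (hWe k),
      integral_sq_of_map_gaussian (hWm k) (hlaw k), hRv, hJ]
    simp only [integral_const, probReal_univ, smul_eq_mul, one_mul]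
    field_simp
    rw [hpm]
    ring
  have hl1 : ∀ ω, Real.log (gaussianPDFReal 0 1 (x n ω))
      = -Real.log (2 * Real.pi) / 2 - (1 / 2) * x n ω ^ 2 := by
    intro ω
    rw [log_gaussianPDFReal one_ne_zero]
    simp
    ring
  have hl0 : ∀ ω, Real.log (gaussianPDFReal 0 S (x 0 ω))
      = -Real.log (2 * Real.pi * S) / 2 - (1 / (2 * S)) * x 0 ω ^ 2 := by
    intro ω
    rw [log_gaussianPDFReal hS]
    ring
  have hIl1 : Integrable (fun ω => Real.log (gaussianPDFReal 0 1 (x n ω))) P := by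
    simp_rw [hl1]
    exact (integrable_const _).sub ((hxL n).integrable_sq.const_mul _)
  have hIl0 : Integrable (fun ω => Real.log (gaussianPDFReal 0 S (x 0 ω))) P := by
    simp_rw [hl0]
    exact (integrable_const _).sub ((hxL 0).integrable_sq.const_mul _)
  have hhxy : ∀ ω, h ((fun i : Fin (n + 1) => x i ω), (fun i : Fin (n + 1) => y i ω))
      = ∑ k ∈ Finset.range n, (Real.log (gaussianPDFReal 0 R
      (x k ω - y k ω - J * (x (k + 1) ω - a * y k ω)))
      - Real.log (gaussianPDFReal 0 v (x (k + 1) ω - a * x k ω)))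
      - Real.log (gaussianPDFReal 0 S (x 0 ω)) + Real.log (gaussianPDFReal 0 1 (x n ω)) := by
    intro ω
    rw [hhx, logRatio_congr (u' := fun k => x k ω) (w' := fun k => y k ω) (fun _ _ => rfl)
      (fun k hk => extendZero_apply (N := n + 1) (k := k) (by omega) (fun k => y k ω))]
    rfl
  have hIs := integrable_finsetSum (Finset.range n) fun k _ => hIt k
  have hhint : Integrable h
      (P.map fun ω => ((fun i : Fin (n + 1) => x i ω), (fun i : Fin (n + 1) => y i ω))) := by
    rw [integrable_map_measure hhm.aestronglyMeasurable hXY.aemeasurable]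
    exact (integrable_congr (ae_of_all _ hhxy)).2 ((hIs.sub hIl0).add hIl1)
  have hval : ∫ q, h q
      ∂(P.map fun ω => ((fun i : Fin (n + 1) => x i ω), (fun i : Fin (n + 1) => y i ω)))
      = n * (Real.log (pm / p) / 2) - v / (2 * pm * p)
          * (∑ k ∈ Finset.range n, ∫ ω, (x k ω - y k ω) ^ 2 ∂P - n * p)
        + (Real.log S + 1 - ∫ ω, x n ω ^ 2 ∂P) / 2 := by
    rw [integral_map hXY.aemeasurable hhm.aestronglyMeasurable]
    simp_rw [hhxy]
    have hI3 : Integrable (fun ω => ∑ k ∈ Finset.range n, (Real.log (gaussianPDFReal 0 R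
      (x k ω - y k ω - J * (x (k + 1) ω - a * y k ω)))
      - Real.log (gaussianPDFReal 0 v (x (k + 1) ω - a * x k ω)))) P := hIs
    have hI4 : Integrable (fun ω => ∑ k ∈ Finset.range n, (Real.log (gaussianPDFReal 0 R
      (x k ω - y k ω - J * (x (k + 1) ω - a * y k ω)))
      - Real.log (gaussianPDFReal 0 v (x (k + 1) ω - a * x k ω)))
      - Real.log (gaussianPDFReal 0 S (x 0 ω))) P := hI3.sub hIl0
    rw [integral_add hI4 hIl1, integral_sub hI3 hIl0,
      integral_finsetSum _ fun k _ => hIt k]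
    simp_rw [hterm_int]
    simp_rw [hl1, hl0]
    rw [integral_sub (integrable_const _) ((hxL n).integrable_sq.const_mul _),
      integral_sub (integrable_const _) ((hxL 0).integrable_sq.const_mul _), integral_const_mul,
      integral_const_mul, integral_sq_of_map_gaussian (hx 0) hx0]
    simp only [integral_const, probReal_univ, smul_eq_mul, one_mul]
    rw [Finset.sum_sub_distrib, ← Finset.mul_sum, Finset.sum_sub_distrib,
      Real.log_mul (by positivity) hS0.ne']
    simp only [Finset.sum_const, Finset.card_range, nsmul_eq_mul]
    field_simp
    ring
  rw [← hval]
  exact ofReal_integral_le_klDiv hhm hhint hmass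

end LowerBound

end GaussMarkov

namespace GaussMarkov

open InformationTheory

/-! ### Data processing, and time averages of affine bounds -/

section MutualInfo

/-- Data processing for mutual information. -/
lemma mutualInfo_comp_le {Ω E F E' F' : Type*} [MeasurableSpace Ω] [MeasurableSpace E]
    [MeasurableSpace F] [MeasurableSpace E'] [MeasurableSpace F'] (P : Measure Ω)
    [IsProbabilityMeasure P] {X : Ω → E} {Y : Ω → F} (hX : Measurable X) (hY : Measurable Y)
    {f : E → E'} {g : F → F'} (hf : Measurable f) (hg : Measurable g) :
    mutualInfo P (fun ω => f (X ω)) (fun ω => g (Y ω)) ≤ mutualInfo P X Y := by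
  unfold mutualInfo
  gcongr
  have i1 := Measure.isProbabilityMeasure_map (μ := P) hX.aemeasurable
  have i2 := Measure.isProbabilityMeasure_map (μ := P) hY.aemeasurable
  have i3 := Measure.isProbabilityMeasure_map (μ := P) (hX.prodMk hY).aemeasurable
  have e1 : (P.map fun ω => (f (X ω), g (Y ω))) = (P.map fun ω => (X ω, Y ω)).map (Prod.map f g) := by
    rw [Measure.map_map (hf.prodMap hg) (hX.prodMk hY)]
    rfl
  have e2 : (P.map fun ω => f (X ω)) = (P.map X).map f := (Measure.map_map hf hX).symm
  have e3 : (P.map fun ω => g (Y ω)) = (P.map Y).map g := (Measure.map_map hg hY).symm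
  rw [e1, e2, e3, Measure.map_prod_map _ _ hf hg]
  exact klDiv_map_le _ _ (hf.prodMap hg)

lemma mutualInfo_map {Ω Ω' E F : Type*} [MeasurableSpace Ω] [MeasurableSpace Ω']
    [MeasurableSpace E] [MeasurableSpace F] (P : Measure Ω) {T : Ω → Ω'} (hT : Measurable T)
    {X : Ω' → E} {Y : Ω' → F} (hX : Measurable X) (hY : Measurable Y) :
    mutualInfo (P.map T) X Y = mutualInfo P (fun ω => X (T ω)) (fun ω => Y (T ω)) := by
  unfold mutualInfo
  rw [Measure.map_map (hX.prodMk hY) hT, Measure.map_map hX hT, Measure.map_map hY hT]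
  rfl

end MutualInfo

section Limsup

lemma tendsto_ofReal_affine_div (α β : ℝ) :
    Tendsto (fun K : ℕ => ENNReal.ofReal (K * α + β) / (K : ℝ≥0∞)) atTop (𝓝 (ENNReal.ofReal α)) := by
  have h1 : Tendsto (fun K : ℕ => ENNReal.ofReal (α + β / K)) atTop (𝓝 (ENNReal.ofReal α)) := by
    refine (ENNReal.continuous_ofReal.tendsto _).comp ?_
    simpa using tendsto_const_nhds.add (tendsto_const_div_atTop_nhds_zero_nat β)
  refine h1.congr' ?_
  filter_upwards [eventually_gt_atTop 0] with K hK
  have hK0 : (0 : ℝ) < K := by exact_mod_cast hK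
  rw [← ENNReal.ofReal_natCast K, ← ENNReal.ofReal_div_of_pos hK0]
  congr 1
  field_simp

lemma le_limsup_of_affine_le {u : ℕ → ℝ≥0∞} {α β : ℝ}
    (h : ∀ᶠ K : ℕ in atTop, ENNReal.ofReal (K * α + β) / (K : ℝ≥0∞) ≤ u K) :
    ENNReal.ofReal α ≤ limsup u atTop := by
  rw [← (tendsto_ofReal_affine_div α β).limsup_eq]
  exact limsup_le_limsup h

lemma limsup_le_of_le_affine {u : ℕ → ℝ≥0∞} {α β : ℝ}
    (h : ∀ᶠ K : ℕ in atTop, u K ≤ ENNReal.ofReal (K * α + β) / (K : ℝ≥0∞)) :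
    limsup u atTop ≤ ENNReal.ofReal α := by
  rw [← (tendsto_ofReal_affine_div α β).limsup_eq]
  exact limsup_le_limsup h

end Limsup

/-! ### A stationary linear reconstruction of the sampled source -/

section LinearPolicy

lemma measurable_pi_of_forall {α ι : Type*} {m : MeasurableSpace α} {f : α → ι → ℝ}
    (h : ∀ i, Measurable[m] fun a => f a i) : Measurable[m] f :=
  measurable_pi_lambda _ h

/-- The Gauss-Markov source driven by the noise coordinates `ω (inl k)`. -/
def srcProc (a : ℝ) : ℕ → (ℕ ⊕ ℕ → ℝ) → ℝ
  | 0, ω => ω (Sum.inl 0)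
  | k + 1, ω => a * srcProc a k ω + ω (Sum.inl (k + 1))

/-- The reconstruction by a linear recursion with gain `G` and noise coordinates `ω (inr k)`. -/
def recProc (a G : ℝ) : ℕ → (ℕ ⊕ ℕ → ℝ) → ℝ
  | 0, ω => G * srcProc a 0 ω + ω (Sum.inr 0)
  | k + 1, ω => (1 - G) * a * recProc a G k ω + G * srcProc a (k + 1) ω + ω (Sum.inr (k + 1))

lemma measurable_srcProc (a : ℝ) {m : MeasurableSpace (ℕ ⊕ ℕ → ℝ)} (k : ℕ)
    (h : ∀ i ≤ k, Measurable[m] fun ω : ℕ ⊕ ℕ → ℝ => ω (Sum.inl i)) :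
    Measurable[m] (srcProc a k) := by
  induction k with
  | zero => exact h 0 le_rfl
  | succ k ih =>
    exact ((ih fun i hi => h i (hi.trans (Nat.le_succ k))).const_mul a).add (h (k + 1) le_rfl)

lemma measurable_recProc (a G : ℝ) {m : MeasurableSpace (ℕ ⊕ ℕ → ℝ)} (k : ℕ)
    (h : ∀ i ≤ k, Measurable[m] fun ω : ℕ ⊕ ℕ → ℝ => ω (Sum.inl i))
    (h' : ∀ i ≤ k, Measurable[m] fun ω : ℕ ⊕ ℕ → ℝ => ω (Sum.inr i)) :
    Measurable[m] (recProc a G k) := by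
  induction k with
  | zero => exact ((measurable_srcProc a 0 h).const_mul G).add (h' 0 le_rfl)
  | succ k ih =>
    exact (((ih (fun i hi => h i (hi.trans (Nat.le_succ k)))
      (fun i hi => h' i (hi.trans (Nat.le_succ k)))).const_mul ((1 - G) * a)).add
      ((measurable_srcProc a (k + 1) h).const_mul G)).add (h' (k + 1) le_rfl)

/-- The law of the noise coordinates. -/
noncomputable def noiseLaw (S v s : ℝ≥0) : ℕ ⊕ ℕ → Measure ℝ
  | Sum.inl 0 => gaussianReal 0 S
  | Sum.inl (_ + 1) => gaussianReal 0 v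
  | Sum.inr _ => gaussianReal 0 s

instance (S v s : ℝ≥0) (i : ℕ ⊕ ℕ) : IsProbabilityMeasure (noiseLaw S v s i) := by
  rcases i with (_ | _) | _ <;> (unfold noiseLaw; infer_instance)

/-- The product law of all noise coordinates. -/
noncomputable def noiseMeasure (S v s : ℝ≥0) : Measure (ℕ ⊕ ℕ → ℝ) :=
  Measure.infinitePi (noiseLaw S v s)

instance (S v s : ℝ≥0) : IsProbabilityMeasure (noiseMeasure S v s) := by
  unfold noiseMeasure; infer_instance

/-- The σ-algebra generated by the noise coordinates in `T`. -/
abbrev coordAlgebra (T : Set (ℕ ⊕ ℕ)) : MeasurableSpace (ℕ ⊕ ℕ → ℝ) :=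
  ⨆ i ∈ T, MeasurableSpace.comap (fun ω : ℕ ⊕ ℕ → ℝ => ω i) inferInstance

lemma measurable_coord {T : Set (ℕ ⊕ ℕ)} {i : ℕ ⊕ ℕ} (hi : i ∈ T) :
    Measurable[coordAlgebra T] fun ω : ℕ ⊕ ℕ → ℝ => ω i :=
  Measurable.mono (comap_measurable _) (le_iSup₂_of_le i hi le_rfl) le_rfl

/-- Disjoint families of coordinates of a product measure are independent. Every independence used
for the linear policy is reduced to a measurability check through this lemma. -/
lemma indepFun_coord (S v s : ℝ≥0) {T : Set (ℕ ⊕ ℕ)} {i : ℕ ⊕ ℕ} (hi : i ∉ T) {E : Type*}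
    [MeasurableSpace E] {f : (ℕ ⊕ ℕ → ℝ) → E} (hf : Measurable[coordAlgebra T] f) :
    IndepFun f (fun ω => ω i) (noiseMeasure S v s) := by
  have h := iIndepFun_infinitePi (P := noiseLaw S v s) (X := fun _ t => t) fun _ => measurable_id
  have h2 := indep_iSup_of_disjoint (fun j => (measurable_pi_apply j).comap_le) h
    (S := T) (T := {i}) (by simpa using hi)
  rw [IndepFun_iff_Indep]
  refine indep_of_indep_of_le_left (indep_of_indep_of_le_right h2 ?_) hf.comap_le
  simp

lemma map_coord (S v s : ℝ≥0) (i : ℕ ⊕ ℕ) :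
    (noiseMeasure S v s).map (fun ω => ω i) = noiseLaw S v s i :=
  Measure.infinitePi_map_eval _ i

variable (a G : ℝ) (S v s : ℝ≥0)

lemma measurable_srcProc' (k : ℕ) : Measurable (srcProc a k) :=
  measurable_srcProc a k fun _ _ => measurable_pi_apply _

lemma measurable_recProc' (k : ℕ) : Measurable (recProc a G k) :=
  measurable_recProc a G k (fun _ _ => measurable_pi_apply _) fun _ _ => measurable_pi_apply _

/-- The linear policy. -/
noncomputable def linearPolicy : ReconPolicy where
  kern k := shiftKernel (fun q : (Fin k → ℝ) × (Fin (k + 1) → ℝ) =>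
    (1 - G) * a * extendZero q.1 (k - 1) + G * q.2 (Fin.last k)) s
  markov k := isMarkovKernel_shiftKernel
    (((measurable_extendZero_comp measurable_fst _).const_mul _).add (by fun_prop)) s

/-- The joint law of the source and of its reconstruction by the linear policy. -/
noncomputable def linearLaw : Measure ((ℕ → ℝ) × (ℕ → ℝ)) :=
  (noiseMeasure S v s).map fun ω => (fun k => srcProc a k ω, fun k => recProc a G k ω)

lemma measurable_procs :
    Measurable fun ω => ((fun k => srcProc a k ω, fun k => recProc a G k ω) : (ℕ → ℝ) × (ℕ → ℝ)) :=
  (measurable_pi_lambda _ fun k => measurable_srcProc' a k).prodMk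
    (measurable_pi_lambda _ fun k => measurable_recProc' a G k)

/-- One formula for all steps. At k = 0 the subtraction k - 1 truncates and the empty sequence
extends to zero, so the previous reconstruction counts as 0. -/
lemma recProc_eq (k : ℕ) (ω : ℕ ⊕ ℕ → ℝ) :
    recProc a G k ω = (1 - G) * a * extendZero (fun i : Fin k => recProc a G i ω) (k - 1)
      + G * srcProc a k ω + ω (Sum.inr k) := by
  cases k with
  | zero => simp [recProc, extendZero]
  | succ k =>
    rw [extendZero_apply (N := k + 1) (k := k + 1 - 1) (by omega) (fun i => recProc a G i ω)]
    simp [recProc]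

/-- The noise coordinates that determine the source, and the reconstruction before time `k`. -/
def pastCoords (k : ℕ) : Set (ℕ ⊕ ℕ) := {i | ∀ j, i = Sum.inr j → j < k}

lemma measurable_rec_past {k i : ℕ} (hi : i < k) :
    Measurable[coordAlgebra (pastCoords k)] (recProc a G i) :=
  measurable_recProc a G i (fun j _ => measurable_coord (by simp [pastCoords]))
    fun j hj => measurable_coord (by simp [pastCoords]; omega)

/-- The index i is unrestricted: the source is not influenced by the reconstruction, so the
reconstruction noise at step k is independent of the entire source. This lets the whole source path
be the channel input. -/
lemma measurable_src_past (k i : ℕ) :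
    Measurable[coordAlgebra (pastCoords k)] (srcProc a i) :=
  measurable_srcProc a i fun j _ => measurable_coord (by simp [pastCoords])

lemma isInducedLaw_linearLaw {b : ℝ} (hv : v = Real.toNNReal (b ^ 2)) :
    IsInducedLaw a b S (linearPolicy a G s) (linearLaw a G S v s) := by
  have hm := measurable_procs a G
  constructor
  · exact Measure.isProbabilityMeasure_map hm.aemeasurable
  · rw [linearLaw, Measure.map_map (by fun_prop) hm]
    exact map_coord S v s (Sum.inl 0)
  · intro k
    rw [linearLaw, Measure.map_map (by fun_prop) hm, ← hv]
    refine Eq.trans ?_ (map_coord S v s (Sum.inl (k + 1)))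
    congr 1
    funext ω
    simp [srcProc]
  · intro k
    have h0 : IndepFun (fun ω => ((fun i : Fin (k + 1) => srcProc a i ω),
        (fun i : Fin (k + 1) => recProc a G i ω))) (fun ω => ω (Sum.inl (k + 1)))
        (noiseMeasure S v s) := by
      refine indepFun_coord S v s (T := {i | i ≠ Sum.inl (k + 1)}) (by simp) ?_
      have hl : ∀ i ≤ k, Measurable[coordAlgebra {i | i ≠ Sum.inl (k + 1)}]
          fun ω : ℕ ⊕ ℕ → ℝ => ω (Sum.inl i) := fun i hi =>
        measurable_coord (by simp; omega)
      have hr : ∀ i ≤ k, Measurable[coordAlgebra {i | i ≠ Sum.inl (k + 1)}]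
          fun ω : ℕ ⊕ ℕ → ℝ => ω (Sum.inr i) := fun i hi =>
        measurable_coord (by simp)
      refine Measurable.prodMk (measurable_pi_of_forall fun i => ?_)
        (measurable_pi_of_forall fun i => ?_)
      · exact measurable_srcProc a i fun j hj => hl j (by omega)
      · exact measurable_recProc a G i (fun j hj => hl j (by omega)) (fun j hj => hr j (by omega))
    rw [linearLaw, indepFun_iff_map_prod_eq_prod_map_map (by fun_prop) (by fun_prop),
      Measure.map_map (by fun_prop) hm, Measure.map_map (by fun_prop) hm,
      Measure.map_map (by fun_prop) hm]
    have h1 := (indepFun_iff_map_prod_eq_prod_map_map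
      (measurable_pi_apply (Sum.inl (k + 1))).aemeasurable
      (Measurable.aemeasurable (by
        exact (measurable_fin_of_measurable (measurable_srcProc' a) (k + 1)).prodMk
          (measurable_fin_of_measurable (measurable_recProc' a G) (k + 1))))).1 h0.symm
    have e : ∀ ω, srcProc a (k + 1) ω - a * srcProc a k ω = ω (Sum.inl (k + 1)) := fun ω => by
      simp [srcProc]
    simp only [Function.comp_def, e]
    exact h1
  · intro k
    rw [linearLaw, Measure.map_map (by fun_prop) hm, Measure.map_map (by fun_prop) hm]
    have hX : Measurable fun ω => ((fun i : Fin k => recProc a G i ω),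
        (fun i : Fin (k + 1) => srcProc a i ω)) :=
      (measurable_fin_of_measurable (measurable_recProc' a G) k).prodMk
        (measurable_fin_of_measurable (measurable_srcProc' a) (k + 1))
    have hind : IndepFun (fun ω => ((fun i : Fin k => recProc a G i ω),
        (fun i : Fin (k + 1) => srcProc a i ω))) (fun ω => ω (Sum.inr k)) (noiseMeasure S v s) := by
      refine indepFun_coord S v s (T := pastCoords k) (by simp [pastCoords]) ?_
      exact Measurable.prodMk (measurable_pi_of_forall fun i => measurable_rec_past a G i.2)
        (measurable_pi_of_forall fun i => measurable_src_past a k i)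
    have hmean : Measurable fun q : (Fin k → ℝ) × (Fin (k + 1) → ℝ) =>
        (1 - G) * a * extendZero q.1 (k - 1) + G * q.2 (Fin.last k) :=
      ((measurable_extendZero_comp measurable_fst _).const_mul _).add (by fun_prop)
    have := map_prodMk_add_noise hX hmean (measurable_pi_apply (Sum.inr k))
      (map_coord S v s (Sum.inr k)) hind
    simp only [Function.comp_def]
    rw [linearPolicy]
    simp only
    refine Eq.trans ?_ this
    congr 1
    funext ω
    rw [recProc_eq]
    rfl

lemma memLp_coord (i : ℕ ⊕ ℕ) : MemLp (fun ω : ℕ ⊕ ℕ → ℝ => ω i) 2 (noiseMeasure S v s) := by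
  rcases i with (_ | k) | k
  · exact memLp_of_map_gaussian (measurable_pi_apply _) (map_coord S v s _)
  · exact memLp_of_map_gaussian (measurable_pi_apply _) (map_coord S v s _)
  · exact memLp_of_map_gaussian (measurable_pi_apply _) (map_coord S v s _)

lemma memLp_srcProc (k : ℕ) : MemLp (srcProc a k) 2 (noiseMeasure S v s) := by
  induction k with
  | zero => exact memLp_coord S v s _
  | succ k ih => exact (ih.const_mul a).add (memLp_coord S v s _)

lemma memLp_recProc (k : ℕ) : MemLp (recProc a G k) 2 (noiseMeasure S v s) := by
  induction k with
  | zero => exact ((memLp_srcProc a S v s 0).const_mul G).add (memLp_coord S v s _)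
  | succ k ih =>
    exact ((ih.const_mul ((1 - G) * a)).add ((memLp_srcProc a S v s (k + 1)).const_mul G)).add
      (memLp_coord S v s _)

/-- The mean squared prediction error of the linear policy before the step `k`. -/
noncomputable def predErr (k : ℕ) : ℝ :=
  ∫ ω, (srcProc a k ω - a * extendZero (fun i : Fin k => recProc a G i ω) (k - 1)) ^ 2
    ∂(noiseMeasure S v s)

lemma memLp_prediction (k : ℕ) :
    MemLp (fun ω => srcProc a k ω - a * extendZero (fun i : Fin k => recProc a G i ω) (k - 1)) 2
      (noiseMeasure S v s) := by
  cases k with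
  | zero => simpa [extendZero] using memLp_srcProc a S v s 0
  | succ k =>
    have : ∀ ω, extendZero (fun i : Fin (k + 1) => recProc a G i ω) (k + 1 - 1) = recProc a G k ω :=
      fun ω => extendZero_apply (N := k + 1) (k := k + 1 - 1) (by omega) (fun i => recProc a G i ω)
    simp_rw [this]
    exact (memLp_srcProc a S v s (k + 1)).sub ((memLp_recProc a G S v s k).const_mul a)

/-- The error is (1 - G) times the prediction error minus the fresh reconstruction noise, and these
two are independent. -/
lemma integral_sq_linear_err (k : ℕ) :
    ∫ ω, (srcProc a k ω - recProc a G k ω) ^ 2 ∂(noiseMeasure S v s)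
      = (1 - G) ^ 2 * predErr a G S v s k + s := by
  have e : ∀ ω, srcProc a k ω - recProc a G k ω = (1 - G) *
      (srcProc a k ω - a * extendZero (fun i : Fin k => recProc a G i ω) (k - 1))
      + (-1) * ω (Sum.inr k) := fun ω => by rw [recProc_eq a G k ω]; ring
  simp_rw [e]
  rw [integral_sq_add_of_indepFun (memLp_prediction a G S v s k) (memLp_coord S v s _)
    (integral_of_map_gaussian (measurable_pi_apply _) (map_coord S v s (Sum.inr k))),
    integral_sq_of_map_gaussian (measurable_pi_apply _) (map_coord S v s (Sum.inr k)), predErr]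
  · ring
  · refine indepFun_coord S v s (T := pastCoords k) (by simp [pastCoords]) ?_
    refine (measurable_src_past a k k).sub (Measurable.const_mul ?_ a)
    exact (measurable_extendZero k (k - 1)).comp
      (measurable_pi_of_forall fun i : Fin k => measurable_rec_past a G i.2)

lemma predErr_succ (k : ℕ) : predErr a G S v s (k + 1)
    = a ^ 2 * ((1 - G) ^ 2 * predErr a G S v s k + s) + v := by
  rw [← integral_sq_linear_err, predErr]
  have e : ∀ ω, srcProc a (k + 1) ω
      - a * extendZero (fun i : Fin (k + 1) => recProc a G i ω) (k + 1 - 1)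
      = a * (srcProc a k ω - recProc a G k ω) + 1 * ω (Sum.inl (k + 1)) := fun ω => by
    rw [extendZero_apply (N := k + 1) (k := k + 1 - 1) (by omega) (fun i => recProc a G i ω)]
    simp [srcProc]
    ring
  simp_rw [e]
  have hL : MemLp (fun ω => srcProc a k ω - recProc a G k ω) 2 (noiseMeasure S v s) :=
    (memLp_srcProc a S v s k).sub (memLp_recProc a G S v s k)
  rw [integral_sq_add_of_indepFun hL
    (memLp_coord S v s _)
    (integral_of_map_gaussian (measurable_pi_apply _) (map_coord S v s (Sum.inl (k + 1)))),
    integral_sq_of_map_gaussian (measurable_pi_apply _) (map_coord S v s (Sum.inl (k + 1)))]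
  · simp
  · refine indepFun_coord S v s (T := {i | i ≠ Sum.inl (k + 1)}) (by simp) ?_
    have hl : ∀ i ≤ k, Measurable[coordAlgebra {i | i ≠ Sum.inl (k + 1)}]
        fun ω : ℕ ⊕ ℕ → ℝ => ω (Sum.inl i) := fun i hi => measurable_coord (by simp; omega)
    exact (measurable_srcProc a k hl).sub
      (measurable_recProc a G k hl fun i hi => measurable_coord (by simp))

/-- The mean squared error of the linear policy averages to a value not above its stationary
one, up to a bounded transient. -/
lemma exists_sum_predErr_le {q : ℝ} (hc : a ^ 2 * (1 - G) ^ 2 < 1)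
    (hq : q = a ^ 2 * ((1 - G) ^ 2 * q + s) + v) :
    ∃ β : ℝ, ∀ K : ℕ, ∑ k ∈ Finset.range K, predErr a G S v s k ≤ K * q + β := by
  set c := a ^ 2 * (1 - G) ^ 2 with hcd
  have hc0 : 0 ≤ c := by positivity
  -- The deviation from the fixed point q contracts by the factor c, so its sum is bounded by a
  -- geometric series uniformly in K.
  have h1 : ∀ k, predErr a G S v s k - q = c ^ k * (predErr a G S v s 0 - q) := by
    intro k
    induction k with
    | zero => simp
    | succ k ih =>
      rw [predErr_succ, pow_succ' c, mul_assoc c, ← ih]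
      conv_lhs => rw [hq]
      rw [hcd]; ring
  refine ⟨|predErr a G S v s 0 - q| * (1 - c)⁻¹, fun K => ?_⟩
  have h2 : ∑ k ∈ Finset.range K, predErr a G S v s k
      = K * q + (∑ k ∈ Finset.range K, c ^ k) * (predErr a G S v s 0 - q) := by
    rw [Finset.sum_mul, ← Finset.sum_congr rfl fun k _ => h1 k, Finset.sum_sub_distrib]
    simp
  have h3 : ∑ k ∈ Finset.range K, c ^ k ≤ (1 - c)⁻¹ := by
    rw [← tsum_geometric_of_lt_one hc0 hc]
    exact (summable_geometric_of_lt_one hc0 hc).sum_le_tsum _ fun k _ => by positivity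
  have h4 : 0 ≤ ∑ k ∈ Finset.range K, c ^ k := Finset.sum_nonneg fun k _ => by positivity
  rw [h2]
  have h5 := le_abs_self (predErr a G S v s 0 - q)
  have h6 : (∑ k ∈ Finset.range K, c ^ k) * (predErr a G S v s 0 - q)
      ≤ (∑ k ∈ Finset.range K, c ^ k) * |predErr a G S v s 0 - q| := by gcongr
  have h7 : (∑ k ∈ Finset.range K, c ^ k) * |predErr a G S v s 0 - q|
      ≤ (1 - c)⁻¹ * |predErr a G S v s 0 - q| := by gcongr
  linarith

lemma dtDistortion_linearLaw_le {q Q : ℝ} (hQ : 0 ≤ Q) (hc : a ^ 2 * (1 - G) ^ 2 < 1)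
    (hq : q = a ^ 2 * ((1 - G) ^ 2 * q + s) + v) :
    dtDistortion Q (linearLaw a G S v s) ≤ ENNReal.ofReal (Q * ((1 - G) ^ 2 * q + s)) := by
  obtain ⟨β, hβ⟩ := exists_sum_predErr_le a G S v s hc hq
  refine limsup_le_of_le_affine (β := Q * (1 - G) ^ 2 * β) (Eventually.of_forall fun K => ?_)
  gcongr
  have h1 : ∀ k, ∫⁻ ω, ENNReal.ofReal (Q * (ω.1 k - ω.2 k) ^ 2) ∂(linearLaw a G S v s)
      = ENNReal.ofReal (Q * ((1 - G) ^ 2 * predErr a G S v s k + s)) := by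
    intro k
    rw [linearLaw, lintegral_map (by fun_prop) (measurable_procs a G),
      ← ofReal_integral_eq_lintegral_ofReal, integral_const_mul, integral_sq_linear_err]
    · exact ((memLp_srcProc a S v s k).sub (memLp_recProc a G S v s k)).integrable_sq.const_mul _
    · exact ae_of_all _ fun ω => by positivity
  simp_rw [h1]
  have h0 : ∀ k, 0 ≤ predErr a G S v s k := fun k => integral_nonneg fun ω => by positivity
  rw [← ENNReal.ofReal_sum_of_nonneg fun k _ => by have := h0 k; positivity]
  apply ENNReal.ofReal_le_ofReal
  rw [← Finset.mul_sum, Finset.sum_add_distrib, ← Finset.mul_sum]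
  simp only [Finset.sum_const, Finset.card_range, nsmul_eq_mul]
  have h2 : (1 - G) ^ 2 * ∑ k ∈ Finset.range K, predErr a G S v s k
      ≤ (1 - G) ^ 2 * (K * q + β) := by gcongr; exact hβ K
  have h3 := mul_le_mul_of_nonneg_left h2 hQ
  linarith

/-- The reconstruction is the output of a Gaussian channel with feedback. Predicting it by a times
its predecessor leaves the innovation G times the prediction error, with stationary mean square G²
q. -/
lemma dtInfoRate_linearLaw_le {q : ℝ} (hs : s ≠ 0) (hc : a ^ 2 * (1 - G) ^ 2 < 1)
    (hq : q = a ^ 2 * ((1 - G) ^ 2 * q + s) + v) :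
    dtInfoRate (linearLaw a G S v s) ≤ ENNReal.ofReal (G ^ 2 * q / (2 * s) / Real.log 2) := by
  have hs0 : (0 : ℝ) < s := lt_of_le_of_ne s.2 (by exact_mod_cast hs.symm)
  have hl : 0 < Real.log 2 := Real.log_pos (by norm_num)
  obtain ⟨β, hβ⟩ := exists_sum_predErr_le a G S v s hc hq
  refine limsup_le_of_le_affine (β := G ^ 2 / (2 * s) / Real.log 2 * β)
    (Eventually.of_forall fun K => ?_)
  gcongr
  have hXm : Measurable fun ω k => srcProc a k ω :=
    measurable_pi_of_forall fun k => measurable_srcProc' a k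
  rw [linearLaw, mutualInfo_map _ (measurable_procs a G) (by fun_prop) (by fun_prop)]
  refine (mutualInfo_comp_le _ hXm (measurable_fin_of_measurable (measurable_recProc' a G) K)
    (f := fun u (i : Fin K) => u i) (by fun_prop) measurable_id).trans ?_
  have key := klDiv_gaussianChannel_le (P := noiseMeasure S v s) hXm (Y := recProc a G)
    (n := fun k ω => ω (Sum.inr k)) (fun k => measurable_pi_apply _)
    (m := fun k q => (1 - G) * a * extendZero q.2 (k - 1) + G * q.1 k)
    (fun k => ((measurable_extendZero_comp measurable_snd _).const_mul _).add (by fun_prop))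
    (m' := fun k q => a * extendZero q (k - 1))
    (fun k => (measurable_extendZero _ _).const_mul _) hs (recProc_eq a G)
    (fun k => map_coord S v s (Sum.inr k)) (fun k => ?_) ?_ K
  · unfold mutualInfo
    have e : ∀ k ω, ((1 - G) * a * extendZero (fun i : Fin k => recProc a G i ω) (k - 1)
        + G * srcProc a k ω) - a * extendZero (fun i : Fin k => recProc a G i ω) (k - 1)
        = G * (srcProc a k ω - a * extendZero (fun i : Fin k => recProc a G i ω) (k - 1)) :=
      fun k ω => by ring
    simp only [e, mul_pow, integral_const_mul] at key
    refine (ENNReal.div_le_div_right key _).trans ?_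
    rw [← ENNReal.ofReal_div_of_pos hl]
    apply ENNReal.ofReal_le_ofReal
    have h2 : ∑ k ∈ Finset.range K, G ^ 2 * predErr a G S v s k / (2 * s)
        ≤ G ^ 2 / (2 * s) * (K * q + β) := by
      have : ∀ k, G ^ 2 * predErr a G S v s k / (2 * s)
          = G ^ 2 / (2 * s) * predErr a G S v s k := fun k => by ring
      simp_rw [this]
      rw [← Finset.mul_sum]
      gcongr
      exact hβ K
    have h3 := div_le_div_of_nonneg_right h2 hl.le
    refine h3.trans (le_of_eq ?_)
    ring
  · refine indepFun_coord S v s (T := pastCoords k) (by simp [pastCoords]) ?_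
    exact Measurable.prodMk (measurable_pi_of_forall fun i => measurable_src_past a k i)
      (measurable_pi_of_forall fun i => measurable_rec_past a G i.2)
  · intro k
    refine ((memLp_prediction a G S v s k).const_mul G).ae_eq (ae_of_all _ fun ω => ?_)
    simp only
    ring

end LinearPolicy

end GaussMarkov

namespace GaussMarkov

open InformationTheory

/-! ### Bounds on the discrete-time rate-distortion function -/

section DiscreteTime

lemma integral_exp_mul {c : ℝ} (hc : c ≠ 0) (τ : ℝ) :
    ∫ t in (0 : ℝ)..τ, Real.exp (c * t) = (Real.exp (c * τ) - 1) / c := by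
  rw [intervalIntegral.integral_comp_mul_left (fun t => Real.exp t) hc, integral_exp]
  simp
  field_simp

lemma Qd_eq {A : ℝ} (hA : A < 0) (τ : ℝ) : Qd A τ = (Real.exp (2 * A * τ) - 1) / (2 * A) := by
  rw [← integral_exp_mul (by linarith), Qd]
  congr 1
  funext t
  rw [Ad, ← Real.exp_add]
  ring_nf

lemma Qd_pos {A : ℝ} (hA : A < 0) {τ : ℝ} (hτ : 0 < τ) : 0 < Qd A τ := by
  rw [Qd_eq hA]
  apply div_pos_of_neg_of_neg
  · have : Real.exp (2 * A * τ) < 1 := by rw [Real.exp_lt_one_iff]; nlinarith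
    linarith
  · linarith

/-- The squared pole and the noise variance are both affine in `Qd`, so the dependence on τ can be
carried by this single quantity. -/
lemma Ad_sq {A : ℝ} (hA : A < 0) (τ : ℝ) : Ad A τ ^ 2 = 1 + 2 * A * Qd A τ := by
  have hA' : (2 * A) ≠ 0 := by linarith
  rw [Qd_eq hA, Ad, ← Real.exp_nat_mul, mul_div_cancel₀ _ hA']
  push_cast
  ring_nf

lemma Bd_sq {A B : ℝ} {τ : ℝ} (hτ : 0 ≤ τ) : Bd A B τ ^ 2 = B ^ 2 * Qd A τ := by
  have e : (∫ l in (0 : ℝ)..τ, Real.exp (A * l) * B * B * Real.exp (A * l)) = B ^ 2 * Qd A τ := by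
    rw [Qd, ← intervalIntegral.integral_const_mul]
    congr 1
    funext t
    simp only [Ad]
    ring
  rw [Bd, Real.sq_sqrt, e]
  exact intervalIntegral.integral_nonneg hτ fun t _ => by
    have : Real.exp (A * t) * B * B * Real.exp (A * t) = (Real.exp (A * t) * B) ^ 2 := by ring
    rw [this]; positivity

lemma bbar_eq {A B : ℝ} (hA : A < 0) {τ : ℝ} (hτ : 0 ≤ τ) :
    bbar A B τ = B ^ 2 * (Qd A τ - τ) / (2 * A) := by
  have e : bbar A B τ = ∫ t in (0 : ℝ)..τ, B ^ 2 / (2 * A) * (Real.exp (2 * A * t) - 1) := by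
    refine intervalIntegral.integral_congr fun t ht => ?_
    rw [Set.uIcc_of_le hτ] at ht
    rw [← pow_two, Bd_sq ht.1, Qd_eq hA]
    ring
  rw [e, intervalIntegral.integral_const_mul, intervalIntegral.integral_sub
    (Continuous.intervalIntegrable (by fun_prop) _ _) (by simp), integral_exp_mul (by linarith),
    ← Qd_eq hA]
  simp
  ring

lemma Ad_sq_lt_one {A : ℝ} (hA : A < 0) {τ : ℝ} (hτ : 0 < τ) : Ad A τ ^ 2 < 1 := by
  rw [Ad_sq hA]
  have := Qd_pos hA hτ
  nlinarith

/-- Every causal reconstruction of the sampled source obeys the rate-distortion bound of the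
Gaussian test channel. -/
theorem le_dtInfoRate {a b : ℝ} {S0 : ℝ≥0} (ha : a ^ 2 < 1) (hb : b ≠ 0) (hS0 : S0 ≠ 0)
    {κ : ReconPolicy} {P : Measure ((ℕ → ℝ) × (ℕ → ℝ))} (hP : IsInducedLaw a b S0 κ P) {Q p : ℝ}
    (hQ : 0 < Q) (hp : 0 < p) (hD : dtDistortion Q P ≤ ENNReal.ofReal (Q * p)) :
    ENNReal.ofReal (Real.log ((a ^ 2 * p + b ^ 2) / p) / 2 / Real.log 2) ≤ dtInfoRate P := by
  have iP := hP.prob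
  have hl : 0 < Real.log 2 := Real.log_pos (by norm_num)
  set v : ℝ≥0 := Real.toNNReal (b ^ 2) with hv
  have hvb : (v : ℝ) = b ^ 2 := Real.coe_toNNReal _ (by positivity)
  have hv0 : v ≠ 0 := by
    intro h
    rw [h] at hvb
    exact hb (by simpa using hvb.symm)
  set x : ℕ → (ℕ → ℝ) × (ℕ → ℝ) → ℝ := fun k ω => ω.1 k with hx
  set y : ℕ → (ℕ → ℝ) × (ℕ → ℝ) → ℝ := fun k ω => ω.2 k with hy
  have hxm : ∀ k, Measurable (x k) := fun k => by fun_prop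
  have hym : ∀ k, Measurable (y k) := fun k => by fun_prop
  have hfin : ∀ ε > 0, ∀ᶠ K : ℕ in atTop,
      (∑ k ∈ Finset.range K, ∫⁻ ω, ENNReal.ofReal (Q * (x k ω - y k ω) ^ 2) ∂P) / (K : ℝ≥0∞)
        < ENNReal.ofReal (Q * (p + ε)) := by
    intro ε hε
    refine eventually_lt_of_limsup_lt (hD.trans_lt ?_)
    rw [ENNReal.ofReal_lt_ofReal_iff (by positivity)]
    gcongr
    linarith
  have hsum : ∀ ε > 0, ∀ᶠ K : ℕ in atTop,
      (∑ k ∈ Finset.range K, ∫⁻ ω, ENNReal.ofReal (Q * (x k ω - y k ω) ^ 2) ∂P)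
        ≤ ENNReal.ofReal (K * (Q * (p + ε))) := by
    intro ε hε
    filter_upwards [hfin ε hε, eventually_gt_atTop 0] with K hK hK0
    rw [ENNReal.ofReal_mul (by positivity), ENNReal.ofReal_natCast]
    have := (ENNReal.div_le_iff (by exact_mod_cast hK0.ne') (by simp)).1 hK.le
    rwa [mul_comm] at this
  -- The distortion bound is an asymptotic average, but some partial sum past k is finite, and that
  -- forces the k-th error to be square integrable.
  have heL : ∀ k, MemLp (fun ω => x k ω - y k ω) 2 P := by
    intro k
    obtain ⟨K, hK, hKk⟩ := ((hsum 1 one_pos).and (eventually_gt_atTop k)).exists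
    have h1 : ∫⁻ ω, ENNReal.ofReal (Q * (x k ω - y k ω) ^ 2) ∂P < ∞ :=
      ((Finset.single_le_sum (f := fun k => ∫⁻ ω, ENNReal.ofReal (Q * (x k ω - y k ω) ^ 2) ∂P)
        (fun _ _ => zero_le) (Finset.mem_range.2 hKk)).trans hK).trans_lt ENNReal.ofReal_lt_top
    have hm : Measurable fun ω => x k ω - y k ω := (hxm k).sub (hym k)
    rw [memLp_two_iff_integrable_sq hm.aestronglyMeasurable]
    have h2 : Integrable (fun ω => Q * (x k ω - y k ω) ^ 2) P := by
      refine ⟨((hm.pow_const 2).const_mul Q).aestronglyMeasurable, ?_⟩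
      rwa [hasFiniteIntegral_iff_ofReal (ae_of_all _ fun ω => by positivity)]
    refine (h2.const_mul Q⁻¹).congr (ae_of_all _ fun ω => ?_)
    simp only
    field_simp
  have hsum' : ∀ ε > 0, ∀ᶠ K : ℕ in atTop,
      ∑ k ∈ Finset.range K, ∫ ω, (x k ω - y k ω) ^ 2 ∂P ≤ K * (p + ε) := by
    intro ε hε
    filter_upwards [hsum ε hε] with K hK
    have h1 : ∀ k, ∫⁻ ω, ENNReal.ofReal (Q * (x k ω - y k ω) ^ 2) ∂P
        = ENNReal.ofReal (Q * ∫ ω, (x k ω - y k ω) ^ 2 ∂P) := by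
      intro k
      rw [← ofReal_integral_eq_lintegral_ofReal ((heL k).integrable_sq.const_mul _)
        (ae_of_all _ fun ω => by positivity), integral_const_mul]
    simp_rw [h1] at hK
    have h0 : ∀ k, 0 ≤ ∫ ω, (x k ω - y k ω) ^ 2 ∂P := fun k =>
      integral_nonneg fun ω => by positivity
    rw [← ENNReal.ofReal_sum_of_nonneg (fun k _ => mul_nonneg hQ.le (h0 k)), ← Finset.mul_sum,
      ENNReal.ofReal_le_ofReal_iff (by positivity)] at hK
    have : Q * ∑ k ∈ Finset.range K, ∫ ω, (x k ω - y k ω) ^ 2 ∂P ≤ Q * (K * (p + ε)) := by linarith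
    exact le_of_mul_le_mul_left this hQ
  set c : ℝ := Real.log ((a ^ 2 * p + v) / p) / 2 with hc
  set g : ℝ := v / (2 * (a ^ 2 * p + v) * p) with hg
  have hg0 : 0 ≤ g := by positivity
  set M : ℝ := S0 + v / (1 - a ^ 2) with hM
  have hbound : ∀ ε > 0, ENNReal.ofReal ((c - g * ε) / Real.log 2) ≤ dtInfoRate P := by
    intro ε hε
    -- K samples have only K - 1 transitions, whence the terms -c and -g p in β; the rest bounds the
    -- initial and terminal contributions.
    refine le_limsup_of_affine_le
      (β := (-c - g * p + (Real.log S0 + 1 - M) / 2) / Real.log 2) ?_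
    filter_upwards [hsum' ε hε, eventually_gt_atTop 0] with K hK hK0
    obtain ⟨n, rfl⟩ : ∃ n, K = n + 1 := ⟨K - 1, by omega⟩
    gcongr
    have key := le_klDiv_of_causal hxm hym hv0 hS0 hP.init hP.noise_law hP.noise_indep heL hp n
    rw [← hc, ← hg] at key
    unfold mutualInfo
    refine le_trans ?_ (ENNReal.div_le_div_right key _)
    rw [← ENNReal.ofReal_div_of_pos hl]
    apply ENNReal.ofReal_le_ofReal
    have hM' : ∫ ω, x n ω ^ 2 ∂P ≤ M :=
      integral_sq_source_le hxm ha hP.init hP.noise_law (fun k => (hP.noise_indep k).comp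
        measurable_id (φ := id) (ψ := fun q : (Fin (k + 1) → ℝ) × (Fin (k + 1) → ℝ) =>
          q.1 (Fin.last k)) (by fun_prop)) n
    have hS : ∑ k ∈ Finset.range n, ∫ ω, (x k ω - y k ω) ^ 2 ∂P ≤ (n + 1) * (p + ε) := by
      rw [Finset.sum_range_succ] at hK
      have : 0 ≤ ∫ ω, (x n ω - y n ω) ^ 2 ∂P := integral_nonneg fun ω => by positivity
      push_cast at hK
      linarith
    have hS' := mul_le_mul_of_nonneg_left hS hg0
    rw [← mul_div_assoc, ← add_div]
    apply div_le_div_of_nonneg_right _ hl.le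
    push_cast
    rw [mul_sub]
    linarith
  rw [← hvb]
  have ht : Tendsto (fun ε : ℝ => ENNReal.ofReal ((c - g * ε) / Real.log 2)) (𝓝[>] 0)
      (𝓝 (ENNReal.ofReal (c / Real.log 2))) := by
    have : Continuous fun ε : ℝ => ENNReal.ofReal ((c - g * ε) / Real.log 2) :=
      ENNReal.continuous_ofReal.comp (by fun_prop)
    have h2 := this.tendsto 0
    simp only [mul_zero, sub_zero] at h2
    exact h2.mono_left nhdsWithin_le_nhds
  exact le_of_tendsto ht (eventually_nhdsWithin_of_forall fun ε hε => hbound ε hε)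

/-- The weight Q rescales the distortion, so the tangent is taken at the error variance D / Q. -/
lemma le_dtRDF {A B : ℝ} (hA : A < 0) (hB : B ≠ 0) {S0 : ℝ≥0} (hS0 : S0 ≠ 0) {D Q τ : ℝ}
    (hD : 0 < D) (hQ : 0 < Q) (hτ : 0 < τ) :
    ENNReal.ofReal (Real.log (Ad A τ ^ 2 + Bd A B τ ^ 2 * Q / D) / 2 / Real.log 2)
      ≤ dtRDF A B S0 D Q τ := by
  refine le_sInf ?_
  rintro r ⟨κ, P, hP, hDP, rfl⟩
  have hb : Bd A B τ ≠ 0 := by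
    intro h
    have h1 := Bd_sq (A := A) (B := B) hτ.le
    rw [h] at h1
    have := Qd_pos hA hτ
    have : 0 < B ^ 2 * Qd A τ := by positivity
    linarith [h1]
  have h2 : Ad A τ ^ 2 + Bd A B τ ^ 2 * Q / D
      = (Ad A τ ^ 2 * (D / Q) + Bd A B τ ^ 2) / (D / Q) := by field_simp
  rw [h2]
  refine le_dtInfoRate (Ad_sq_lt_one hA hτ) hb hS0 hP hQ (by positivity) ?_
  rwa [mul_div_cancel₀ _ hQ.ne']

lemma dtRDF_le {A B : ℝ} {S0 : ℝ≥0} {D Q τ : ℝ} (hQ : 0 < Q) {G s q : ℝ} (hs : 0 < s)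
    (hc : Ad A τ ^ 2 * (1 - G) ^ 2 < 1)
    (hq : q = Ad A τ ^ 2 * ((1 - G) ^ 2 * q + s) + Bd A B τ ^ 2)
    (hD : Q * ((1 - G) ^ 2 * q + s) ≤ D) :
    dtRDF A B S0 D Q τ ≤ ENNReal.ofReal (G ^ 2 * q / (2 * s) / Real.log 2) := by
  set v : ℝ≥0 := Real.toNNReal (Bd A B τ ^ 2) with hv
  have hvb : (v : ℝ) = Bd A B τ ^ 2 := Real.coe_toNNReal _ (by positivity)
  set s' : ℝ≥0 := ⟨s, hs.le⟩ with hs'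
  have hs0 : s' ≠ 0 := by
    intro h
    exact hs.ne' (congrArg NNReal.toReal h)
  have hq' : q = Ad A τ ^ 2 * ((1 - G) ^ 2 * q + s') + v := by rw [hvb]; exact hq
  refine le_trans (sInf_le ?_) (dtInfoRate_linearLaw_le (Ad A τ) G S0 v s' hs0 hc hq')
  refine ⟨linearPolicy (Ad A τ) G s', linearLaw (Ad A τ) G S0 v s',
    isInducedLaw_linearLaw _ _ _ _ _ hv, ?_, rfl⟩
  exact (dtDistortion_linearLaw_le _ _ _ _ _ hQ.le hc hq').trans (ENNReal.ofReal_le_ofReal hD)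

/-- The rate of the optimal linear test channel, with the logarithm linearized. -/
lemma dtRDF_le_of_lt {A B : ℝ} {S0 : ℝ≥0} {D Q τ p : ℝ} (hQ : 0 < Q) (hp : 0 < p)
    (hlt : p < Ad A τ ^ 2 * p + Bd A B τ ^ 2) (hD : Q * p ≤ D) :
    dtRDF A B S0 D Q τ
      ≤ ENNReal.ofReal ((Ad A τ ^ 2 + Bd A B τ ^ 2 / p - 1) / 2 / Real.log 2) := by
  set a2 := Ad A τ ^ 2 with ha2
  set b2 := Bd A B τ ^ 2 with hb2
  have ha0 : 0 ≤ a2 := by positivity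
  have hb0 : 0 ≤ b2 := by positivity
  set q := a2 * p + b2 with hq
  have hq0 : 0 < q := hp.trans hlt
  set G := 1 - p / q with hG
  have hG0 : 0 < G := by rw [hG, sub_pos, div_lt_one hq0]; exact hlt
  have hGq : G * q = q - p := by rw [hG]; field_simp
  have e1 : (1 - G) ^ 2 * q + G * p = p := by
    rw [hG]; field_simp; ring
  have h := dtRDF_le (A := A) (B := B) (S0 := S0) (D := D) (Q := Q) (τ := τ) hQ (G := G)
    (s := G * p) (q := q) (by positivity) ?_ (by rw [e1]) (by rw [e1]; exact hD)
  · refine h.trans (le_of_eq ?_)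
    congr 2
    have : G ^ 2 * q / (2 * (G * p)) = (G * q) / (2 * p) := by field_simp
    rw [this, hGq, hq]
    field_simp
  · have h1 : a2 * p ≤ q := by rw [hq]; linarith
    have h2 : (1 - G) ^ 2 = (p / q) ^ 2 := by rw [hG]; ring
    rw [h2]
    have h3 : p / q < 1 := (div_lt_one hq0).2 hlt
    have h4 : 0 < p / q := by positivity
    have h5 : a2 * (p / q) ≤ 1 := by rw [← mul_div_assoc, div_le_one hq0]; exact h1
    calc a2 * (p / q) ^ 2 = (a2 * (p / q)) * (p / q) := by ring
      _ ≤ 1 * (p / q) := by gcongr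
      _ < 1 := by linarith

/-- A noise that is independent of the source meets every distortion above the stationary
variance. -/
lemma dtRDF_eq_zero {A B : ℝ} {S0 : ℝ≥0} {D Q τ : ℝ} (hA : A < 0) (hτ : 0 < τ) (hQ : 0 < Q)
    (hD : Q * (Bd A B τ ^ 2 / (1 - Ad A τ ^ 2)) < D) : dtRDF A B S0 D Q τ = 0 := by
  have ha := Ad_sq_lt_one hA hτ
  set a2 := Ad A τ ^ 2 with ha2
  set b2 := Bd A B τ ^ 2 with hb2
  have h1 : 0 < 1 - a2 := by linarith
  -- With G = 0 the reconstruction is an independent process with the same pole and stationary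
  -- variance s / (1 - a2), chosen to fill the gap between D / Q and the variance of the source.
  set s := (1 - a2) * (D / Q - b2 / (1 - a2)) with hs
  have hs0 : 0 < s := by
    apply mul_pos h1
    rw [sub_pos, lt_div_iff₀ hQ]
    linarith
  have h := dtRDF_le (A := A) (B := B) (S0 := S0) (D := D) (Q := Q) (τ := τ) hQ (G := 0)
    (s := s) (q := (a2 * s + b2) / (1 - a2)) hs0 (by rw [sub_zero, one_pow, mul_one]; exact ha)
    (by rw [← ha2, ← hb2]; field_simp; ring) (by
      have : (1 - 0) ^ 2 * ((a2 * s + b2) / (1 - a2)) + s = D / Q := by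
        rw [hs]; field_simp; ring
      rw [this, mul_div_cancel₀ _ hQ.ne'])
  simpa using h

end DiscreteTime

end GaussMarkov

namespace GaussMarkov

/-! ### Expansions for small sampling periods -/

section SmallPeriod

/-- The normalized third-order Taylor remainder of `exp (c τ)`. -/
noncomputable def expRem (c τ : ℝ) : ℝ :=
  (Real.exp (c * τ) - (1 + c * τ + (c * τ) ^ 2 / 2 + (c * τ) ^ 3 / 6)) / τ ^ 3

lemma exp_eq_expRem (c : ℝ) {τ : ℝ} (hτ : τ ≠ 0) :
    Real.exp (c * τ) = 1 + c * τ + (c * τ) ^ 2 / 2 + (c * τ) ^ 3 / 6 + τ ^ 3 * expRem c τ := by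
  unfold expRem
  field_simp
  ring

/-- Carrying the remainder as an explicit vanishing factor makes the later expansions exact
polynomial identities in τ and `expRem`. -/
lemma tendsto_expRem (c : ℝ) : Tendsto (expRem c) (𝓝[>] 0) (𝓝 0) := by
  have h1 : (fun x : ℝ => Real.exp x - ∑ i ∈ Finset.range 4, x ^ i / (Nat.factorial i : ℝ))
      =O[𝓝 0] fun x => x ^ 4 := Real.exp_sub_sum_range_isBigO_pow 4
  have h2 : Tendsto (fun τ : ℝ => c * τ) (𝓝[>] 0) (𝓝 0) := by
    have : Continuous fun τ : ℝ => c * τ := by fun_prop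
    have h := this.tendsto 0
    rw [mul_zero] at h
    exact h.mono_left nhdsWithin_le_nhds
  have h3 := h1.comp_tendsto h2
  have h4 : (fun τ : ℝ => (c * τ) ^ 4) =O[𝓝[>] 0] fun τ => τ ^ 4 := by
    simp_rw [mul_pow]
    exact Asymptotics.isBigO_const_mul_self _ _ _
  have h5 : (fun τ : ℝ => τ ^ 4) =o[𝓝[>] 0] fun τ => τ ^ 3 :=
    (Asymptotics.isLittleO_pow_pow (by norm_num : 3 < 4)).mono nhdsWithin_le_nhds
  have h6 := (h3.trans h4).trans_isLittleO h5
  refine h6.tendsto_div_nhds_zero.congr fun τ => ?_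
  simp only [Function.comp, Finset.sum_range_succ, Finset.sum_range_zero, expRem]
  norm_num [Nat.factorial]

lemma Qd_eq_expRem {A : ℝ} (hA : A < 0) {τ : ℝ} (hτ : 0 < τ) :
    Qd A τ = τ * (1 + 2 * A * τ / 2 + (2 * A) ^ 2 * τ ^ 2 / 6
      + τ ^ 2 * expRem (2 * A) τ / (2 * A)) := by
  have hA' : A ≠ 0 := hA.ne
  rw [Qd_eq hA, exp_eq_expRem _ hτ.ne']
  field_simp
  ring

lemma Dd_eq {A B Dc : ℝ} (hA : A < 0) {τ : ℝ} (hτ : 0 < τ) :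
    Dd A B Dc τ = Dc * τ - B ^ 2 * (Qd A τ - τ) / (2 * A) := by
  rw [Dd, bbar_eq hA hτ.le]

lemma Dd_eq_expRem {A B Dc : ℝ} (hA : A < 0) {τ : ℝ} (hτ : 0 < τ) :
    Dd A B Dc τ = τ * (Dc - B ^ 2 * τ * (1 / 2 + 2 * A * τ / 6
      + τ * expRem (2 * A) τ / (2 * A) ^ 2)) := by
  have hA' : A ≠ 0 := hA.ne
  rw [Dd_eq hA hτ, Qd_eq_expRem hA hτ]
  field_simp
  ring

lemma tendsto_id_pos : Tendsto (fun τ : ℝ => τ) (𝓝[>] 0) (𝓝 0) :=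
  tendsto_id.mono_left nhdsWithin_le_nhds

lemma tendsto_Qd_div {A : ℝ} (hA : A < 0) :
    Tendsto (fun τ => Qd A τ / τ) (𝓝[>] 0) (𝓝 1) := by
  have h := ((tendsto_id_pos.const_mul (2 * A)).div_const 2)
  have h2 := (((tendsto_id_pos.pow 2).const_mul ((2 * A) ^ 2)).div_const 6)
  have h3 := (((tendsto_id_pos.pow 2).mul (tendsto_expRem (2 * A))).div_const (2 * A))
  have h4 := ((h.const_add 1).add h2).add h3
  simp only [mul_zero, zero_div, add_zero, ne_eq, OfNat.ofNat_ne_zero, not_false_eq_true,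
    zero_pow] at h4
  refine h4.congr' ?_
  filter_upwards [self_mem_nhdsWithin] with τ hτ
  have hτ0 : (0 : ℝ) < τ := hτ
  rw [Qd_eq_expRem hA hτ0]
  field_simp

lemma tendsto_Dd_div {A B Dc : ℝ} (hA : A < 0) :
    Tendsto (fun τ => Dd A B Dc τ / τ) (𝓝[>] 0) (𝓝 Dc) := by
  have h1 := ((tendsto_id_pos.const_mul (2 * A)).div_const 6).const_add (1 / 2)
  have h2 := ((tendsto_id_pos.mul (tendsto_expRem (2 * A))).div_const ((2 * A) ^ 2))
  have h3 := ((tendsto_id_pos.const_mul (B ^ 2)).mul (h1.add h2)).const_sub Dc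
  simp only [mul_zero, zero_mul, sub_zero] at h3
  refine h3.congr' ?_
  filter_upwards [self_mem_nhdsWithin] with τ hτ
  have hτ0 : (0 : ℝ) < τ := hτ
  rw [Dd_eq_expRem hA hτ0, mul_div_cancel_left₀ _ hτ0.ne']

lemma eventually_Dd_pos {A B Dc : ℝ} (hA : A < 0) (hDc : 0 < Dc) :
    ∀ᶠ τ in 𝓝[>] (0 : ℝ), 0 < Dd A B Dc τ := by
  filter_upwards [(tendsto_Dd_div (B := B) hA).eventually_const_lt hDc, self_mem_nhdsWithin]
    with τ h hτ
  exact (div_pos_iff_of_pos_right hτ).1 h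

/-- The ratio of the predicted to the filtered error variance of the sampled source. -/
noncomputable def varRatio (A B Dc τ : ℝ) : ℝ := Ad A τ ^ 2 + Bd A B τ ^ 2 * Qd A τ / Dd A B Dc τ

lemma tendsto_varRatio {A B Dc : ℝ} (hA : A < 0) (hDc : 0 < Dc) :
    Tendsto (fun τ => (varRatio A B Dc τ - 1) / τ) (𝓝[>] 0) (𝓝 (2 * A + B ^ 2 / Dc)) := by
  have h1 := (tendsto_Qd_div hA).const_mul (2 * A)
  have h2 := (((tendsto_Qd_div hA).pow 2).const_mul (B ^ 2)).div (tendsto_Dd_div (B := B) hA) hDc.ne'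
  have h3 := h1.add h2
  simp only [one_pow, mul_one] at h3
  refine h3.congr' ?_
  filter_upwards [self_mem_nhdsWithin, eventually_Dd_pos (B := B) hA hDc] with τ hτ hD
  have hτ0 : (0 : ℝ) < τ := hτ
  rw [varRatio, Ad_sq hA, Bd_sq hτ0.le]
  simp only [Pi.div_apply]
  field_simp
  ring

/-- The comparison of the sampled to the continuous-time rate, by a third-order expansion. -/
lemma eventually_exp_le_varRatio {A B Dc : ℝ} (hA : A < 0) (hDc : 0 < Dc)
    (hpos : 0 < 2 * A + B ^ 2 / Dc) :
    ∀ᶠ τ in 𝓝[>] (0 : ℝ), Real.exp ((2 * A + B ^ 2 / Dc) * τ) ≤ varRatio A B Dc τ := by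
  set r := 2 * A with hr
  have hr0 : r ≠ 0 := by rw [hr]; linarith
  set s := B ^ 2 / Dc with hs
  have hs0 : 0 < s := by rw [hr] at hpos; linarith
  set t := r + s with ht
  set e1 := expRem r with he1
  set e2 := expRem t with he2
  set V : ℝ → ℝ := fun τ => -(t ^ 3 - r ^ 3) / 6 + e1 τ - e2 τ with hV
  set U : ℝ := -s * (s + 2 * r) / 2 with hU
  set W : ℝ → ℝ := fun τ => r / 6 + e1 τ / r ^ 2 with hW
  set Y : ℝ → ℝ := fun τ => r ^ 2 / 6 + e1 τ / r with hY
  have tV : Tendsto V (𝓝[>] 0) (𝓝 (-(t ^ 3 - r ^ 3) / 6)) := by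
    have h := ((tendsto_expRem r).const_add (-(t ^ 3 - r ^ 3) / 6)).sub (tendsto_expRem t)
    rw [add_zero, sub_zero] at h
    exact h
  have tW : Tendsto W (𝓝[>] 0) (𝓝 (r / 6)) := by
    simpa using ((tendsto_expRem r).div_const (r ^ 2)).const_add (r / 6)
  have tY : Tendsto Y (𝓝[>] 0) (𝓝 (r ^ 2 / 6)) := by
    simpa using ((tendsto_expRem r).div_const r).const_add (r ^ 2 / 6)
  -- The difference multiplied by `Dd` has no terms below τ⁴, and H is the remaining coefficient,
  -- grouped by further powers of τ. V, U, W, Y name pieces of the expansions of the exponentials,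
  -- of `Dd` and of `Qd`.
  set H : ℝ → ℝ := fun τ => (V τ - s * U / 2 + s ^ 2 * W τ + s * (r ^ 2 / 4 + 2 * Y τ))
    + τ * (-s * V τ / 2 - s * (W τ * U) + s * r * Y τ) + τ ^ 2 * (-s * (V τ * W τ) + s * Y τ ^ 2)
    with hH
  have tH : Tendsto H (𝓝[>] 0) (𝓝 (s * (s + r) ^ 2 / 12)) := by
    have h1 := ((tV.sub_const (s * U / 2)).add (tW.const_mul (s ^ 2))).add
      (((tY.const_mul 2).const_add (r ^ 2 / 4)).const_mul s)
    have h2 := tendsto_id_pos.mul ((((tV.const_mul (-s)).div_const 2).sub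
      ((tW.mul_const U).const_mul s)).add (tY.const_mul (s * r)))
    have h3 := (tendsto_id_pos.pow 2).mul (((tV.mul tW).const_mul (-s)).add
      ((tY.pow 2).const_mul s))
    have h4 := (h1.add h2).add h3
    convert h4 using 2
    rw [hU, ht]
    ring
  -- Since `Dd` is of order τ, this positive limit is a third-order gap between the two sides; s + r
  -- > 0 keeps it from degenerating.
  have hlim : 0 < s * (s + r) ^ 2 / 12 := by
    have : 0 < s + r := by linarith
    positivity
  filter_upwards [tH.eventually_const_lt hlim, self_mem_nhdsWithin,
    eventually_Dd_pos (B := B) hA hDc] with τ hHτ hτ hD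
  have hτ0 : (0 : ℝ) < τ := hτ
  have hB : B ^ 2 = Dc * s := by rw [hs]; field_simp
  have key : Dd A B Dc τ * (varRatio A B Dc τ - Real.exp (t * τ)) = Dc * τ ^ 4 * H τ := by
    have h1 : Dd A B Dc τ * (varRatio A B Dc τ - Real.exp (t * τ))
        = Dd A B Dc τ * (Real.exp (r * τ) - Real.exp (t * τ)) + B ^ 2 * Qd A τ ^ 2 := by
      have h2 : Ad A τ ^ 2 = Real.exp (r * τ) := by
        rw [Ad, ← Real.exp_nat_mul, hr]; congr 1; push_cast; ring
      rw [varRatio, Bd_sq hτ0.le, h2]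
      field_simp
      ring
    rw [h1, Dd_eq_expRem hA hτ0, Qd_eq_expRem hA hτ0, exp_eq_expRem r hτ0.ne',
      exp_eq_expRem t hτ0.ne', hB, ← hr, ← he1, ← he2]
    simp only [hH, hV, hW, hY, hU, ht]
    field_simp
    ring
  have h5 : 0 < Dd A B Dc τ * (varRatio A B Dc τ - Real.exp (t * τ)) := by
    rw [key]; positivity
  have h6 := (pos_iff_pos_of_mul_pos h5).1 hD
  linarith

lemma varRatio_eq {A B Dc τ : ℝ} : varRatio A B Dc τ
    = Ad A τ ^ 2 + Bd A B τ ^ 2 / (Dd A B Dc τ / Qd A τ) := by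
  rw [varRatio, div_div_eq_mul_div]

/-- Let V be the stationary variance of the source, so that `Dd` = `Qd` V + (Dc - V) τ. If V < Dc,
an independent reconstruction already meets the constraint. -/
lemma dtRDF_eq_zero_of_le {A B Dc : ℝ} {S0 : ℝ≥0} (hA : A < 0) (hDc : 0 < Dc)
    (hle : 2 * A + B ^ 2 / Dc ≤ 0) {τ : ℝ} (hτ : 0 < τ) :
    dtRDF A B S0 (Dd A B Dc τ) (Qd A τ) τ = 0 := by
  have hQ := Qd_pos hA hτ
  set V := -B ^ 2 / (2 * A) with hV
  have hA' : (2 * A) ≠ 0 := by linarith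
  have hVle : V ≤ Dc := by
    have h1 : B ^ 2 / Dc ≤ -(2 * A) := by linarith
    rw [div_le_iff₀ hDc] at h1
    rw [hV, div_le_iff_of_neg (by linarith)]
    linarith
  have h1a : 1 - Ad A τ ^ 2 = -(2 * A) * Qd A τ := by rw [Ad_sq hA]; ring
  have hVq : Bd A B τ ^ 2 / (1 - Ad A τ ^ 2) = V := by
    rw [h1a, Bd_sq hτ.le, hV]; field_simp
  have hD : Dd A B Dc τ = Qd A τ * V + (Dc - V) * τ := by
    rw [Dd_eq hA hτ, hV]; field_simp; ring
  rcases hVle.lt_or_eq with hlt | heq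
  · refine dtRDF_eq_zero hA hτ hQ ?_
    rw [hVq, hD]
    have : 0 < (Dc - V) * τ := mul_pos (by linarith) hτ
    linarith
  -- In the critical case V = Dc there is no room for an independent noise of positive variance.
  -- Error variances p < V are feasible instead, and their rate bounds tend to zero as p increases
  -- to V.
  · have hV0 : 0 < V := heq ▸ hDc
    have hb : ∀ p, 0 < p → p < V → dtRDF A B S0 (Dd A B Dc τ) (Qd A τ) τ
        ≤ ENNReal.ofReal ((Ad A τ ^ 2 + Bd A B τ ^ 2 / p - 1) / 2 / Real.log 2) := by
      intro p hp hpV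
      refine dtRDF_le_of_lt hQ hp ?_ ?_
      · have h2 : 0 < 1 - Ad A τ ^ 2 := by linarith [Ad_sq_lt_one hA hτ]
        rw [← hVq, lt_div_iff₀ h2] at hpV
        linarith
      · rw [hD, sub_eq_zero.2 heq.symm, zero_mul, add_zero]
        have := mul_le_mul_of_nonneg_left hpV.le hQ.le
        linarith
    have ht : Tendsto (fun p : ℝ => ENNReal.ofReal
        ((Ad A τ ^ 2 + Bd A B τ ^ 2 / p - 1) / 2 / Real.log 2)) (𝓝[<] V) (𝓝 0) := by
      have h3 : (Ad A τ ^ 2 + Bd A B τ ^ 2 / V - 1) / 2 / Real.log 2 = 0 := by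
        have h2 : 1 - Ad A τ ^ 2 ≠ 0 := by linarith [Ad_sq_lt_one hA hτ]
        have h4 : Bd A B τ ^ 2 = V * (1 - Ad A τ ^ 2) := by rw [← hVq]; field_simp
        rw [h4, mul_div_cancel_left₀ _ hV0.ne']
        ring
      have h5 : ContinuousAt (fun p : ℝ => (Ad A τ ^ 2 + Bd A B τ ^ 2 / p - 1) / 2 / Real.log 2) V := by
        have : V ≠ 0 := hV0.ne'
        fun_prop (disch := assumption)
      have h6 := (ENNReal.continuous_ofReal.continuousAt.comp h5).tendsto
      simp only [Function.comp_def] at h6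
      rw [h3, ENNReal.ofReal_zero] at h6
      exact h6.mono_left nhdsWithin_le_nhds
    refine le_antisymm (ge_of_tendsto ht ?_) zero_le
    filter_upwards [self_mem_nhdsWithin, Ioo_mem_nhdsLT hV0] with p h1 h2
    exact hb p h2.1 h2.2

/-- The common limit of the two rates. -/
noncomputable def limitRate (A B Dc : ℝ) : ℝ :=
  Real.logb 2 (Real.exp 1) * max 0 (A + B ^ 2 / (2 * Dc))

lemma limitRate_eq_of_pos {A B Dc : ℝ} (h : 0 ≤ 2 * A + B ^ 2 / Dc) :
    limitRate A B Dc = (2 * A + B ^ 2 / Dc) / 2 / Real.log 2 := by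
  have e : A + B ^ 2 / (2 * Dc) = (2 * A + B ^ 2 / Dc) / 2 := by
    rw [mul_comm 2 Dc, ← div_div]; ring
  rw [limitRate, e, max_eq_right (by linarith), Real.logb, Real.log_exp]
  ring

lemma limitRate_eq_zero {A B Dc : ℝ} (h : 2 * A + B ^ 2 / Dc ≤ 0) : limitRate A B Dc = 0 := by
  have e : A + B ^ 2 / (2 * Dc) = (2 * A + B ^ 2 / Dc) / 2 := by
    rw [mul_comm 2 Dc, ← div_div]; ring
  rw [limitRate, e, max_eq_left (by linarith), mul_zero]

lemma limitRate_nonneg (A B Dc : ℝ) : 0 ≤ limitRate A B Dc :=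
  mul_nonneg (Real.logb_nonneg (by norm_num) (Real.one_le_exp zero_le_one)) (le_max_left _ _)

/-- In the nontrivial case the sampled rate is at least half the logarithm of `varRatio`, and
`eventually_exp_le_varRatio` compares that logarithm with a linear function of τ. -/
theorem eventually_limitRate_le_normRate {A B Dc : ℝ} {S0 : ℝ≥0} (hA : A < 0) (hDc : 0 < Dc)
    (hS0 : S0 ≠ 0) :
    ∀ᶠ τ in 𝓝[>] (0 : ℝ), ENNReal.ofReal (limitRate A B Dc) ≤ normRate A B S0 Dc τ := by
  rcases le_or_gt (2 * A + B ^ 2 / Dc) 0 with hle | hpos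
  · rw [limitRate_eq_zero hle]
    simp
  · have hB : B ≠ 0 := by
      rintro rfl
      simp at hpos
      linarith
    filter_upwards [eventually_exp_le_varRatio hA hDc hpos, self_mem_nhdsWithin,
      eventually_Dd_pos (B := B) hA hDc] with τ h1 hτ hD
    have hτ0 : (0 : ℝ) < τ := hτ
    have hl : 0 < Real.log 2 := Real.log_pos (by norm_num)
    have h2 := le_dtRDF (S0 := S0) hA hB hS0 hD (Qd_pos hA hτ0) hτ0
    rw [normRate, ENNReal.le_div_iff_mul_le (by simp [hτ0]) (by simp),
      ← ENNReal.ofReal_mul (limitRate_nonneg _ _ _)]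
    refine le_trans (ENNReal.ofReal_le_ofReal ?_) h2
    rw [limitRate_eq_of_pos hpos.le]
    have h3 := Real.log_le_log (Real.exp_pos _) h1
    rw [Real.log_exp] at h3
    rw [div_div, div_div, div_mul_eq_mul_div]
    apply div_le_div_of_nonneg_right _ (by positivity)
    exact h3

/-- Squeeze between the constant `limitRate` and the linearized rate (`varRatio` - 1) / (2 τ).
Replacing log ρ by ρ - 1 costs nothing in the limit, because `varRatio` tends to 1. -/
theorem tendsto_normRate {A B Dc : ℝ} {S0 : ℝ≥0} (hA : A < 0) (hDc : 0 < Dc) (hS0 : S0 ≠ 0) :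
    Tendsto (normRate A B S0 Dc) (𝓝[>] 0) (𝓝 (ENNReal.ofReal (limitRate A B Dc))) := by
  rcases le_or_gt (2 * A + B ^ 2 / Dc) 0 with hle | hpos
  · rw [limitRate_eq_zero hle, ENNReal.ofReal_zero]
    refine tendsto_const_nhds.congr' ?_
    filter_upwards [self_mem_nhdsWithin] with τ hτ
    rw [normRate, dtRDF_eq_zero_of_le hA hDc hle hτ, ENNReal.zero_div]
  · have hu : Tendsto (fun τ => ENNReal.ofReal ((varRatio A B Dc τ - 1) / τ / 2 / Real.log 2))
        (𝓝[>] 0) (𝓝 (ENNReal.ofReal (limitRate A B Dc))) := by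
      rw [limitRate_eq_of_pos hpos.le]
      exact (ENNReal.continuous_ofReal.tendsto _).comp
        (((tendsto_varRatio hA hDc).div_const 2).div_const _)
    refine tendsto_of_tendsto_of_tendsto_of_le_of_le' tendsto_const_nhds hu
      (eventually_limitRate_le_normRate hA hDc hS0) ?_
    filter_upwards [eventually_exp_le_varRatio hA hDc hpos, self_mem_nhdsWithin,
      eventually_Dd_pos (B := B) hA hDc] with τ h1 hτ hD
    have hτ0 : (0 : ℝ) < τ := hτ
    have hQ := Qd_pos hA hτ0
    have hp : 0 < Dd A B Dc τ / Qd A τ := by positivity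
    have h2 : 1 < varRatio A B Dc τ :=
      lt_of_lt_of_le (Real.one_lt_exp_iff.2 (by positivity)) h1
    have h3 := dtRDF_le_of_lt (S0 := S0) (A := A) (B := B) (τ := τ) (D := Dd A B Dc τ) hQ hp ?_
      (by rw [mul_div_cancel₀ _ hQ.ne'])
    · rw [← varRatio_eq] at h3
      rw [normRate]
      refine (ENNReal.div_le_div_right h3 _).trans (le_of_eq ?_)
      rw [← ENNReal.ofReal_div_of_pos hτ0]
      congr 1
      field_simp
    · rw [varRatio_eq, ← sub_pos] at h2
      have := mul_pos h2 hp
      rw [sub_mul, add_mul, div_mul_cancel₀ _ hp.ne'] at this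
      linarith

end SmallPeriod

/-! ### The inverse of θ near zero -/

section Theta

lemma theta_zero : theta 0 = 0 := by simp [theta]

lemma le_theta {x : ℝ} (hx : 0 ≤ x) : x ≤ theta x := by
  unfold theta
  rcases hx.eq_or_lt with rfl | hx
  · simp
  · have h1 : Real.logb 2 x ≤ Real.logb 2 (1 + x) :=
      Real.logb_le_logb_of_le (by norm_num) hx (by linarith)
    have h2 : 0 ≤ Real.logb 2 (1 + x) := Real.logb_nonneg (by norm_num) (by linarith)
    nlinarith

lemma continuous_theta : ContinuousOn theta (Set.Ici 0) := by
  have h1 : ContinuousOn (fun x : ℝ => x * Real.log x) (Set.Ici 0) :=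
    Real.continuous_mul_log.continuousOn
  have h2 : ContinuousOn (fun x : ℝ => x + (1 + x) * (Real.log (1 + x) / Real.log 2)
      - x * Real.log x / Real.log 2) (Set.Ici 0) := by
    refine ContinuousOn.sub ?_ (h1.div_const _)
    refine continuousOn_id.add ((by fun_prop : ContinuousOn (fun x : ℝ => 1 + x) _).mul
      (ContinuousOn.div_const (ContinuousOn.log (by fun_prop) fun x hx => ?_) _))
    have : (0 : ℝ) ≤ x := hx
    positivity
  refine h2.congr fun x _ => ?_
  simp only [theta, Real.logb]
  ring

lemma exists_theta_eq {y : ℝ} (hy : 0 ≤ y) : ∃ x ∈ Set.Ici (0 : ℝ), theta x = y := by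
  have h := intermediate_value_Icc hy (continuous_theta.mono Set.Icc_subset_Ici_self)
  rw [theta_zero] at h
  obtain ⟨x, hx, hxy⟩ := h ⟨hy, le_theta hy⟩
  exact ⟨x, hx.1, hxy⟩

lemma thetaInv_nonneg {y : ℝ} (hy : 0 ≤ y) : 0 ≤ thetaInv y :=
  Function.invFunOn_mem (exists_theta_eq hy)

lemma theta_thetaInv {y : ℝ} (hy : 0 ≤ y) : theta (thetaInv y) = y :=
  Function.invFunOn_eq (exists_theta_eq hy)

/-- For x = θ⁻¹(y), dropping the nonnegative terms of θ(x) leaves -x log₂ x ≤ y, and x ≤ y allows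
log₂ x to be replaced by log₂ y. -/
lemma thetaInv_mul_logb_le {y : ℝ} (hy : 0 ≤ y) :
    thetaInv y * -Real.logb 2 y ≤ y := by
  set x := thetaInv y with hx
  have hx0 : 0 ≤ x := thetaInv_nonneg hy
  have hxy : theta x = y := theta_thetaInv hy
  rcases hx0.eq_or_lt with h0 | h0
  · rw [← h0]; simpa using hy
  · have hle : x ≤ y := hxy ▸ le_theta hx0
    have h1 : Real.logb 2 x ≤ Real.logb 2 y := Real.logb_le_logb_of_le (by norm_num) h0 hle
    have h2 : 0 ≤ Real.logb 2 (1 + x) := Real.logb_nonneg (by norm_num) (by linarith)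
    have h3 : theta x = x + (1 + x) * Real.logb 2 (1 + x) - x * Real.logb 2 x := rfl
    nlinarith

/-- `θ⁻¹` is superlinearly small at zero. -/
lemma tendsto_thetaInv_div {R : ℝ → ℝ} {c : ℝ} (hR0 : ∀ τ, 0 < τ → 0 ≤ R τ)
    (hR : ∀ᶠ τ in 𝓝[>] (0 : ℝ), R τ ≤ c * τ) :
    Tendsto (fun τ => thetaInv (R τ) / τ) (𝓝[>] 0) (𝓝 0) := by
  set C := max c 1 with hC
  have hC1 : 1 ≤ C := le_max_right _ _
  have hRC : ∀ᶠ τ in 𝓝[>] (0 : ℝ), R τ ≤ C * τ := by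
    filter_upwards [hR, self_mem_nhdsWithin] with τ h hτ
    have hτ0 : (0 : ℝ) < τ := hτ
    exact h.trans (by gcongr; exact le_max_left _ _)
  have hCτ : Tendsto (fun τ : ℝ => C * τ) (𝓝[>] 0) (𝓝[>] 0) := by
    rw [tendsto_nhdsWithin_iff]
    refine ⟨by simpa using tendsto_id_pos.const_mul C, ?_⟩
    filter_upwards [self_mem_nhdsWithin] with τ hτ
    have hτ0 : (0 : ℝ) < τ := hτ
    exact Set.mem_Ioi.2 (by positivity)
  have hlog : Tendsto (fun τ : ℝ => -Real.logb 2 (C * τ)) (𝓝[>] 0) atTop := by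
    have h1 : Tendsto (fun τ : ℝ => -Real.log (C * τ)) (𝓝[>] 0) atTop :=
      tendsto_neg_atBot_atTop.comp (Real.tendsto_log_nhdsGT_zero.comp hCτ)
    have h2 := h1.atTop_div_const (Real.log_pos (by norm_num : (1 : ℝ) < 2))
    refine h2.congr fun τ => ?_
    rw [Real.logb]; ring
  have hu : Tendsto (fun τ : ℝ => C / -Real.logb 2 (C * τ)) (𝓝[>] 0) (𝓝 0) :=
    tendsto_const_nhds.div_atTop hlog
  refine tendsto_of_tendsto_of_tendsto_of_le_of_le' tendsto_const_nhds hu ?_ ?_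
  · filter_upwards [self_mem_nhdsWithin] with τ hτ
    exact div_nonneg (thetaInv_nonneg (hR0 τ hτ)) (le_of_lt hτ)
  · filter_upwards [self_mem_nhdsWithin, hRC, hlog.eventually_gt_atTop 0] with τ hτ h1 h2
    have hτ0 : (0 : ℝ) < τ := hτ
    rw [div_le_div_iff₀ hτ0 h2]
    have h0 := hR0 τ hτ
    -- Rate zero is treated apart: monotonicity of the logarithm is available only for a positive
    -- argument.
    rcases h0.eq_or_lt with h3 | h3
    · have h4 := le_theta (thetaInv_nonneg h0)
      rw [theta_thetaInv h0, ← h3] at h4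
      rw [← h3, le_antisymm h4 (thetaInv_nonneg le_rfl)]
      have : 0 < C * τ := by positivity
      linarith
    · have h4 := thetaInv_mul_logb_le h0
      have h5 : Real.logb 2 (R τ) ≤ Real.logb 2 (C * τ) :=
        Real.logb_le_logb_of_le (by norm_num) h3 h1
      have h6 := mul_le_mul_of_nonneg_left (neg_le_neg h5) (thetaInv_nonneg h0)
      linarith

end Theta

end GaussMarkov

namespace GaussMarkov

/-! ### Euler schemes for linear equations with a continuous driver -/

section Euler

/-- The Euler scheme, with step `h`, of `dx = A x dt + B du` started at `x0`. -/
def euler (A B : ℝ) (h : ℝ≥0) (u : ℝ≥0 → ℝ) (x0 : ℝ) : ℕ → ℝ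
  | 0 => x0
  | j + 1 => (1 + A * h) * euler A B h u x0 j + B * (u ((j + 1) * h) - u (j * h))

lemma euler_eq (A B : ℝ) (h : ℝ≥0) (u : ℝ≥0 → ℝ) (x0 : ℝ) (j : ℕ) :
    euler A B h u x0 j = (1 + A * h) ^ j * x0 + euler A B h u 0 j := by
  induction j with
  | zero => simp [euler]
  | succ j ih => rw [euler, ih, euler]; ring

lemma measurable_euler {Ω : Type*} {m : MeasurableSpace Ω} (A B : ℝ) (h : ℝ≥0)
    {u : ℝ≥0 → Ω → ℝ} {x0 : Ω → ℝ} (hx0 : Measurable[m] x0) (j : ℕ)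
    (hu : ∀ i ≤ j, Measurable[m] (u (i * h))) :
    Measurable[m] fun ω => euler A B h (fun s => u s ω) (x0 ω) j := by
  induction j with
  | zero => exact hx0
  | succ j ih =>
    have h1 := hu (j + 1) le_rfl
    push_cast at h1
    exact ((ih fun i hi => hu i (hi.trans j.le_succ)).const_mul _).add
      ((h1.sub (hu j j.le_succ)).const_mul B)

/-- A solution of the linear equation driven by a continuous path. -/
structure IsLinearPath (A B : ℝ) (x u : ℝ≥0 → ℝ) : Prop where
  continuous : Continuous x
  continuous_driver : Continuous u
  eq : ∀ t : ℝ≥0, x t = x 0 + (∫ s in (0 : ℝ)..t, A * x s.toNNReal) + B * u t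

variable {A B : ℝ} {x u : ℝ≥0 → ℝ}

lemma IsLinearPath.continuous_comp (hx : IsLinearPath A B x u) :
    Continuous fun s : ℝ => A * x s.toNNReal :=
  continuous_const.mul (hx.continuous.comp continuous_real_toNNReal)

lemma IsLinearPath.sub_eq (hx : IsLinearPath A B x u) (s t : ℝ≥0) :
    x t - x s = (∫ r in (s : ℝ)..t, A * x r.toNNReal) + B * (u t - u s) := by
  have h := intervalIntegral.integral_add_adjacent_intervals
    (hx.continuous_comp.intervalIntegrable 0 s) (hx.continuous_comp.intervalIntegrable (μ := volume) s t)
  rw [hx.eq t, hx.eq s, ← h]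
  ring

lemma IsLinearPath.abs_step_le (hx : IsLinearPath A B x u) {s h : ℝ≥0} {ε : ℝ}
    (hε : ∀ r, s ≤ r → r ≤ s + h → |x r - x s| ≤ ε) :
    |x (s + h) - ((1 + A * h) * x s + B * (u (s + h) - u s))| ≤ |A| * h * ε := by
  have h1 := hx.sub_eq s (s + h)
  have h2 : (∫ r in (s : ℝ)..((s + h : ℝ≥0) : ℝ), A * (x r.toNNReal - x s))
      = (∫ r in (s : ℝ)..((s + h : ℝ≥0) : ℝ), A * x r.toNNReal) - A * h * x s := by
    simp_rw [mul_sub]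
    rw [intervalIntegral.integral_sub (hx.continuous_comp.intervalIntegrable _ _)
      (continuous_const.intervalIntegrable _ _)]
    simp
    ring
  have h3 : x (s + h) - ((1 + A * h) * x s + B * (u (s + h) - u s))
      = ∫ r in (s : ℝ)..((s + h : ℝ≥0) : ℝ), A * (x r.toNNReal - x s) := by
    rw [h2]; linarith
  rw [h3]
  have h4 := intervalIntegral.norm_integral_le_of_norm_le_const (a := (s : ℝ))
    (b := ((s + h : ℝ≥0) : ℝ)) (f := fun r : ℝ => A * (x r.toNNReal - x s)) (C := |A| * ε) ?_
  · rw [Real.norm_eq_abs] at h4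
    refine h4.trans (le_of_eq ?_)
    push_cast
    rw [add_sub_cancel_left, NNReal.abs_eq]
    ring
  · intro r hr
    rw [Set.uIoc_of_le (by simp)] at hr
    rw [norm_mul, Real.norm_eq_abs, Real.norm_eq_abs]
    gcongr
    refine hε _ ?_ ?_
    · exact NNReal.le_toNNReal_of_coe_le hr.1.le
    · exact Real.toNNReal_le_iff_le_coe.2 hr.2

/-- The factor 1 + A h does not amplify errors, so the local errors simply add up over the n steps.
-/
lemma IsLinearPath.abs_sub_euler_le (hx : IsLinearPath A B x u) {h t : ℝ≥0} {ε : ℝ}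
    (hα : |1 + A * h| ≤ 1) (n : ℕ)
    (hε : ∀ j < n, ∀ r, t + j * h ≤ r → r ≤ t + j * h + h → |x r - x (t + j * h)| ≤ ε) :
    |x (t + n * h) - euler A B h (fun s => u (t + s) - u t) (x t) n| ≤ n * (|A| * h * ε) := by
  induction n with
  | zero => simp [euler]
  | succ n ih =>
    have h1 := ih fun j hj => hε j (hj.trans n.lt_succ_self)
    have h2 := hx.abs_step_le (hε n n.lt_succ_self)
    have e : t + ((n + 1 : ℕ) : ℝ≥0) * h = t + n * h + h := by push_cast; ring
    have e' : t + ((n : ℝ≥0) + 1) * h = t + n * h + h := by ring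
    rw [e, euler, e']
    set y := euler A B h (fun s => u (t + s) - u t) (x t) n with hy
    have h3 : x (t + n * h + h) - ((1 + A * h) * y + B * (u (t + n * h + h) - u t - (u (t + n * h) - u t)))
        = (x (t + n * h + h) - ((1 + A * h) * x (t + n * h) + B * (u (t + n * h + h) - u (t + n * h))))
          + (1 + A * h) * (x (t + n * h) - y) := by ring
    rw [h3]
    refine (abs_add_le _ _).trans ?_
    rw [abs_mul]
    have h4 := mul_le_mul hα h1 (abs_nonneg _) zero_le_one
    push_cast
    linarith

/-- Uniform continuity of the path on a compact interval makes every local oscillation at most ε /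
(2 (|A| s + 1)), and the accumulated error is |A| s times that. For large n the step is short enough
for the factor to lie in [0, 1]. -/
lemma IsLinearPath.tendsto_euler (hA : A < 0) (hx : IsLinearPath A B x u) (t s : ℝ≥0) :
    Tendsto (fun n : ℕ => euler A B (s / n) (fun r => u (t + r) - u t) (x t) n) atTop
      (𝓝 (x (t + s))) := by
  rw [Metric.tendsto_atTop]
  intro ε hε
  have huc := isCompact_Icc.uniformContinuousOn_of_continuous
    (s := Set.Icc (0 : ℝ≥0) (t + s)) hx.continuous.continuousOn
  rw [Metric.uniformContinuousOn_iff] at huc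
  obtain ⟨η, hη, huc⟩ := huc (ε / (2 * (|A| * s + 1))) (by positivity)
  have hlim : Tendsto (fun n : ℕ => (s : ℝ) / n) atTop (𝓝 0) :=
    tendsto_const_div_atTop_nhds_zero_nat _
  obtain ⟨N, hN⟩ := eventually_atTop.1 (((hlim.eventually_lt_const hη).and
    ((hlim.const_mul (-A)).eventually_lt_const (u := 1) (by simp))).and (eventually_gt_atTop 0))
  refine ⟨N, fun n hn => ?_⟩
  obtain ⟨⟨h1, h2⟩, h3⟩ := hN n hn
  have hn0 : (n : ℝ≥0) ≠ 0 := by exact_mod_cast h3.ne'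
  have hns : (n : ℝ≥0) * (s / n) = s := by field_simp
  have key := hx.abs_sub_euler_le (t := t) (h := s / n) (ε := ε / (2 * (|A| * s + 1))) ?_ n ?_
  · rw [hns] at key
    rw [Real.dist_eq, abs_sub_comm]
    refine key.trans_lt ?_
    have hns' : (n : ℝ) * ((s / n : ℝ≥0) : ℝ) = s := by exact_mod_cast hns
    calc (n : ℝ) * (|A| * ((s / n : ℝ≥0) : ℝ) * (ε / (2 * (|A| * s + 1))))
        = |A| * s * (ε / (2 * (|A| * s + 1))) := by rw [← hns']; ring
      _ < ε := by
        rw [mul_div_assoc', div_lt_iff₀ (by positivity)]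
        have : 0 ≤ |A| * s := by positivity
        nlinarith
  · push_cast
    have : 0 ≤ -A * ((s : ℝ) / n) := mul_nonneg (by linarith) (by positivity)
    rw [abs_of_nonneg (by linarith)]
    linarith
  · intro j hj r hr1 hr2
    have hj1 : ((j : ℝ≥0) + 1) * (s / n) ≤ s := by
      calc ((j : ℝ≥0) + 1) * (s / n) ≤ n * (s / n) := by
            gcongr; exact_mod_cast hj
        _ = s := hns
    have hle : t + j * (s / n) + s / n ≤ t + s := by
      rw [add_assoc, ← add_one_mul]; gcongr
    have := huc r ⟨zero_le, hr2.trans hle⟩ (t + j * (s / n))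
      ⟨zero_le, (le_add_of_nonneg_right zero_le).trans hle⟩ ?_
    · rw [Real.dist_eq] at this; exact this.le
    · rw [NNReal.dist_eq, abs_of_nonneg (sub_nonneg.2 (by exact_mod_cast hr1))]
      refine lt_of_le_of_lt ?_ h1
      have : (r : ℝ) ≤ ((t + j * (s / n) + s / n : ℝ≥0) : ℝ) := by exact_mod_cast hr2
      push_cast at this ⊢
      linarith

lemma tendsto_euler_pow (A : ℝ) (s : ℝ≥0) :
    Tendsto (fun n : ℕ => (1 + A * ((s / n : ℝ≥0) : ℝ)) ^ n) atTop (𝓝 (Real.exp (A * s))) := by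
  refine (Real.tendsto_one_add_div_pow_exp (A * s)).congr fun n => ?_
  push_cast
  rw [mul_div_assoc]

/-- The scheme is affine in its initial value, with slope (1 + A s / n)^n → exp (A s). The part
started at zero is a function of the driver after t alone. -/
lemma IsLinearPath.tendsto_euler_zero (hA : A < 0) (hx : IsLinearPath A B x u) (t s : ℝ≥0) :
    Tendsto (fun n : ℕ => euler A B (s / n) (fun r => u (t + r) - u t) 0 n) atTop
      (𝓝 (x (t + s) - Real.exp (A * s) * x t)) := by
  refine ((hx.tendsto_euler hA t s).sub ((tendsto_euler_pow A s).mul_const (x t))).congr fun n => ?_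
  rw [euler_eq _ _ _ _ (x t)]
  ring

end Euler

/-! ### Laws of the Euler schemes and of their limits -/

section EulerLaw

variable {Ω : Type*} [MeasurableSpace Ω] {P : Measure Ω}

/-- The variance of the Euler scheme. -/
noncomputable def eulerVar (A B : ℝ) (h : ℝ≥0) : ℕ → ℝ≥0
  | 0 => 0
  | j + 1 => NNReal.mk ((1 + A * h) ^ 2) (sq_nonneg _) * eulerVar A B h j
      + NNReal.mk (B ^ 2) (sq_nonneg _) * h

/-- Geometric sum with ratio (1 + A h)², cleared of its denominator: (1 + A h)² - 1 = h (2 A + A²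
h). -/
lemma eulerVar_eq (A B : ℝ) (h : ℝ≥0) (j : ℕ) :
    (eulerVar A B h j : ℝ) * (2 * A + A ^ 2 * h) = B ^ 2 * (((1 + A * h) ^ j) ^ 2 - 1) := by
  induction j with
  | zero => simp [eulerVar]
  | succ j ih =>
    simp only [eulerVar, NNReal.coe_add, NNReal.coe_mul, NNReal.coe_mk]
    rw [add_mul, mul_assoc, ih]
    ring

lemma tendsto_eulerVar {A : ℝ} (hA : A < 0) (B : ℝ) (s : ℝ≥0) :
    Tendsto (fun n : ℕ => (eulerVar A B (s / n) n : ℝ)) atTop (𝓝 (B ^ 2 * Qd A s)) := by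
  have h1 : Tendsto (fun n : ℕ => 2 * A + A ^ 2 * ((s / n : ℝ≥0) : ℝ)) atTop (𝓝 (2 * A)) := by
    have : Tendsto (fun n : ℕ => (s : ℝ) / n) atTop (𝓝 0) :=
      tendsto_const_div_atTop_nhds_zero_nat _
    simpa using (this.const_mul (A ^ 2)).const_add (2 * A)
  have h2 := ((((tendsto_euler_pow A s).pow 2).sub_const 1).const_mul (B ^ 2)).div h1 (by linarith)
  have h3 : B ^ 2 * (Real.exp (A * s) ^ 2 - 1) / (2 * A) = B ^ 2 * Qd A s := by
    rw [Qd_eq hA, ← Real.exp_nat_mul]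
    push_cast
    rw [← mul_assoc, mul_div_assoc]
  rw [h3] at h2
  refine h2.congr' ?_
  filter_upwards [h1.eventually_lt_const (u := 0) (by linarith)] with n hn
  simp only [Pi.div_apply]
  rw [← eulerVar_eq, mul_div_cancel_right₀ _ hn.ne]

/-- Each step adds a Brownian increment independent of the values already used, so the Gaussian law
is preserved and variances add. -/
lemma map_euler {w : ℝ≥0 → Ω → ℝ} (hw : IsPreBrownianReal w P) (hm : ∀ t, Measurable (w t))
    (A B : ℝ) (h : ℝ≥0) (j : ℕ) :
    P.map (fun ω => euler A B h (fun s => w s ω) 0 j) = gaussianReal 0 (eulerVar A B h j) := by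
  have : IsProbabilityMeasure P := hw.isGaussianProcess.isProbabilityMeasure
  induction j with
  | zero =>
    simp only [euler, eulerVar, Measure.map_const, measure_univ, one_smul, gaussianReal_zero_var]
  | succ j ih =>
    have hi : IndepFun (fun ω => euler A B h (fun s => w s ω) 0 j)
        (fun ω => w ((j + 1) * h) ω - w (j * h) ω) P := by
      have h1 := hw.indepFun_shift (j * h)
      rw [IndepFun_iff_Indep] at h1 ⊢
      refine indep_of_indep_of_le_left (indep_of_indep_of_le_right h1.symm ?_) ?_
      · refine Measurable.comap_le ?_
        have h2 := (measurable_pi_apply (X := fun _ : ℝ≥0 => ℝ) h).comp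
          (comap_measurable (fun ω t => w (j * h + t) ω - w (j * h) ω))
        convert h2 using 2
        simp only [Function.comp]
        congr 2
        ring
      · refine Measurable.comap_le ?_
        refine measurable_euler A B h measurable_const j fun i hi => ?_
        exact (measurable_pi_apply (X := fun _ : Set.Iic ((j : ℝ≥0) * h) => ℝ) ⟨i * h, by
          simp only [Set.mem_Iic]; gcongr⟩).comp
          (comap_measurable (fun ω (t : Set.Iic ((j : ℝ≥0) * h)) => w t ω))
    have hl1 : HasLaw (fun ω => euler A B h (fun s => w s ω) 0 j)
        (gaussianReal 0 (eulerVar A B h j)) P :=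
      ⟨(measurable_euler A B h measurable_const j fun i _ => hm _).aemeasurable, ih⟩
    have hl2 : HasLaw (fun ω => w ((j + 1) * h) ω - w (j * h) ω) (gaussianReal 0 h) P := by
      rw [show ((j : ℝ≥0) + 1) * h = j * h + h by ring]
      exact (hw.shift (j * h)).hasLaw_eval h
    have hl1' := gaussianReal_const_mul hl1 (1 + A * h)
    have hl2' := gaussianReal_const_mul hl2 B
    have h4 := gaussianReal_add_gaussianReal_of_indepFun
      (hi.comp (measurable_const_mul (1 + A * h)) (measurable_const_mul B)) hl1'.map_eq hl2'.map_eq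
    rw [mul_zero, mul_zero, add_zero] at h4
    exact h4

/-- An almost sure limit of centred Gaussian variables is Gaussian. -/
lemma map_gaussian_of_tendsto [IsProbabilityMeasure P] {X : ℕ → Ω → ℝ} {Z : Ω → ℝ} {v : ℕ → ℝ≥0}
    {σ : ℝ≥0} (hX : ∀ n, Measurable (X n)) (hZ : Measurable Z)
    (hlaw : ∀ n, P.map (X n) = gaussianReal 0 (v n))
    (hlim : ∀ᵐ ω ∂P, Tendsto (fun n => X n ω) atTop (𝓝 (Z ω)))
    (hv : Tendsto (fun n => (v n : ℝ)) atTop (𝓝 σ)) : P.map Z = gaussianReal 0 σ := by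
  have i1 := Measure.isProbabilityMeasure_map (μ := P) hZ.aemeasurable
  refine Measure.ext_of_charFun ?_
  funext ξ
  have hc : ∀ {Y : Ω → ℝ}, Measurable Y →
      charFun (P.map Y) ξ = ∫ ω, Complex.exp (ξ * Y ω * Complex.I) ∂P := by
    intro Y hY
    rw [charFun_apply_real, integral_map hY.aemeasurable]
    exact Continuous.aestronglyMeasurable (by fun_prop)
  have h1 : Tendsto (fun n => charFun (P.map (X n)) ξ) atTop (𝓝 (charFun (P.map Z) ξ)) := by
    simp_rw [hc (hX _), hc hZ]
    refine tendsto_integral_of_dominated_convergence (fun _ => 1) ?_ (integrable_const _) ?_ ?_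
    · intro n
      have := hX n
      exact Measurable.aestronglyMeasurable (by fun_prop)
    · intro n
      refine ae_of_all _ fun ω => ?_
      rw [← Complex.ofReal_mul, Complex.norm_exp_ofReal_mul_I]
    · filter_upwards [hlim] with ω hω
      have hcont : Continuous fun y : ℝ => Complex.exp (ξ * y * Complex.I) := by fun_prop
      exact (hcont.tendsto _).comp hω
  have h2 : Tendsto (fun n => charFun (P.map (X n)) ξ) atTop (𝓝 (charFun (gaussianReal 0 σ) ξ)) := by
    simp_rw [hlaw, charFun_gaussianReal]
    have hcont : Continuous fun y : ℝ =>
      Complex.exp (ξ * (0 : ℝ) * Complex.I - y * ξ ^ 2 / 2) := by fun_prop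
    exact (hcont.tendsto _).comp hv
  exact tendsto_nhds_unique h1 h2

end EulerLaw

end GaussMarkov

namespace GaussMarkov

/-! ### Measurable functionals of the source and the observation noise -/

section Paths

variable {Ω : Type*}

/-- A version of the flow of the source as a functional of the initial value and the driver. -/
noncomputable def flow (A B : ℝ) (w : ℝ≥0 → Ω → ℝ) (x0 : Ω → ℝ) (s : ℝ≥0) (ω : Ω) : ℝ :=
  limsup (fun n : ℕ => euler A B (s / n) (fun r => w (0 + r) ω - w 0 ω) (x0 ω) n) atTop

/-- The upper limit is defined everywhere, hence measurable for any σ-algebra that carries the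
initial value and the driver up to s. This version replaces the source, which equals it only almost
surely, in independence arguments. -/
lemma measurable_flow {m : MeasurableSpace Ω} (A B : ℝ) {w : ℝ≥0 → Ω → ℝ} {x0 : Ω → ℝ} {s : ℝ≥0}
    (hx0 : Measurable[m] x0) (hw : ∀ r ≤ s, Measurable[m] (w r)) :
    Measurable[m] (flow A B w x0 s) := by
  refine Measurable.limsup fun n => measurable_euler A B _ hx0 n fun i hi => ?_
  refine (hw _ ?_).sub (hw 0 zero_le)
  rw [zero_add]
  rcases Nat.eq_zero_or_pos n with rfl | hn
  · simp
  · have hn0 : (0 : ℝ≥0) < n := by exact_mod_cast hn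
    rw [mul_div_left_comm]
    exact mul_le_of_le_one_right zero_le (div_le_one_of_le₀ (by exact_mod_cast hi) hn0.le)

/-- The source up to time `t`, and the whole observation noise. -/
def sourcePast (x v : ℝ≥0 → Ω → ℝ) (t : ℝ≥0) (ω : Ω) : (Set.Iic t → ℝ) × (ℝ≥0 → ℝ) :=
  (fun r => x r ω, fun r => v r ω)

/-- The whole source, and the observation noise up to time `t`. -/
def noisePast (x v : ℝ≥0 → Ω → ℝ) (t : ℝ≥0) (ω : Ω) : (ℝ≥0 → ℝ) × (Set.Iic t → ℝ) :=
  (fun r => x r ω, fun r => v r ω)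

lemma measurable_sourcePast_source (x v : ℝ≥0 → Ω → ℝ) {t r : ℝ≥0} (hr : r ≤ t) :
    Measurable[MeasurableSpace.comap (sourcePast x v t) inferInstance] (x r) :=
  (measurable_pi_apply (⟨r, hr⟩ : Set.Iic t)).comp (comap_measurable (sourcePast x v t)).fst

lemma measurable_sourcePast_noise (x v : ℝ≥0 → Ω → ℝ) (t r : ℝ≥0) :
    Measurable[MeasurableSpace.comap (sourcePast x v t) inferInstance] (v r) :=
  (measurable_pi_apply r).comp (comap_measurable (sourcePast x v t)).snd

lemma measurable_noisePast_source (x v : ℝ≥0 → Ω → ℝ) (t r : ℝ≥0) :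
    Measurable[MeasurableSpace.comap (noisePast x v t) inferInstance] (x r) :=
  (measurable_pi_apply r).comp (comap_measurable (noisePast x v t)).fst

lemma measurable_noisePast_noise (x v : ℝ≥0 → Ω → ℝ) {t r : ℝ≥0} (hr : r ≤ t) :
    Measurable[MeasurableSpace.comap (noisePast x v t) inferInstance] (v r) :=
  (measurable_pi_apply (⟨r, hr⟩ : Set.Iic t)).comp (comap_measurable (noisePast x v t)).snd

/-- Weighted integrals of a continuous process are measurable. -/
lemma measurable_integral_of_continuous {m : MeasurableSpace Ω} {C : ℝ → ℝ} (hC : Measurable C)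
    {x : ℝ≥0 → Ω → ℝ} (hx : ∀ ω, Continuous fun t => x t ω) {a b : ℝ≥0} (hab : a ≤ b)
    (hm : ∀ r ≤ b, Measurable[m] (x r)) :
    Measurable[m] fun ω => ∫ s in (a : ℝ)..b, C s * x s.toNNReal ω := by
  -- Stopping the process at b leaves the integral unchanged and makes the integrand measurable at
  -- all times, as joint measurability requires.
  have h1 : ∀ ω, ∫ s in (a : ℝ)..b, C s * x s.toNNReal ω
      = ∫ s in (a : ℝ)..b, C s * x (min s.toNNReal b) ω := by
    intro ω
    refine intervalIntegral.integral_congr fun s hs => ?_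
    rw [Set.uIcc_of_le (by exact_mod_cast hab)] at hs
    rw [min_eq_left (Real.toNNReal_le_iff_le_coe.2 hs.2)]
  simp_rw [h1, intervalIntegral.integral_of_le (show (a : ℝ) ≤ b by exact_mod_cast hab)]
  have h2 : Measurable (Function.uncurry fun (s : ℝ) ω => x (min s.toNNReal b) ω) := by
    refine measurable_uncurry_of_continuous_of_measurable (fun ω => ?_) fun s => ?_
    · exact (hx ω).comp (continuous_real_toNNReal.min continuous_const)
    · exact hm _ (min_le_right _ _)
  have h3 : Measurable (Function.uncurry fun ω (s : ℝ) => C s * x (min s.toNNReal b) ω) :=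
    (hC.comp measurable_snd).mul (h2.comp measurable_swap)
  exact h3.stronglyMeasurable.integral_prod_right.measurable

end Paths

/-! ### Markov structure and moments of the continuous-time model -/

section Model

variable {Ω : Type*} [MeasurableSpace Ω] {μ : Measure Ω}

lemma indepFun_prodMk_of_indepFun [IsProbabilityMeasure μ] {E F G : Type*} [MeasurableSpace E]
    [MeasurableSpace F] [MeasurableSpace G] {X : Ω → E} {U : Ω → F} {V : Ω → G}
    (hX : Measurable X) (hU : Measurable U) (hV : Measurable V)
    (h1 : IndepFun X (fun ω => (U ω, V ω)) μ) (h2 : IndepFun U V μ) :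
    IndepFun (fun ω => (X ω, U ω)) V μ := by
  have i1 := Measure.isProbabilityMeasure_map (μ := μ) hX.aemeasurable
  have i2 := Measure.isProbabilityMeasure_map (μ := μ) hU.aemeasurable
  have i3 := Measure.isProbabilityMeasure_map (μ := μ) hV.aemeasurable
  have h3 : IndepFun X U μ := h1.comp measurable_id measurable_fst
  rw [indepFun_iff_map_prod_eq_prod_map_map (hX.prodMk hU).aemeasurable hV.aemeasurable]
  rw [indepFun_iff_map_prod_eq_prod_map_map hX.aemeasurable (hU.prodMk hV).aemeasurable] at h1
  rw [indepFun_iff_map_prod_eq_prod_map_map hU.aemeasurable hV.aemeasurable] at h2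
  rw [indepFun_iff_map_prod_eq_prod_map_map hX.aemeasurable hU.aemeasurable] at h3
  rw [h2, ← Measure.prodAssoc_prod] at h1
  rw [h3]
  have h4 := congrArg (Measure.map (MeasurableEquiv.prodAssoc (α := E) (β := F) (γ := G)).symm) h1
  rw [Measure.map_map (by fun_prop) (by fun_prop), Measure.map_map (by fun_prop) (by fun_prop),
    MeasurableEquiv.symm_comp_self, Measure.map_id] at h4
  exact h4

variable {A B : ℝ} {S0 : ℝ≥0} {x w v : ℝ≥0 → Ω → ℝ}

lemma IsModel.ae_isLinearPath (h : IsModel μ A B S0 x w v) :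
    ∀ᵐ ω ∂μ, IsLinearPath A B (fun t => x t ω) (fun t => w t ω) := by
  filter_upwards [h.sde] with ω hω
  exact ⟨h.continuous_x ω, h.continuous_w ω, hω⟩

lemma IsModel.ae_eq_flow (h : IsModel μ A B S0 x w v) (hA : A < 0) :
    ∀ᵐ ω ∂μ, ∀ s, x s ω = flow A B w (x 0) s ω := by
  filter_upwards [h.ae_isLinearPath] with ω hω s
  have := (hω.tendsto_euler hA 0 s).limsup_eq
  rw [zero_add] at this
  exact this.symm

lemma IsModel.ae_tendsto_increment (h : IsModel μ A B S0 x w v) (hA : A < 0) (t s : ℝ≥0) :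
    ∀ᵐ ω ∂μ, Tendsto (fun n : ℕ => euler A B (s / n) (fun r => w (t + r) ω - w t ω) 0 n) atTop
      (𝓝 (x (t + s) ω - Real.exp (A * s) * x t ω)) := by
  filter_upwards [h.ae_isLinearPath] with ω hω
  exact hω.tendsto_euler_zero hA t s

lemma Qd_nonneg {A : ℝ} {s : ℝ} (hs : 0 ≤ s) : 0 ≤ Qd A s :=
  intervalIntegral.integral_nonneg hs fun _ _ => mul_self_nonneg _

lemma IsModel.map_increment [IsProbabilityMeasure μ] (h : IsModel μ A B S0 x w v) (hA : A < 0)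
    (t s : ℝ≥0) :
    μ.map (fun ω => x (t + s) ω - Real.exp (A * s) * x t ω)
      = gaussianReal 0 (Real.toNNReal (B ^ 2 * Qd A s)) := by
  have hw : ∀ r, Measurable fun ω => w (t + r) ω - w t ω := fun r =>
    (h.measurable_w _).sub (h.measurable_w _)
  refine map_gaussian_of_tendsto
    (fun n => measurable_euler A B (s / n) (measurable_const (a := (0 : ℝ))) n fun i _ => hw _)
    ((h.measurable_x _).sub ((h.measurable_x _).const_mul _))
    (fun n => map_euler (h.brownian_w.shift t).toIsPreBrownianReal hw A B (s / n) n)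
    (h.ae_tendsto_increment hA t s) ?_
  rw [Real.coe_toNNReal _ (mul_nonneg (sq_nonneg _) (Qd_nonneg s.coe_nonneg))]
  exact tendsto_eulerVar hA B s

lemma IsModel.measurable_path_w (h : IsModel μ A B S0 x w v) : Measurable fun ω t => w t ω :=
  measurable_pi_of_forall h.measurable_w

lemma IsModel.measurable_path_v (h : IsModel μ A B S0 x w v) : Measurable fun ω t => v t ω :=
  measurable_pi_of_forall h.measurable_v

/-- The increment is a functional of w after t, the earlier source of x 0 and w up to t, and v is
independent of both. The entire observation noise sits on the side of the past, so every estimate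
formed by time t is covered for any gain. -/
lemma IsModel.indepFun_increment [IsProbabilityMeasure μ] (h : IsModel μ A B S0 x w v) (hA : A < 0)
    (t s : ℝ≥0) :
    IndepFun (sourcePast x v t) (fun ω => x (t + s) ω - Real.exp (A * s) * x t ω) μ := by
  have mU : Measurable fun ω (r : Set.Iic t) => w r ω :=
    measurable_pi_of_forall fun r => h.measurable_w r
  have mV : Measurable fun ω r => w (t + r) ω - w t ω :=
    measurable_pi_of_forall fun r => (h.measurable_w _).sub (h.measurable_w _)
  have h1 : IndepFun (fun ω => (x 0 ω, fun r : Set.Iic t => w r ω))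
      (fun ω r => w (t + r) ω - w t ω) μ := by
    refine indepFun_prodMk_of_indepFun (h.measurable_x 0) mU mV ?_
      (h.brownian_w.indepFun_shift t).symm
    refine h.indep_init.comp (φ := id)
      (ψ := fun f : ℝ≥0 → ℝ => ((fun r : Set.Iic t => f r), fun r => f (t + r) - f t))
      measurable_id ?_
    exact Measurable.prodMk (by fun_prop) (by fun_prop)
  have h2 : IndepFun (fun ω => ((fun r => v r ω : ℝ≥0 → ℝ), (x 0 ω, fun r : Set.Iic t => w r ω)))
      (fun ω r => w (t + r) ω - w t ω) μ := by
    refine indepFun_prodMk_of_indepFun h.measurable_path_v ((h.measurable_x 0).prodMk mU) mV ?_ h1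
    refine h.indep_obs.symm.comp (φ := id)
      (ψ := fun f : ℝ × (ℝ≥0 → ℝ) =>
        ((f.1, fun r : Set.Iic t => f.2 r), fun r => f.2 (t + r) - f.2 t)) measurable_id ?_
    exact Measurable.prodMk (by fun_prop) (by fun_prop)
  have e1 : (fun ω => ((fun r : Set.Iic t => flow A B w (x 0) r ω), (fun r => v r ω : ℝ≥0 → ℝ)))
      =ᵐ[μ] sourcePast x v t := by
    filter_upwards [h.ae_eq_flow hA] with ω hω
    simp only [sourcePast, ← hω]
  have e2 : (fun ω => limsup (fun n : ℕ =>
      euler A B (s / n) (fun r => w (t + r) ω - w t ω) 0 n) atTop)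
      =ᵐ[μ] fun ω => x (t + s) ω - Real.exp (A * s) * x t ω := by
    filter_upwards [h.ae_tendsto_increment hA t s] with ω hω
    exact hω.limsup_eq
  refine IndepFun.congr ?_ e1 e2
  rw [IndepFun_iff_Indep] at h2 ⊢
  have c := comap_measurable (m := inferInstance)
    (fun ω => ((fun r => v r ω : ℝ≥0 → ℝ), (x 0 ω, fun r : Set.Iic t => w r ω)))
  refine indep_of_indep_of_le_left (indep_of_indep_of_le_right h2 ?_) ?_
  · refine Measurable.comap_le (Measurable.limsup fun n => ?_)
    refine measurable_euler A B (s / n) measurable_const n fun i _ => ?_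
    exact (measurable_pi_apply _).comp (comap_measurable fun ω r => w (t + r) ω - w t ω)
  · refine Measurable.comap_le (Measurable.prodMk (measurable_pi_of_forall fun r => ?_) ?_)
    · refine measurable_flow A B c.snd.fst fun q hq => ?_
      exact (measurable_pi_apply (⟨q, hq.trans r.2⟩ : Set.Iic t)).comp c.snd.snd
    · exact c.fst

lemma IsModel.map_noise (h : IsModel μ A B S0 x w v) (t s : ℝ≥0) :
    μ.map (fun ω => v (t + s) ω - v t ω) = gaussianReal 0 s :=
  ((h.brownian_v.shift t).hasLaw_eval s).map_eq

/-- Here the whole source sits with the past of v, since it is a functional of x 0 and w: the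
observation is a channel whose input is the complete source path. -/
lemma IsModel.indepFun_noise [IsProbabilityMeasure μ] (h : IsModel μ A B S0 x w v) (hA : A < 0)
    (t s : ℝ≥0) :
    IndepFun (noisePast x v t) (fun ω => v (t + s) ω - v t ω) μ := by
  have mU : Measurable fun ω (r : Set.Iic t) => v r ω :=
    measurable_pi_of_forall fun r => h.measurable_v r
  have mV : Measurable fun ω => v (t + s) ω - v t ω :=
    (h.measurable_v _).sub (h.measurable_v _)
  have h2 : IndepFun (fun ω => ((x 0 ω, fun r => w r ω), fun r : Set.Iic t => v r ω))
      (fun ω => v (t + s) ω - v t ω) μ := by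
    refine indepFun_prodMk_of_indepFun ((h.measurable_x 0).prodMk h.measurable_path_w) mU mV ?_ ?_
    · refine h.indep_obs.comp (φ := id)
        (ψ := fun f : ℝ≥0 → ℝ => ((fun r : Set.Iic t => f r), f (t + s) - f t)) measurable_id ?_
      exact Measurable.prodMk (by fun_prop) (by fun_prop)
    · exact (h.brownian_v.indepFun_shift t).symm.comp (φ := id) (ψ := fun f : ℝ≥0 → ℝ => f s)
        measurable_id (measurable_pi_apply s)
  have e1 : (fun ω => ((fun r => flow A B w (x 0) r ω : ℝ≥0 → ℝ), (fun r : Set.Iic t => v r ω)))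
      =ᵐ[μ] noisePast x v t := by
    filter_upwards [h.ae_eq_flow hA] with ω hω
    simp only [noisePast, ← hω]
  refine IndepFun.congr ?_ e1 Filter.EventuallyEq.rfl
  rw [IndepFun_iff_Indep] at h2 ⊢
  have c := comap_measurable (m := inferInstance)
    (fun ω => ((x 0 ω, (fun r => w r ω : ℝ≥0 → ℝ)), (fun r : Set.Iic t => v r ω)))
  refine indep_of_indep_of_le_left h2 ?_
  refine Measurable.comap_le (Measurable.prodMk (measurable_pi_of_forall fun r => ?_) c.snd)
  exact measurable_flow A B c.fst.fst fun q _ => (measurable_pi_apply q).comp c.fst.snd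

lemma IsModel.memLp_init [IsProbabilityMeasure μ] (h : IsModel μ A B S0 x w v) :
    MemLp (x 0) 2 μ := memLp_of_map_gaussian (h.measurable_x 0) h.init

lemma IsModel.measurable_increment (h : IsModel μ A B S0 x w v) (t s : ℝ≥0) :
    Measurable fun ω => x (t + s) ω - Real.exp (A * s) * x t ω :=
  (h.measurable_x _).sub ((h.measurable_x _).const_mul _)

lemma IsModel.memLp_increment [IsProbabilityMeasure μ] (h : IsModel μ A B S0 x w v) (hA : A < 0)
    (t s : ℝ≥0) : MemLp (fun ω => x (t + s) ω - Real.exp (A * s) * x t ω) 2 μ :=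
  memLp_of_map_gaussian (h.measurable_increment t s) (h.map_increment hA t s)

lemma IsModel.memLp [IsProbabilityMeasure μ] (h : IsModel μ A B S0 x w v) (hA : A < 0)
    (t : ℝ≥0) : MemLp (x t) 2 μ := by
  have h1 := (h.memLp_increment hA 0 t).add (h.memLp_init.const_mul (Real.exp (A * t)))
  rw [zero_add] at h1
  convert h1 using 1
  funext ω
  simp

lemma IsModel.integral_increment [IsProbabilityMeasure μ] (h : IsModel μ A B S0 x w v) (hA : A < 0)
    (t s : ℝ≥0) : ∫ ω, (x (t + s) ω - Real.exp (A * s) * x t ω) ∂μ = 0 :=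
  integral_of_map_gaussian (h.measurable_increment t s) (h.map_increment hA t s)

lemma IsModel.integral_increment_sq [IsProbabilityMeasure μ] (h : IsModel μ A B S0 x w v)
    (hA : A < 0) (t s : ℝ≥0) :
    ∫ ω, (x (t + s) ω - Real.exp (A * s) * x t ω) ^ 2 ∂μ = B ^ 2 * Qd A s := by
  rw [integral_sq_of_map_gaussian (h.measurable_increment t s) (h.map_increment hA t s),
    Real.coe_toNNReal _ (mul_nonneg (sq_nonneg _) (Qd_nonneg s.coe_nonneg))]

/-- The mean square of the source plus a variable of the past, one step ahead. -/
lemma IsModel.integral_sq_step [IsProbabilityMeasure μ] (h : IsModel μ A B S0 x w v)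
    (hA : A < 0) (t s : ℝ≥0) {Y : Ω → ℝ} (hY : MemLp Y 2 μ)
    (hYm : Measurable[MeasurableSpace.comap (sourcePast x v t) inferInstance] Y) :
    ∫ ω, (Y ω + (x (t + s) ω - Real.exp (A * s) * x t ω)) ^ 2 ∂μ
      = ∫ ω, Y ω ^ 2 ∂μ + B ^ 2 * Qd A s := by
  have hi : IndepFun Y (fun ω => x (t + s) ω - Real.exp (A * s) * x t ω) μ := by
    have h1 := h.indepFun_increment hA t s
    rw [IndepFun_iff_Indep] at h1 ⊢
    exact indep_of_indep_of_le_left h1 hYm.comap_le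
  have h2 := integral_sq_add_of_indepFun hY (h.memLp_increment hA t s)
    ?_ hi 1 1
  · simp only [one_mul, one_pow] at h2
    rw [h2, h.integral_increment_sq hA]
  · exact h.integral_increment hA t s

/-- The one-step variance formula started at time 0; stability bounds both of its terms uniformly in
t. -/
lemma IsModel.integral_sq_le [IsProbabilityMeasure μ] (h : IsModel μ A B S0 x w v) (hA : A < 0)
    (t : ℝ≥0) : ∫ ω, x t ω ^ 2 ∂μ ≤ S0 + B ^ 2 / (-(2 * A)) := by
  have h1 := h.integral_sq_step hA 0 t (h.memLp_init.const_mul (Real.exp (A * t)))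
    ((measurable_sourcePast_source x v le_rfl).const_mul _)
  simp only [zero_add, add_sub_cancel, mul_pow] at h1
  rw [h1, integral_const_mul, integral_sq_of_map_gaussian (h.measurable_x 0) h.init]
  have h2 : Real.exp (A * t) ^ 2 ≤ 1 :=
    pow_le_one₀ (Real.exp_pos _).le (Real.exp_le_one_iff.2 (by nlinarith [t.coe_nonneg]))
  have h3 : Qd A t ≤ 1 / (-(2 * A)) := by
    rw [Qd_eq hA, le_div_iff₀ (by linarith)]
    have h5 : (Real.exp (2 * A * t) - 1) / (2 * A) * -(2 * A) = 1 - Real.exp (2 * A * t) := by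
      rw [mul_neg, div_mul_cancel₀ _ (by linarith)]
      ring
    rw [h5]
    linarith [Real.exp_pos (2 * A * t)]
  have h4 := mul_le_mul_of_nonneg_left h3 (sq_nonneg B)
  rw [mul_one_div] at h4
  have := mul_le_mul_of_nonneg_right h2 S0.coe_nonneg
  linarith

end Model

end GaussMarkov

namespace GaussMarkov

/-! ### Conditional expectations and observation σ-algebras -/

section BestPredictor

variable {Ω : Type*} {m m0 : MeasurableSpace Ω} {μ : Measure Ω}

/-- The conditional expectation is the best mean square predictor. -/
lemma integral_sub_condExp_sq_le [IsProbabilityMeasure μ] (hm : m ≤ m0) {X Y : Ω → ℝ}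
    (hX : MemLp X 2 μ) (hY : MemLp Y 2 μ) (hYm : StronglyMeasurable[m] Y) :
    ∫ ω, (X ω - μ[X | m] ω) ^ 2 ∂μ ≤ ∫ ω, (X ω - Y ω) ^ 2 ∂μ := by
  have hE : MemLp (μ[X | m]) 2 μ := hX.condExp (by norm_num)
  have hf : StronglyMeasurable[m] fun ω => μ[X | m] ω - Y ω :=
    stronglyMeasurable_condExp.sub hYm
  have hg : MemLp (fun ω => X ω - μ[X | m] ω) 2 μ := hX.sub hE
  have hf2 : MemLp (fun ω => μ[X | m] ω - Y ω) 2 μ := hE.sub hY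
  have hfg : Integrable (fun ω => (μ[X | m] ω - Y ω) * (X ω - μ[X | m] ω)) μ := hf2.integrable_mul hg
  have h0 : ∫ ω, (μ[X | m] ω - Y ω) * (X ω - μ[X | m] ω) ∂μ = 0 := by
    rw [← integral_condExp hm]
    have h1 := condExp_mul_of_stronglyMeasurable_left (μ := μ) hf hfg
      (hg.integrable (by norm_num))
    have h2 : μ[fun ω => X ω - μ[X | m] ω | m] =ᵐ[μ] 0 := by
      have h3 := condExp_sub (m := m) (hX.integrable (by norm_num)) (hE.integrable (by norm_num))
      refine h3.trans ?_
      rw [condExp_of_stronglyMeasurable hm stronglyMeasurable_condExp integrable_condExp, sub_self]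
    have h4 : μ[fun ω => (μ[X | m] ω - Y ω) * (X ω - μ[X | m] ω) | m] =ᵐ[μ] fun _ => (0 : ℝ) := by
      refine h1.trans ?_
      filter_upwards [h2] with ω hω
      simp only [Pi.mul_apply, Pi.zero_apply] at hω ⊢
      rw [hω, mul_zero]
    rw [integral_congr_ae h4, integral_zero]
  have e : ∀ ω, (X ω - Y ω) ^ 2 = (X ω - μ[X | m] ω) ^ 2
      + ((μ[X | m] ω - Y ω) ^ 2 + 2 * ((μ[X | m] ω - Y ω) * (X ω - μ[X | m] ω))) := fun ω => by ring
  simp_rw [e]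
  have i1 : Integrable (fun ω => (μ[X | m] ω - Y ω) ^ 2
      + 2 * ((μ[X | m] ω - Y ω) * (X ω - μ[X | m] ω))) μ := hf2.integrable_sq.add (hfg.const_mul 2)
  rw [integral_add hg.integrable_sq i1, integral_add hf2.integrable_sq (hfg.const_mul 2),
    integral_const_mul, h0]
  have : 0 ≤ ∫ ω, (μ[X | m] ω - Y ω) ^ 2 ∂μ := integral_nonneg fun ω => sq_nonneg _
  linarith

end BestPredictor

section Observations

variable {Ω : Type*} {x v : ℝ≥0 → Ω → ℝ} {C : ℝ → ℝ}

lemma obsAlgebra_mono (C : ℝ → ℝ) (x v : ℝ≥0 → Ω → ℝ) {s t : ℝ≥0} (h : s ≤ t) :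
    obsAlgebra C x v s ≤ obsAlgebra C x v t :=
  iSup_le fun r => le_iSup_of_le (⟨r.1, r.2.trans h⟩ : Set.Iic t) le_rfl

lemma measurable_obs {m : MeasurableSpace Ω} (hC : Measurable C)
    (hx : ∀ ω, Continuous fun t => x t ω) {t : ℝ≥0} (hxm : ∀ r ≤ t, Measurable[m] (x r))
    (hvm : Measurable[m] (v t)) : Measurable[m] (obs C x v t) := by
  have h := measurable_integral_of_continuous hC hx (zero_le (a := t)) hxm
  rw [NNReal.coe_zero] at h
  exact h.add hvm

lemma obsAlgebra_le_of_measurable {m : MeasurableSpace Ω} (hC : Measurable C)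
    (hx : ∀ ω, Continuous fun t => x t ω) {t : ℝ≥0} (hxm : ∀ r ≤ t, Measurable[m] (x r))
    (hvm : ∀ r ≤ t, Measurable[m] (v r)) : obsAlgebra C x v t ≤ m :=
  iSup_le fun r => (measurable_obs hC hx (fun q hq => hxm q (hq.trans r.2)) (hvm r r.2)).comap_le

end Observations

/-! ### Continuous-time lower bound by sampling -/

section LowerBound

variable {Ω : Type*} [MeasurableSpace Ω] {μ : Measure Ω} {A B : ℝ} {S0 : ℝ≥0}
  {x w v : ℝ≥0 → Ω → ℝ} {C : ℝ → ℝ}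

lemma IsModel.obsAlgebra_le (h : IsModel μ A B S0 x w v) (hC : Measurable C) (t : ℝ≥0) :
    obsAlgebra C x v t ≤ ‹MeasurableSpace Ω› :=
  obsAlgebra_le_of_measurable hC h.continuous_x (fun r _ => h.measurable_x r)
    fun r _ => h.measurable_v r

lemma IsModel.measurable_estimate (h : IsModel μ A B S0 x w v) (hC : Measurable C) (t : ℝ≥0) :
    Measurable (estimate μ C x v t) :=
  (stronglyMeasurable_condExp.mono (h.obsAlgebra_le hC t)).measurable

lemma IsModel.measurable_sourcePast_estimate (h : IsModel μ A B S0 x w v) (hC : Measurable C)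
    {s t : ℝ≥0} (hst : s ≤ t) :
    Measurable[MeasurableSpace.comap (sourcePast x v t) inferInstance] (estimate μ C x v s) := by
  refine (stronglyMeasurable_condExp.mono ?_).measurable
  exact obsAlgebra_le_of_measurable hC h.continuous_x
    (fun r hr => measurable_sourcePast_source x v (hr.trans hst))
    fun r _ => measurable_sourcePast_noise x v t r

variable [IsProbabilityMeasure μ]

lemma IsModel.memLp_estimate (h : IsModel μ A B S0 x w v) (hA : A < 0) (t : ℝ≥0) :
    MemLp (estimate μ C x v t) 2 μ := (h.memLp hA t).condExp (by norm_num)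

lemma IsModel.memLp_error (h : IsModel μ A B S0 x w v) (hA : A < 0) (t : ℝ≥0) :
    MemLp (fun ω => x t ω - estimate μ C x v t ω) 2 μ := (h.memLp hA t).sub (h.memLp_estimate hA t)

lemma Qd_le {A : ℝ} (hA : A < 0) {s : ℝ} (hs : 0 ≤ s) : Qd A s ≤ s := by
  have h1 : ∀ t ∈ Set.Icc (0 : ℝ) s, Ad A t * Ad A t ≤ 1 := by
    intro t ht
    have h2 : Ad A t ≤ 1 := Real.exp_le_one_iff.2 (by nlinarith [ht.1])
    have h3 : 0 ≤ Ad A t := (Real.exp_pos _).le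
    nlinarith
  have h4 := intervalIntegral.integral_mono_on hs (μ := volume) (f := fun t => Ad A t * Ad A t)
    (g := fun _ => (1 : ℝ)) (Continuous.intervalIntegrable (by unfold Ad; fun_prop) _ _)
    (by simp) h1
  simpa [Qd] using h4

/-- Propagating the old estimate by exp (A s) gives a competitor that ignores the new observations;
its error contracts and then gains the variance of the source increment. -/
lemma IsModel.error_le (h : IsModel μ A B S0 x w v) (hA : A < 0) (hC : Measurable C)
    (t s : ℝ≥0) :
    ∫ ω, (x (t + s) ω - estimate μ C x v (t + s) ω) ^ 2 ∂μ
      ≤ ∫ ω, (x t ω - estimate μ C x v t ω) ^ 2 ∂μ + B ^ 2 * s := by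
  set a := Real.exp (A * s) with ha
  have h1 : ∫ ω, (x (t + s) ω - estimate μ C x v (t + s) ω) ^ 2 ∂μ
      ≤ ∫ ω, (x (t + s) ω - a * estimate μ C x v t ω) ^ 2 ∂μ := by
    refine integral_sub_condExp_sq_le (h.obsAlgebra_le hC _) (h.memLp hA _)
      ((h.memLp_estimate hA t).const_mul a) ?_
    exact (stronglyMeasurable_condExp.mono
      (obsAlgebra_mono C x v (le_add_of_nonneg_right zero_le))).const_mul a
  have h2 := h.integral_sq_step hA t s ((h.memLp_error (C := C) hA t).const_mul a)
    (((measurable_sourcePast_source x v le_rfl).sub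
      (h.measurable_sourcePast_estimate hC le_rfl)).const_mul a)
  have e : ∀ ω, a * (x t ω - estimate μ C x v t ω) + (x (t + s) ω - a * x t ω)
      = x (t + s) ω - a * estimate μ C x v t ω := fun ω => by ring
  simp only [← ha] at h2
  simp_rw [e, mul_pow] at h2
  rw [integral_const_mul] at h2
  rw [h2] at h1
  have h3 : a ^ 2 ≤ 1 :=
    pow_le_one₀ (Real.exp_pos _).le (Real.exp_le_one_iff.2 (by nlinarith [s.coe_nonneg]))
  have h4 : 0 ≤ ∫ ω, (x t ω - estimate μ C x v t ω) ^ 2 ∂μ := integral_nonneg fun ω => sq_nonneg _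
  have h5 := mul_le_mul_of_nonneg_left (Qd_le hA s.coe_nonneg) (sq_nonneg B)
  nlinarith

lemma IsModel.lintegral_error (h : IsModel μ A B S0 x w v) (hA : A < 0) (t : ℝ≥0) :
    ∫⁻ ω, ENNReal.ofReal ((x t ω - estimate μ C x v t ω) ^ 2) ∂μ
      = ENNReal.ofReal (∫ ω, (x t ω - estimate μ C x v t ω) ^ 2 ∂μ) :=
  (ofReal_integral_eq_lintegral_ofReal (h.memLp_error hA t).integrable_sq
    (ae_of_all _ fun _ => sq_nonneg _)).symm

/-- The errors on a grid are controlled by the accumulated error. -/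
lemma IsModel.sum_error_le (h : IsModel μ A B S0 x w v) (hA : A < 0) (hC : Measurable C)
    (δ : ℝ≥0) (K : ℕ) :
    ENNReal.ofReal (δ * ∑ k ∈ Finset.range K,
        ∫ ω, (x ((k + 1 : ℕ) * δ) ω - estimate μ C x v ((k + 1 : ℕ) * δ) ω) ^ 2 ∂μ)
      ≤ (∫⁻ t in Set.Ioc (0 : ℝ) ((K * δ : ℝ≥0) : ℝ),
          ∫⁻ ω, ENNReal.ofReal ((x t.toNNReal ω - estimate μ C x v t.toNNReal ω) ^ 2) ∂μ)
        + ENNReal.ofReal (K * (B ^ 2 * δ * δ)) := by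
  induction K with
  | zero => simp
  | succ K ih =>
    rw [Finset.sum_range_succ, mul_add, ENNReal.ofReal_add
      (mul_nonneg δ.coe_nonneg (Finset.sum_nonneg fun k _ => integral_nonneg fun ω => sq_nonneg _))
      (mul_nonneg δ.coe_nonneg (integral_nonneg fun ω => sq_nonneg _))]
    have hle : ((K * δ : ℝ≥0) : ℝ) ≤ (((K + 1 : ℕ) * δ : ℝ≥0) : ℝ) := by
      push_cast; nlinarith [δ.coe_nonneg]
    have hsplit : Set.Ioc (0 : ℝ) (((K + 1 : ℕ) * δ : ℝ≥0) : ℝ)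
        = Set.Ioc (0 : ℝ) ((K * δ : ℝ≥0) : ℝ)
          ∪ Set.Ioc ((K * δ : ℝ≥0) : ℝ) (((K + 1 : ℕ) * δ : ℝ≥0) : ℝ) :=
      (Set.Ioc_union_Ioc_eq_Ioc (NNReal.coe_nonneg _) hle).symm
    rw [hsplit, lintegral_union measurableSet_Ioc
      (Set.disjoint_left.2 fun r h1 h2 => absurd h1.2 (not_le.2 h2.1))]
    have hcell : ENNReal.ofReal (δ *
        ∫ ω, (x ((K + 1 : ℕ) * δ) ω - estimate μ C x v ((K + 1 : ℕ) * δ) ω) ^ 2 ∂μ)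
        ≤ (∫⁻ t in Set.Ioc ((K * δ : ℝ≥0) : ℝ) (((K + 1 : ℕ) * δ : ℝ≥0) : ℝ),
          ∫⁻ ω, ENNReal.ofReal ((x t.toNNReal ω - estimate μ C x v t.toNNReal ω) ^ 2) ∂μ)
          + ENNReal.ofReal (B ^ 2 * δ * δ) := by
      have hvol : volume (Set.Ioc ((K * δ : ℝ≥0) : ℝ) (((K + 1 : ℕ) * δ : ℝ≥0) : ℝ))
          = ENNReal.ofReal δ := by
        rw [Real.volume_Ioc]; congr 1; push_cast; ring
      have hconst : ∀ c : ℝ, 0 ≤ c → ENNReal.ofReal (c * δ)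
          = ∫⁻ _ in Set.Ioc ((K * δ : ℝ≥0) : ℝ) (((K + 1 : ℕ) * δ : ℝ≥0) : ℝ), ENNReal.ofReal c := by
        intro c hc
        rw [lintegral_const, Measure.restrict_apply_univ, hvol, ENNReal.ofReal_mul hc]
      rw [mul_comm, hconst _ (integral_nonneg fun ω => sq_nonneg _), hconst _ (by positivity),
        ← lintegral_add_right _ measurable_const]
      refine setLIntegral_mono' measurableSet_Ioc fun t ht => ?_
      rw [h.lintegral_error hA, ← ENNReal.ofReal_add (integral_nonneg fun ω => sq_nonneg _)
        (by positivity)]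
      apply ENNReal.ofReal_le_ofReal
      have ht0 : 0 ≤ t := (NNReal.coe_nonneg _).trans ht.1.le
      have hle' : t.toNNReal ≤ (K + 1 : ℕ) * δ := Real.toNNReal_le_iff_le_coe.2 ht.2
      -- The grid error is taken at the right endpoint of the cell, so it exceeds the error at any
      -- earlier t of the cell by at most B² δ.
      have h1 := h.error_le hA hC t.toNNReal ((K + 1 : ℕ) * δ - t.toNNReal)
      rw [add_tsub_cancel_of_le hle'] at h1
      refine h1.trans ?_
      have h2 : (((K + 1 : ℕ) * δ - t.toNNReal : ℝ≥0) : ℝ) ≤ δ := by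
        rw [NNReal.coe_sub hle', Real.coe_toNNReal _ ht0]
        have := ht.1
        push_cast at this ⊢
        linarith
      have := mul_le_mul_of_nonneg_left h2 (sq_nonneg B)
      linarith
    refine (add_le_add ih hcell).trans (le_of_eq ?_)
    have e : ENNReal.ofReal (((K + 1 : ℕ) : ℝ) * (B ^ 2 * δ * δ))
        = ENNReal.ofReal (K * (B ^ 2 * δ * δ)) + ENNReal.ofReal (B ^ 2 * δ * δ) := by
      rw [← ENNReal.ofReal_add (by positivity) (by positivity)]
      congr 1
      push_cast
      ring
    rw [e]
    ring

lemma IsModel.mutualInfo_grid_le (h : IsModel μ A B S0 x w v) (hC : Measurable C) (δ : ℝ≥0)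
    {n : ℕ} {T : ℝ≥0} (hT : n * δ ≤ T) :
    mutualInfo μ (fun ω (i : Fin (n + 1)) => x ((i : ℕ) * δ) ω)
        (fun ω (i : Fin (n + 1)) => estimate μ C x v ((i : ℕ) * δ) ω)
      ≤ mutualInfo μ (fun ω (s : Set.Iic T) => x s ω)
          (fun ω (s : Set.Iic T) => estimate μ C x v s ω) := by
  have hi : ∀ i : Fin (n + 1), ((i : ℕ) : ℝ≥0) * δ ≤ T := fun i =>
    le_trans (by gcongr; exact_mod_cast Nat.lt_succ_iff.1 i.2) hT
  exact mutualInfo_comp_le μ (X := fun ω (s : Set.Iic T) => x s ω)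
    (Y := fun ω (s : Set.Iic T) => estimate μ C x v s ω) (measurable_pi_of_forall fun s => h.measurable_x s)
    (measurable_pi_of_forall fun s => h.measurable_estimate hC s)
    (f := fun (g : Set.Iic T → ℝ) (i : Fin (n + 1)) => g ⟨_, hi i⟩)
    (g := fun (g : Set.Iic T → ℝ) (i : Fin (n + 1)) => g ⟨_, hi i⟩) (by fun_prop) (by fun_prop)

/-- Sampling at period δ can only lose information, and the samples form a Gauss-Markov sequence
with a causal reconstruction. The second term is the price of comparing sampled errors with the time
average. -/
lemma IsModel.le_ctInfoRate_of_period (h : IsModel μ A B S0 x w v) (hA : A < 0) (hB : B ≠ 0)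
    (hS0 : S0 ≠ 0) (hC : Measurable C) {p : ℝ} (hp : 0 < p)
    (hD : ctDistortion μ C x v ≤ ENNReal.ofReal p) {δ : ℝ≥0} (hδ : 0 < δ) :
    ENNReal.ofReal ((Real.log (1 + (2 * A + B ^ 2 / p) * Qd A δ) / 2 / δ
        - B ^ 2 * Qd A δ / (2 * p * p * Ad A δ ^ 2) * (1 + B ^ 2)) / Real.log 2)
      ≤ ctInfoRate μ C x v := by
  have hl : 0 < Real.log 2 := Real.log_pos (by norm_num)
  have hδ0 : (0 : ℝ) < δ := by exact_mod_cast hδ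
  have hQ : 0 < Qd A δ := Qd_pos hA hδ0
  obtain ⟨a, ha⟩ : ∃ a, a = Real.exp (A * δ) := ⟨_, rfl⟩
  have ha0 : 0 < a := ha ▸ Real.exp_pos _
  obtain ⟨q, hq⟩ : ∃ q, q = Real.toNNReal (B ^ 2 * Qd A δ) := ⟨_, rfl⟩
  have hqv : (q : ℝ) = B ^ 2 * Qd A δ := by rw [hq, Real.coe_toNNReal _ (by positivity)]
  have hq0 : (0 : ℝ) < q := by rw [hqv]; positivity
  have hqne : q ≠ 0 := by exact_mod_cast hq0.ne'
  have hsucc : ∀ k : ℕ, ((k + 1 : ℕ) : ℝ≥0) * δ = k * δ + δ := fun k => by push_cast; ring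
  have key := fun n => le_klDiv_of_causal (P := μ) (x := fun k => x (k * δ))
    (y := fun k => estimate μ C x v (k * δ)) (a := a) (v := q) (S := S0)
    (fun k => h.measurable_x _) (fun k => h.measurable_estimate hC _) hqne hS0
    (by simpa using h.init)
    (fun k => by rw [ha, hq, hsucc]; exact h.map_increment hA _ _)
    (fun k => by
      have h1 := (h.indepFun_increment hA (k * δ) δ).symm
      rw [hsucc, ha]
      rw [IndepFun_iff_Indep] at h1 ⊢
      refine indep_of_indep_of_le_right h1 (Measurable.comap_le (Measurable.prodMk ?_ ?_))
      · refine measurable_pi_of_forall fun i => measurable_sourcePast_source x v ?_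
        gcongr; exact_mod_cast Nat.lt_succ_iff.1 i.2
      · refine measurable_pi_of_forall fun i => h.measurable_sourcePast_estimate hC ?_
        gcongr; exact_mod_cast Nat.lt_succ_iff.1 i.2)
    (fun k => h.memLp_error hA _) hp n
  obtain ⟨c, hc⟩ : ∃ c, c = Real.log ((a ^ 2 * p + q) / p) / 2 := ⟨_, rfl⟩
  obtain ⟨g, hg⟩ : ∃ g, g = (q : ℝ) / (2 * (a ^ 2 * p + q) * p) := ⟨_, rfl⟩
  have hg0 : 0 ≤ g := by rw [hg]; positivity
  rw [← hc, ← hg] at key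
  set V : ℕ → ℝ := fun k => ∫ ω, (x (k * δ) ω - estimate μ C x v (k * δ) ω) ^ 2 ∂μ with hV
  have hV0 : ∀ k, 0 ≤ V k := fun k => integral_nonneg fun ω => sq_nonneg _
  have htend : Tendsto (fun K : ℕ => (K : ℝ≥0) * δ) atTop atTop :=
    tendsto_natCast_atTop_atTop.atTop_mul_const hδ
  -- The excess over p has two sources: the slack in the limsup, taken to be δ itself, and the
  -- growth B² δ within a cell.
  have hsum : ∀ᶠ K : ℕ in atTop,
      ∑ k ∈ Finset.range K, V (k + 1) ≤ K * (p + δ + B ^ 2 * δ) := by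
    have h1 : ∀ᶠ T : ℝ≥0 in atTop, (∫⁻ t in Set.Ioc (0 : ℝ) T,
        ∫⁻ ω, ENNReal.ofReal ((x t.toNNReal ω - estimate μ C x v t.toNNReal ω) ^ 2) ∂μ)
          / (T : ℝ≥0∞) < ENNReal.ofReal (p + δ) := by
      refine eventually_lt_of_limsup_lt (hD.trans_lt ?_)
      rw [ENNReal.ofReal_lt_ofReal_iff (by positivity)]
      linarith
    filter_upwards [htend.eventually h1, eventually_gt_atTop 0] with K hK hK0
    have hKδ : ((K : ℝ≥0) * δ) ≠ 0 := by positivity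
    have h2 := (ENNReal.div_le_iff (by exact_mod_cast hKδ) ENNReal.coe_ne_top).1 hK.le
    have h3 := (h.sum_error_le hA hC δ K).trans (add_le_add_left h2 _)
    rw [← ENNReal.ofReal_coe_nnreal (p := (K : ℝ≥0) * δ), ← ENNReal.ofReal_mul (by positivity),
      ← ENNReal.ofReal_add (by positivity) (by positivity),
      ENNReal.ofReal_le_ofReal_iff (by positivity)] at h3
    push_cast at h3
    have h4 : (δ : ℝ) * ∑ k ∈ Finset.range K, V (k + 1) ≤ δ * (K * (p + δ + B ^ 2 * δ)) := by
      simp only [hV]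
      push_cast
      linarith
    exact le_of_mul_le_mul_left h4 hδ0
  obtain ⟨M, hM⟩ : ∃ M : ℝ, M = S0 + B ^ 2 / (-(2 * A)) := ⟨_, rfl⟩
  have hbound : ENNReal.ofReal ((c - g * (δ + B ^ 2 * δ)) / (δ * Real.log 2))
      ≤ limsup ((fun T : ℝ≥0 => mutualInfo μ (fun ω (s : Set.Iic T) => x s ω)
        (fun ω (s : Set.Iic T) => estimate μ C x v s ω) / (T : ℝ≥0∞))
          ∘ fun K : ℕ => (K : ℝ≥0) * δ) atTop := by
    refine le_limsup_of_affine_le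
      (β := (-g * V 0 + (Real.log S0 + 1 - M) / 2) / (δ * Real.log 2)) ?_
    filter_upwards [hsum, eventually_gt_atTop 0] with K hK hK0
    simp only [Function.comp]
    have h1 := h.mutualInfo_grid_le hC δ (n := K) (T := K * δ) le_rfl
    refine le_trans ?_ (ENNReal.div_le_div_right h1 _)
    unfold mutualInfo
    refine le_trans ?_ (ENNReal.div_le_div_right (ENNReal.div_le_div_right (key K) _) _)
    have hK0' : (0 : ℝ) < K := by exact_mod_cast hK0
    rw [← ENNReal.ofReal_div_of_pos hl, ← ENNReal.ofReal_coe_nnreal (p := (K : ℝ≥0) * δ),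
      ← ENNReal.ofReal_div_of_pos (by push_cast; positivity), ← ENNReal.ofReal_natCast K,
      ← ENNReal.ofReal_div_of_pos hK0']
    apply ENNReal.ofReal_le_ofReal
    have hM' : ∫ ω, x (K * δ) ω ^ 2 ∂μ ≤ M := hM ▸ h.integral_sq_le hA _
    have hS : (Finset.range K).sum V ≤ K * (p + δ + B ^ 2 * δ) + V 0 := by
      have h5 : (Finset.range K).sum V ≤ (Finset.range (K + 1)).sum V := by
        rw [Finset.sum_range_succ]; linarith [hV0 K]
      rw [Finset.sum_range_succ'] at h5
      linarith
    have hS' := mul_le_mul_of_nonneg_left hS hg0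
    push_cast
    rw [mul_div_assoc', ← add_div, div_div, div_div,
      show (Real.log 2 : ℝ) * (K * δ) = δ * Real.log 2 * K by ring]
    apply div_le_div_of_nonneg_right _ (by positivity)
    generalize (Finset.range K).sum V = s1 at hS' ⊢
    generalize V 0 = V1 at hS' ⊢
    nlinarith
  have hlim : limsup ((fun T : ℝ≥0 => mutualInfo μ (fun ω (s : Set.Iic T) => x s ω)
        (fun ω (s : Set.Iic T) => estimate μ C x v s ω) / (T : ℝ≥0∞))
          ∘ fun K : ℕ => (K : ℝ≥0) * δ) atTop ≤ ctInfoRate μ C x v := by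
    rw [ctInfoRate, limsup_comp]
    exact limsup_le_limsup_of_le htend
  refine le_trans (ENNReal.ofReal_le_ofReal ?_) (hbound.trans hlim)
  have hc' : c = Real.log (1 + (2 * A + B ^ 2 / p) * Qd A δ) / 2 := by
    rw [hc, hqv]
    congr 2
    have h1 := Ad_sq hA δ
    rw [Ad, ← ha] at h1
    rw [h1]
    field_simp
    ring
  have hg' : g ≤ B ^ 2 * Qd A δ / (2 * p * p * Ad A δ ^ 2) := by
    rw [hg, hqv]
    rw [hqv] at hq0
    apply div_le_div_of_nonneg_left (by positivity) (by unfold Ad; positivity)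
    rw [Ad, ← ha]
    nlinarith
  rw [← div_div _ (δ : ℝ) (Real.log 2)]
  apply div_le_div_of_nonneg_right _ hl.le
  rw [sub_div, hc', ← one_add_mul, ← mul_assoc, mul_div_cancel_right₀ _ hδ0.ne']
  have := mul_le_mul_of_nonneg_right hg' (by positivity : 0 ≤ 1 + B ^ 2)
  linarith

/-- As δ → 0 the logarithm divided by δ tends to 2 A + B² / p, while the correction is of the order
of `Qd` and vanishes. -/
theorem IsModel.le_ctInfoRate (h : IsModel μ A B S0 x w v) (hA : A < 0)
    (hS0 : S0 ≠ 0) (hC : Measurable C) {p : ℝ} (hp : 0 < p)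
    (hD : ctDistortion μ C x v ≤ ENNReal.ofReal p) :
    ENNReal.ofReal (limitRate A B p) ≤ ctInfoRate μ C x v := by
  rcases le_or_gt (2 * A + B ^ 2 / p) 0 with hle | hpos
  · rw [limitRate_eq_zero hle]
    simp
  have hB : B ≠ 0 := by
    rintro rfl
    simp at hpos
    linarith
  have tQ := tendsto_Qd_div hA
  have tQ0 : Tendsto (fun δ => Qd A δ) (𝓝[>] 0) (𝓝 0) := by
    have := tQ.mul tendsto_id_pos
    rw [mul_zero] at this
    refine this.congr' ?_
    filter_upwards [self_mem_nhdsWithin] with δ hδ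
    exact div_mul_cancel₀ _ (ne_of_gt hδ)
  obtain ⟨r, hr⟩ : ∃ r, r = 2 * A + B ^ 2 / p := ⟨_, rfl⟩
  have hr0 : r ≠ 0 := by rw [hr]; exact hpos.ne'
  have tlog : Tendsto (fun δ => Real.log (1 + r * Qd A δ) / δ) (𝓝[>] 0) (𝓝 r) := by
    have h1 : HasDerivAt (fun y : ℝ => Real.log (1 + r * y)) r 0 := by
      have h2 : HasDerivAt (fun y : ℝ => 1 + r * y) r 0 := by
        simpa using ((hasDerivAt_id (0 : ℝ)).const_mul r).const_add 1
      simpa using h2.log (by simp)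
    have h3 := h1.tendsto_slope_zero_right
    simp only [zero_add, mul_zero, add_zero, Real.log_one, sub_zero, smul_eq_mul] at h3
    have hQw : Tendsto (fun δ => Qd A δ) (𝓝[>] 0) (𝓝[>] 0) := by
      refine tendsto_nhdsWithin_iff.2 ⟨tQ0, ?_⟩
      filter_upwards [self_mem_nhdsWithin] with δ hδ
      exact Qd_pos hA hδ
    have h4 := (h3.comp hQw).mul tQ
    rw [mul_one] at h4
    refine h4.congr' ?_
    filter_upwards [self_mem_nhdsWithin] with δ hδ
    have := Qd_pos hA hδ
    simp only [Function.comp]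
    field_simp
  have tAd : Tendsto (fun δ => Ad A δ ^ 2) (𝓝[>] 0) (𝓝 1) := by
    have : Continuous fun δ => Ad A δ ^ 2 := by unfold Ad; fun_prop
    have h2 := this.tendsto 0
    simp only [Ad, mul_zero, Real.exp_zero, one_pow] at h2
    exact h2.mono_left nhdsWithin_le_nhds
  have t1 : Tendsto (fun δ => B ^ 2 * Qd A δ / (2 * p * p * Ad A δ ^ 2) * (1 + B ^ 2))
      (𝓝[>] 0) (𝓝 0) := by
    have := ((tQ0.const_mul (B ^ 2)).div (tAd.const_mul (2 * p * p))
      (by positivity)).mul_const (1 + B ^ 2)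
    simpa using this
  have t2 : Tendsto (fun δ => ENNReal.ofReal ((Real.log (1 + (2 * A + B ^ 2 / p) * Qd A δ) / 2 / δ
        - B ^ 2 * Qd A δ / (2 * p * p * Ad A δ ^ 2) * (1 + B ^ 2)) / Real.log 2)) (𝓝[>] 0)
      (𝓝 (ENNReal.ofReal (limitRate A B p))) := by
    rw [limitRate_eq_of_pos hpos.le]
    refine (ENNReal.continuous_ofReal.tendsto _).comp (Tendsto.div_const ?_ _)
    rw [← hr]
    have h5 := (tlog.div_const 2).sub t1
    rw [sub_zero] at h5
    refine h5.congr fun δ => ?_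
    rw [div_right_comm]
  refine le_of_tendsto t2 ?_
  filter_upwards [self_mem_nhdsWithin] with δ hδ
  have hδ0 : (0 : ℝ) < δ := hδ
  have := h.le_ctInfoRate_of_period hA hB hS0 hC hp hD (δ := ⟨δ, hδ0.le⟩) hδ0
  exact this

end LowerBound

end GaussMarkov

namespace GaussMarkov

/-! ### A recursive filter for sampled observations -/

section GridFilter

/-- The linear recursive filter driven by the increments `u`. -/
noncomputable def linFilter (α L : ℝ) (u : ℕ → ℝ) : ℕ → ℝ
  | 0 => 0
  | k + 1 => α * linFilter α L u k + L * u k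

lemma linFilter_congr {α L : ℝ} {u u' : ℕ → ℝ} {k : ℕ} (h : ∀ i < k, u i = u' i) :
    linFilter α L u k = linFilter α L u' k := by
  induction k with
  | zero => rfl
  | succ k ih =>
    rw [linFilter, linFilter, ih fun i hi => h i (hi.trans k.lt_succ_self), h k k.lt_succ_self]

lemma measurable_linFilter {Ω : Type*} {m : MeasurableSpace Ω} {α L : ℝ} {u : ℕ → Ω → ℝ} {k : ℕ}
    (h : ∀ i < k, Measurable[m] (u i)) :
    Measurable[m] fun ω => linFilter α L (fun i => u i ω) k := by
  induction k with
  | zero => exact measurable_const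
  | succ k ih =>
    exact ((ih fun i hi => h i (hi.trans k.lt_succ_self)).const_mul α).add
      ((h k k.lt_succ_self).const_mul L)

variable {Ω : Type*}

/-- The increments of the noise on a grid of step `δ`; the first one is counted from zero. -/
noncomputable def gridNoise (v : ℝ≥0 → Ω → ℝ) (δ : ℝ≥0) (k : ℕ) (ω : Ω) : ℝ :=
  v ((k + 1 : ℕ) * δ) ω - if k = 0 then 0 else v (k * δ) ω

/-- The increments of the observation on a grid of step `δ`; the first one is counted from zero. -/
noncomputable def gridObs (c : ℝ) (x v : ℝ≥0 → Ω → ℝ) (δ : ℝ≥0) (k : ℕ) (ω : Ω) : ℝ :=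
  obs (fun _ => c) x v ((k + 1 : ℕ) * δ) ω - if k = 0 then 0 else obs (fun _ => c) x v (k * δ) ω

/-- The integral of the source over a cell of the grid. -/
noncomputable def cellIntegral (c : ℝ) (x : ℝ≥0 → Ω → ℝ) (δ : ℝ≥0) (k : ℕ) (ω : Ω) : ℝ :=
  ∫ s in ((k * δ : ℝ≥0) : ℝ)..(((k + 1 : ℕ) * δ : ℝ≥0) : ℝ), c * x s.toNNReal ω

variable {x v : ℝ≥0 → Ω → ℝ}

/-- This exhibits the observation increments as outputs of an additive Gaussian channel; the same
convention at k = 0 on both sides makes the identity hold for every ω. -/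
lemma gridObs_eq (hx : ∀ ω, Continuous fun t => x t ω) (c : ℝ) (δ : ℝ≥0) (k : ℕ) (ω : Ω) :
    gridObs c x v δ k ω = cellIntegral c x δ k ω + gridNoise v δ k ω := by
  have hc : Continuous fun s : ℝ => c * x s.toNNReal ω :=
    continuous_const.mul ((hx ω).comp continuous_real_toNNReal)
  rcases Nat.eq_zero_or_pos k with rfl | hk
  · simp [gridObs, cellIntegral, gridNoise, obs]
  · have h1 := intervalIntegral.integral_add_adjacent_intervals (μ := volume)
      (hc.intervalIntegrable 0 ((k * δ : ℝ≥0) : ℝ))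
      (hc.intervalIntegrable ((k * δ : ℝ≥0) : ℝ) (((k + 1 : ℕ) * δ : ℝ≥0) : ℝ))
    simp only [gridObs, cellIntegral, gridNoise, obs, if_neg hk.ne', ← h1]
    ring

lemma measurable_obs_obsAlgebra (C : ℝ → ℝ) {r t : ℝ≥0} (hr : r ≤ t) :
    Measurable[obsAlgebra C x v t] (obs C x v r) := by
  refine Measurable.mono (comap_measurable _) ?_ le_rfl
  exact le_iSup_of_le (⟨r, hr⟩ : Set.Iic t) le_rfl

lemma measurable_gridObs (c : ℝ) {δ t : ℝ≥0} {k : ℕ} (ht : (k + 1 : ℕ) * δ ≤ t) :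
    Measurable[obsAlgebra (fun _ => c) x v t] (gridObs c x v δ k) := by
  refine (measurable_obs_obsAlgebra _ ht).sub ?_
  split_ifs
  · exact measurable_const
  · exact measurable_obs_obsAlgebra _ (le_trans (by gcongr; exact_mod_cast k.le_succ) ht)

/-- The recursive estimate of the source on the grid. -/
noncomputable def gridFilter (A c L : ℝ) (x v : ℝ≥0 → Ω → ℝ) (δ : ℝ≥0) (k : ℕ) (ω : Ω) : ℝ :=
  linFilter (Real.exp (A * δ) - L * c * δ) L (fun i => gridObs c x v δ i ω) k

lemma measurable_gridFilter (A c L : ℝ) (δ : ℝ≥0) (k : ℕ) :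
    Measurable[obsAlgebra (fun _ => c) x v (k * δ)] (gridFilter A c L x v δ k) :=
  measurable_linFilter fun i hi => measurable_gridObs c (by gcongr; exact_mod_cast hi)

/-- The fluctuation of the source over a cell of the grid. -/
noncomputable def cellDev (x : ℝ≥0 → Ω → ℝ) (δ : ℝ≥0) (k : ℕ) (ω : Ω) : ℝ :=
  ∫ s in ((k * δ : ℝ≥0) : ℝ)..(((k + 1 : ℕ) * δ : ℝ≥0) : ℝ), (x s.toNNReal ω - x (k * δ) ω)

lemma cellIntegral_eq (hx : ∀ ω, Continuous fun t => x t ω) (c : ℝ) (δ : ℝ≥0) (k : ℕ) (ω : Ω) :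
    cellIntegral c x δ k ω = c * (δ * x (k * δ) ω + cellDev x δ k ω) := by
  have hc : Continuous fun s : ℝ => x s.toNNReal ω := (hx ω).comp continuous_real_toNNReal
  rw [cellIntegral, cellDev, intervalIntegral.integral_const_mul,
    intervalIntegral.integral_sub (hc.intervalIntegrable _ _) (continuous_const.intervalIntegrable _ _),
    intervalIntegral.integral_const]
  have : (((k + 1 : ℕ) * δ : ℝ≥0) : ℝ) - ((k * δ : ℝ≥0) : ℝ) = δ := by push_cast; ring
  rw [this, smul_eq_mul, add_sub_cancel]

lemma measurable_noisePast_gridFilter (hx : ∀ ω, Continuous fun t => x t ω)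
    (A c L : ℝ) (δ : ℝ≥0) (k : ℕ) :
    Measurable[MeasurableSpace.comap (noisePast x v (k * δ)) inferInstance]
      (gridFilter A c L x v δ k) :=
  (measurable_gridFilter A c L δ k).mono (obsAlgebra_le_of_measurable measurable_const hx
    (fun r _ => measurable_noisePast_source x v _ r)
    fun _ hr => measurable_noisePast_noise x v hr) le_rfl

lemma measurable_sourcePast_gridFilter (hx : ∀ ω, Continuous fun t => x t ω)
    (A c L : ℝ) (δ : ℝ≥0) (k : ℕ) :
    Measurable[MeasurableSpace.comap (sourcePast x v (k * δ)) inferInstance]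
      (gridFilter A c L x v δ k) :=
  (measurable_gridFilter A c L δ k).mono (obsAlgebra_le_of_measurable measurable_const hx
    (fun _ hr => measurable_sourcePast_source x v hr)
    fun r _ => measurable_sourcePast_noise x v _ r) le_rfl

end GridFilter

/-! ### Mean square estimates on the grid -/

section GridEstimates

/-- Cauchy-Schwarz, obtained from nonnegativity of the variance of f about its mean I / (b - a). -/
lemma sq_intervalIntegral_le {f : ℝ → ℝ} (hf : Continuous f) {a b : ℝ} (hab : a ≤ b) :
    (∫ s in a..b, f s) ^ 2 ≤ (b - a) * ∫ s in a..b, f s ^ 2 := by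
  rcases hab.eq_or_lt with rfl | hlt
  · simp
  obtain ⟨I, hI⟩ : ∃ I, I = ∫ s in a..b, f s := ⟨_, rfl⟩
  have h1 : 0 ≤ ∫ s in a..b, (f s - I / (b - a)) ^ 2 :=
    intervalIntegral.integral_nonneg hab fun _ _ => sq_nonneg _
  have h2 : ∫ s in a..b, (f s - I / (b - a)) ^ 2
      = (∫ s in a..b, f s ^ 2) - 2 * (I / (b - a)) * I + (b - a) * (I / (b - a)) ^ 2 := by
    have e : ∀ s, (f s - I / (b - a)) ^ 2
        = f s ^ 2 - 2 * (I / (b - a)) * f s + (I / (b - a)) ^ 2 := fun s => by ring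
    simp_rw [e]
    rw [intervalIntegral.integral_add (Continuous.intervalIntegrable (by fun_prop) _ _)
      (Continuous.intervalIntegrable (by fun_prop) _ _),
      intervalIntegral.integral_sub (Continuous.intervalIntegrable (by fun_prop) _ _)
      (Continuous.intervalIntegrable (by fun_prop) _ _), intervalIntegral.integral_const_mul, ← hI,
      intervalIntegral.integral_const, smul_eq_mul]
  rw [h2] at h1
  rw [← hI]
  have hba : 0 < b - a := by linarith
  have h3 : (b - a) * ((∫ s in a..b, f s ^ 2) - 2 * (I / (b - a)) * I + (b - a) * (I / (b - a)) ^ 2)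
      = (b - a) * (∫ s in a..b, f s ^ 2) - I ^ 2 := by
    field_simp
    ring
  have := mul_nonneg hba.le h1
  linarith

lemma add_sq_le_weighted {η : ℝ} (hη : 0 < η) (a b : ℝ) :
    (a + b) ^ 2 ≤ (1 + η) * a ^ 2 + (1 + 1 / η) * b ^ 2 := by
  have h : (1 + η) * a ^ 2 + (1 + 1 / η) * b ^ 2 - (a + b) ^ 2 = (η * a - b) ^ 2 / η := by
    field_simp
    ring
  have : 0 ≤ (η * a - b) ^ 2 / η := by positivity
  linarith

lemma integral_add_sq_le {Ω : Type*} [MeasurableSpace Ω] {μ : Measure Ω} {X Y : Ω → ℝ}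
    (hX : MemLp X 2 μ) (hY : MemLp Y 2 μ) {η : ℝ} (hη : 0 < η) :
    ∫ ω, (X ω + Y ω) ^ 2 ∂μ
      ≤ (1 + η) * ∫ ω, X ω ^ 2 ∂μ + (1 + 1 / η) * ∫ ω, Y ω ^ 2 ∂μ := by
  rw [← integral_const_mul, ← integral_const_mul,
    ← integral_add (hX.integrable_sq.const_mul _) (hY.integrable_sq.const_mul _)]
  exact integral_mono (hX.add hY).integrable_sq
    ((hX.integrable_sq.const_mul _).add (hY.integrable_sq.const_mul _))
    fun ω => add_sq_le_weighted hη _ _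

variable {Ω : Type*} [MeasurableSpace Ω] {μ : Measure Ω} {A B : ℝ} {S0 : ℝ≥0}
  {x w v : ℝ≥0 → Ω → ℝ}

/-- A bound on the mean square modulus of continuity of the source. -/
noncomputable def modulusConst (A B : ℝ) (S0 : ℝ≥0) : ℝ := A ^ 2 * (S0 + B ^ 2 / (-(2 * A))) + B ^ 2

lemma modulusConst_nonneg (hA : A < 0) : 0 ≤ modulusConst A B S0 := by
  have : 0 < -(2 * A) := by linarith
  unfold modulusConst
  positivity

/-- The drift contributes order s² and the noise order s. The restriction to s ≤ 1 lets both be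
bounded linearly. -/
lemma IsModel.integral_sq_modulus_le [IsProbabilityMeasure μ] (h : IsModel μ A B S0 x w v) (hA : A < 0) (t : ℝ≥0) {s : ℝ≥0}
    (hs : s ≤ 1) :
    ∫ ω, (x (t + s) ω - x t ω) ^ 2 ∂μ ≤ modulusConst A B S0 * s := by
  have h1 := h.integral_sq_step hA t s ((h.memLp hA t).const_mul (Real.exp (A * s) - 1))
    ((measurable_sourcePast_source x v le_rfl).const_mul _)
  have e : ∀ ω, (Real.exp (A * s) - 1) * x t ω + (x (t + s) ω - Real.exp (A * s) * x t ω)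
      = x (t + s) ω - x t ω := fun ω => by ring
  simp_rw [e, mul_pow] at h1
  rw [integral_const_mul] at h1
  rw [h1]
  have hs1 : (s : ℝ) ≤ 1 := by exact_mod_cast hs
  have h2 : (Real.exp (A * s) - 1) ^ 2 ≤ A ^ 2 * s := by
    have h3 : A * s ≤ Real.exp (A * s) - 1 := by linarith [Real.add_one_le_exp (A * s)]
    have h4 : Real.exp (A * s) ≤ 1 := Real.exp_le_one_iff.2 (by nlinarith [s.coe_nonneg])
    have h5 : (Real.exp (A * s) - 1) ^ 2 ≤ (A * s) ^ 2 := by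
      rw [← neg_sq, ← neg_sq (A * s)]
      exact pow_le_pow_left₀ (by linarith) (by linarith) 2
    have h6 : (s : ℝ) ^ 2 ≤ s := by nlinarith [s.coe_nonneg]
    have := mul_le_mul_of_nonneg_left h6 (sq_nonneg A)
    nlinarith
  have h3 := h.integral_sq_le hA t
  have h4 : 0 ≤ ∫ ω, x t ω ^ 2 ∂μ := integral_nonneg fun ω => sq_nonneg _
  have h5 := mul_le_mul h2 h3 h4 (by positivity)
  have h6 := mul_le_mul_of_nonneg_left (Qd_le hA s.coe_nonneg) (sq_nonneg B)
  unfold modulusConst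
  linarith

lemma IsModel.measurable_cellDev (h : IsModel μ A B S0 x w v) (δ : ℝ≥0) (k : ℕ) :
    Measurable (cellDev x δ k) := by
  have h1 := measurable_integral_of_continuous (C := fun _ => (1 : ℝ)) measurable_const
    (x := fun t ω => x t ω - x (k * δ) ω) (fun ω => (h.continuous_x ω).sub continuous_const)
    (a := k * δ) (b := (k + 1 : ℕ) * δ) (by gcongr; exact_mod_cast k.le_succ)
    fun r _ => (h.measurable_x r).sub (h.measurable_x _)
  simp only [one_mul] at h1
  exact h1

/-- One factor δ comes from Cauchy-Schwarz, one from the length of the cell and one from the mean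
square modulus of continuity. -/
lemma IsModel.lintegral_cellDev_le [IsProbabilityMeasure μ] (h : IsModel μ A B S0 x w v) (hA : A < 0) {δ : ℝ≥0} (hδ : δ ≤ 1)
    (k : ℕ) :
    ∫⁻ ω, ENNReal.ofReal (cellDev x δ k ω ^ 2) ∂μ ≤ ENNReal.ofReal (modulusConst A B S0 * δ ^ 3) := by
  obtain ⟨a, ha⟩ : ∃ a : ℝ≥0, a = k * δ := ⟨_, rfl⟩
  have hb : ((k + 1 : ℕ) : ℝ≥0) * δ = a + δ := by rw [ha]; push_cast; ring
  have hκ : 0 ≤ modulusConst A B S0 := modulusConst_nonneg hA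
  have hab : (a : ℝ) ≤ ((a + δ : ℝ≥0) : ℝ) := by push_cast; linarith [δ.coe_nonneg]
  have hm : Measurable (Function.uncurry fun (s : ℝ) ω => x s.toNNReal ω - x a ω) := by
    refine measurable_uncurry_of_continuous_of_measurable (fun ω => ?_) fun s =>
      (h.measurable_x _).sub (h.measurable_x _)
    exact ((h.continuous_x ω).comp continuous_real_toNNReal).sub continuous_const
  have hm' : Measurable (Function.uncurry fun ω (s : ℝ) =>
      ENNReal.ofReal ((x s.toNNReal ω - x a ω) ^ 2)) :=
    ((hm.pow_const 2).comp measurable_swap).ennreal_ofReal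
  calc ∫⁻ ω, ENNReal.ofReal (cellDev x δ k ω ^ 2) ∂μ
      ≤ ∫⁻ ω, ENNReal.ofReal δ * (∫⁻ s in Set.Ioc (a : ℝ) ((a + δ : ℝ≥0) : ℝ),
          ENNReal.ofReal ((x s.toNNReal ω - x a ω) ^ 2)) ∂μ := by
        refine lintegral_mono fun ω => ?_
        have hc : Continuous fun s : ℝ => x s.toNNReal ω - x a ω :=
          ((h.continuous_x ω).comp continuous_real_toNNReal).sub continuous_const
        have h1 := sq_intervalIntegral_le hc hab
        have h2 : ((a + δ : ℝ≥0) : ℝ) - a = δ := by push_cast; ring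
        rw [h2] at h1
        rw [← ofReal_integral_eq_lintegral_ofReal ?_ (ae_of_all _ fun _ => sq_nonneg _),
          ← intervalIntegral.integral_of_le hab, ← ENNReal.ofReal_mul δ.coe_nonneg]
        · apply ENNReal.ofReal_le_ofReal
          simp only [cellDev, hb, ← ha]
          exact h1
        · exact (hc.pow 2).integrableOn_Ioc
    _ = ENNReal.ofReal δ * ∫⁻ s in Set.Ioc (a : ℝ) ((a + δ : ℝ≥0) : ℝ),
          ∫⁻ ω, ENNReal.ofReal ((x s.toNNReal ω - x a ω) ^ 2) ∂μ := by
        have hm2 : Measurable fun ω => ∫⁻ s in Set.Ioc (a : ℝ) ((a + δ : ℝ≥0) : ℝ),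
            ENNReal.ofReal ((x s.toNNReal ω - x a ω) ^ 2) := hm'.lintegral_prod_right'
        rw [lintegral_const_mul _ hm2, lintegral_lintegral_swap hm'.aemeasurable]
    _ ≤ ENNReal.ofReal δ * ∫⁻ _ in Set.Ioc (a : ℝ) ((a + δ : ℝ≥0) : ℝ),
          ENNReal.ofReal (modulusConst A B S0 * δ) := by
        refine mul_le_mul_right (setLIntegral_mono' measurableSet_Ioc fun s hs => ?_) _
        have h5 : MemLp (fun ω => x s.toNNReal ω - x a ω) 2 μ := (h.memLp hA _).sub (h.memLp hA _)
        rw [← ofReal_integral_eq_lintegral_ofReal h5.integrable_sq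
          (ae_of_all _ fun _ => sq_nonneg _)]
        apply ENNReal.ofReal_le_ofReal
        have hs0 : 0 ≤ s := a.coe_nonneg.trans hs.1.le
        have hle : a ≤ s.toNNReal := NNReal.le_toNNReal_of_coe_le hs.1.le
        have h3 : s.toNNReal - a ≤ δ :=
          tsub_le_iff_left.2 (Real.toNNReal_le_iff_le_coe.2 hs.2)
        have h4 := h.integral_sq_modulus_le hA a (h3.trans hδ)
        rw [add_tsub_cancel_of_le hle] at h4
        exact h4.trans (mul_le_mul_of_nonneg_left (by exact_mod_cast h3) hκ)
    _ = ENNReal.ofReal (modulusConst A B S0 * δ ^ 3) := by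
        rw [lintegral_const, Measure.restrict_apply_univ, Real.volume_Ioc,
          ← ENNReal.ofReal_mul (by positivity), ← ENNReal.ofReal_mul (by positivity)]
        congr 1
        push_cast
        ring

lemma IsModel.memLp_cellDev [IsProbabilityMeasure μ] (h : IsModel μ A B S0 x w v) (hA : A < 0) {δ : ℝ≥0} (hδ : δ ≤ 1)
    (k : ℕ) : MemLp (cellDev x δ k) 2 μ := by
  have hm := h.measurable_cellDev δ k
  rw [memLp_two_iff_integrable_sq hm.aestronglyMeasurable]
  refine ⟨(hm.pow_const 2).aestronglyMeasurable, ?_⟩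
  rw [hasFiniteIntegral_iff_ofReal (ae_of_all _ fun ω => sq_nonneg _)]
  exact (h.lintegral_cellDev_le hA hδ k).trans_lt ENNReal.ofReal_lt_top

lemma IsModel.integral_cellDev_le [IsProbabilityMeasure μ] (h : IsModel μ A B S0 x w v) (hA : A < 0) {δ : ℝ≥0} (hδ : δ ≤ 1)
    (k : ℕ) : ∫ ω, cellDev x δ k ω ^ 2 ∂μ ≤ modulusConst A B S0 * δ ^ 3 := by
  have h1 := h.lintegral_cellDev_le hA hδ k
  rw [← ofReal_integral_eq_lintegral_ofReal (h.memLp_cellDev hA hδ k).integrable_sq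
    (ae_of_all _ fun _ => sq_nonneg _)] at h1
  exact (ENNReal.ofReal_le_ofReal_iff
    (mul_nonneg (modulusConst_nonneg hA) (by positivity))).1 h1

/-- The noise starts at zero only almost surely, so counting the first increment from zero changes
it on a null set. -/
lemma IsModel.gridNoise_ae_eq (h : IsModel μ A B S0 x w v) (δ : ℝ≥0) (k : ℕ) :
    (fun ω => v (k * δ + δ) ω - v (k * δ) ω) =ᵐ[μ] gridNoise v δ k := by
  have e : ((k + 1 : ℕ) : ℝ≥0) * δ = k * δ + δ := by push_cast; ring
  filter_upwards [h.brownian_v.eval_zero_ae_eq_zero] with ω hω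
  rw [gridNoise, e]
  split_ifs with hk
  · simp [hk, hω]
  · rfl

lemma IsModel.measurable_gridNoise (h : IsModel μ A B S0 x w v) (δ : ℝ≥0) (k : ℕ) :
    Measurable (gridNoise v δ k) := by
  refine (h.measurable_v _).sub ?_
  split_ifs
  · exact measurable_const
  · exact h.measurable_v _

lemma IsModel.map_gridNoise (h : IsModel μ A B S0 x w v) (δ : ℝ≥0) (k : ℕ) :
    μ.map (gridNoise v δ k) = gaussianReal 0 δ := by
  rw [← Measure.map_congr (h.gridNoise_ae_eq δ k), h.map_noise]

lemma IsModel.indepFun_gridNoise [IsProbabilityMeasure μ] (h : IsModel μ A B S0 x w v) (hA : A < 0) (δ : ℝ≥0) (k : ℕ) :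
    IndepFun (noisePast x v (k * δ)) (gridNoise v δ k) μ :=
  (h.indepFun_noise hA (k * δ) δ).congr Filter.EventuallyEq.rfl (h.gridNoise_ae_eq δ k)

lemma IsModel.memLp_gridNoise [IsProbabilityMeasure μ] (h : IsModel μ A B S0 x w v) (δ : ℝ≥0) (k : ℕ) :
    MemLp (gridNoise v δ k) 2 μ :=
  memLp_of_map_gaussian (h.measurable_gridNoise δ k) (h.map_gridNoise δ k)

lemma IsModel.memLp_gridFilter [IsProbabilityMeasure μ] (h : IsModel μ A B S0 x w v) (hA : A < 0) (c L : ℝ) {δ : ℝ≥0}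
    (hδ : δ ≤ 1) (k : ℕ) : MemLp (gridFilter A c L x v δ k) 2 μ := by
  induction k with
  | zero => exact memLp_const (0 : ℝ)
  | succ k ih =>
    have hY : MemLp (gridObs c x v δ k) 2 μ := by
      have h1 := ((((h.memLp hA (k * δ)).const_mul (δ : ℝ)).add (h.memLp_cellDev hA hδ k)).const_mul
        c).add (h.memLp_gridNoise δ k)
      refine h1.ae_eq (ae_of_all _ fun ω => ?_)
      rw [gridObs_eq h.continuous_x, cellIntegral_eq h.continuous_x]
      rfl
    exact (ih.const_mul (Real.exp (A * δ) - L * c * δ)).add (hY.const_mul L)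

lemma IsModel.memLp_gridError [IsProbabilityMeasure μ] (h : IsModel μ A B S0 x w v) (hA : A < 0) (c L : ℝ) {δ : ℝ≥0}
    (hδ : δ ≤ 1) (k : ℕ) : MemLp (fun ω => x (k * δ) ω - gridFilter A c L x v δ k ω) 2 μ :=
  (h.memLp hA _).sub (h.memLp_gridFilter hA c L hδ k)

/-- The mean square error of the recursive estimate on the grid. -/
noncomputable def gridError (μ : Measure Ω) (A c L : ℝ) (x v : ℝ≥0 → Ω → ℝ) (δ : ℝ≥0) (k : ℕ) : ℝ :=
  ∫ ω, (x (k * δ) ω - gridFilter A c L x v δ k ω) ^ 2 ∂μ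

lemma gridError_nonneg (c L : ℝ) (δ : ℝ≥0) (k : ℕ) : 0 ≤ gridError μ A c L x v δ k :=
  integral_nonneg fun _ => sq_nonneg _

lemma IsModel.gridError_zero (h : IsModel μ A B S0 x w v) (c L : ℝ) (δ : ℝ≥0) :
    gridError μ A c L x v δ 0 = S0 := by
  simp only [gridError, gridFilter, linFilter, sub_zero, Nat.cast_zero, zero_mul]
  exact integral_sq_of_map_gaussian (h.measurable_x 0) h.init

/-- The new error combines the old error, the observation noise, the source increment and the
fluctuation inside the cell. The first three are orthogonal; the fluctuation is correlated with the
source increment and is split off by a weighted Young inequality, with η left free to be tuned to δ.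
-/
lemma IsModel.gridError_succ_le [IsProbabilityMeasure μ] (h : IsModel μ A B S0 x w v) (hA : A < 0) (c L : ℝ) {δ : ℝ≥0}
    (hδ : δ ≤ 1) {η : ℝ} (hη : 0 < η) (k : ℕ) :
    gridError μ A c L x v δ (k + 1)
      ≤ (1 + η) * ((Real.exp (A * δ) - L * c * δ) ^ 2 * gridError μ A c L x v δ k
          + L ^ 2 * δ + B ^ 2 * Qd A δ)
        + (1 + 1 / η) * ((L * c) ^ 2 * (modulusConst A B S0 * δ ^ 3)) := by
  obtain ⟨α, hα⟩ : ∃ α, α = Real.exp (A * δ) - L * c * δ := ⟨_, rfl⟩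
  have hk : ((k + 1 : ℕ) : ℝ≥0) * δ = k * δ + δ := by push_cast; ring
  have he := h.memLp_gridError hA c L hδ k
  have hn := h.memLp_gridNoise δ k
  have hY : MemLp (fun ω => α * (x (k * δ) ω - gridFilter A c L x v δ k ω)
      + (-L) * gridNoise v δ k ω) 2 μ := (he.const_mul α).add (hn.const_mul (-L))
  have hind : IndepFun (fun ω => x (k * δ) ω - gridFilter A c L x v δ k ω) (gridNoise v δ k) μ := by
    have h1 := h.indepFun_gridNoise hA δ k
    rw [IndepFun_iff_Indep] at h1 ⊢
    exact indep_of_indep_of_le_left h1 ((measurable_noisePast_source x v _ _).sub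
      (measurable_noisePast_gridFilter h.continuous_x A c L δ k)).comap_le
  have h2 := integral_sq_add_of_indepFun he hn
    (integral_of_map_gaussian (h.measurable_gridNoise δ k) (h.map_gridNoise δ k)) hind α (-L)
  rw [integral_sq_of_map_gaussian (h.measurable_gridNoise δ k) (h.map_gridNoise δ k)] at h2
  have hYm : Measurable[MeasurableSpace.comap (sourcePast x v (k * δ)) inferInstance]
      fun ω => α * (x (k * δ) ω - gridFilter A c L x v δ k ω) + (-L) * gridNoise v δ k ω := by
    refine (((measurable_sourcePast_source x v le_rfl).sub
      (measurable_sourcePast_gridFilter h.continuous_x A c L δ k)).const_mul α).add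
      (Measurable.const_mul ?_ _)
    refine (measurable_sourcePast_noise x v _ _).sub ?_
    split_ifs
    · exact measurable_const
    · exact measurable_sourcePast_noise x v _ _
  have h3 := h.integral_sq_step hA (k * δ) δ hY hYm
  rw [h2] at h3
  have h4 := integral_add_sq_le (hY.add (h.memLp_increment hA (k * δ) δ))
    ((h.memLp_cellDev hA hδ k).const_mul (-(L * c))) hη
  have e : ∀ ω, x ((k + 1 : ℕ) * δ) ω - gridFilter A c L x v δ (k + 1) ω
      = ((α * (x (k * δ) ω - gridFilter A c L x v δ k ω) + (-L) * gridNoise v δ k ω)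
        + (x (k * δ + δ) ω - Real.exp (A * δ) * x (k * δ) ω)) + -(L * c) * cellDev x δ k ω := by
    intro ω
    rw [hk, gridFilter, linFilter, gridObs_eq h.continuous_x, cellIntegral_eq h.continuous_x, hα]
    simp only [gridFilter]
    ring
  have h5 : gridError μ A c L x v δ (k + 1) ≤ (1 + η) * (α ^ 2 * gridError μ A c L x v δ k
      + (-L) ^ 2 * δ + B ^ 2 * Qd A δ)
      + (1 + 1 / η) * ∫ ω, (-(L * c) * cellDev x δ k ω) ^ 2 ∂μ := by
    rw [gridError]
    simp_rw [e]
    refine h4.trans (le_of_eq ?_)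
    simp only [Pi.add_apply]
    rw [h3]
    rfl
  refine h5.trans ?_
  simp_rw [mul_pow]
  rw [integral_const_mul, hα, neg_sq, neg_sq, ← mul_pow]
  have h6 := h.integral_cellDev_le hA hδ k
  gcongr

lemma IsModel.integral_innovation_le [IsProbabilityMeasure μ] (h : IsModel μ A B S0 x w v) (hA : A < 0) (c L : ℝ) {δ : ℝ≥0}
    (hδ : δ ≤ 1) {η : ℝ} (hη : 0 < η) (k : ℕ) :
    ∫ ω, (cellIntegral c x δ k ω - c * δ * gridFilter A c L x v δ k ω) ^ 2 ∂μ
      ≤ (1 + η) * ((c * δ) ^ 2 * gridError μ A c L x v δ k)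
        + (1 + 1 / η) * (c ^ 2 * (modulusConst A B S0 * δ ^ 3)) := by
  have h4 := integral_add_sq_le ((h.memLp_gridError hA c L hδ k).const_mul (c * δ))
    ((h.memLp_cellDev hA hδ k).const_mul c) hη
  have e : ∀ ω, cellIntegral c x δ k ω - c * δ * gridFilter A c L x v δ k ω
      = c * δ * (x (k * δ) ω - gridFilter A c L x v δ k ω) + c * cellDev x δ k ω := by
    intro ω
    rw [cellIntegral_eq h.continuous_x]
    ring
  simp_rw [e]
  refine h4.trans ?_
  simp_rw [mul_pow]
  rw [integral_const_mul, integral_const_mul]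
  have h6 := h.integral_cellDev_le hA hδ k
  rw [gridError]
  gcongr

lemma IsModel.memLp_innovation [IsProbabilityMeasure μ] (h : IsModel μ A B S0 x w v) (hA : A < 0) (c L : ℝ) {δ : ℝ≥0}
    (hδ : δ ≤ 1) (k : ℕ) :
    MemLp (fun ω => cellIntegral c x δ k ω - c * δ * gridFilter A c L x v δ k ω) 2 μ := by
  refine (((h.memLp_gridError hA c L hδ k).const_mul (c * δ)).add
    ((h.memLp_cellDev hA hδ k).const_mul c)).ae_eq (ae_of_all _ fun ω => ?_)
  simp only [Pi.add_apply]
  rw [cellIntegral_eq h.continuous_x]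
  ring

end GridEstimates

end GaussMarkov

namespace GaussMarkov

open InformationTheory

/-! ### Divergence along generating statistics -/

section Generating

/-- The divergence on the σ-algebra generated by a map is the divergence of the image measures. -/
lemma klDiv_trim_comap_le {α β : Type*} {mα : MeasurableSpace α} {mβ : MeasurableSpace β}
    {μ ν : Measure α} [IsProbabilityMeasure μ] [IsProbabilityMeasure ν] {f : α → β}
    (hf : Measurable f) :
    klDiv (μ.trim hf.comap_le) (ν.trim hf.comap_le) ≤ klDiv (μ.map f) (ν.map f) := by
  by_cases hac : μ.map f ≪ ν.map f
  swap
  · rw [klDiv_of_not_ac hac]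
    exact le_top
  have i1 := Measure.isProbabilityMeasure_map (μ := μ) hf.aemeasurable
  have i2 := Measure.isProbabilityMeasure_map (μ := ν) hf.aemeasurable
  -- On the pulled-back σ-algebra the density is the pullback of the density of the image measures.
  obtain ⟨ρ, hρ⟩ : ∃ ρ, ρ = (μ.map f).rnDeriv (ν.map f) := ⟨_, rfl⟩
  have hρm : Measurable ρ := hρ ▸ Measure.measurable_rnDeriv _ _
  have hρf : Measurable[MeasurableSpace.comap f mβ] (ρ ∘ f) := hρm.comp (comap_measurable f)
  have htrim : μ.trim hf.comap_le = (ν.trim hf.comap_le).withDensity (ρ ∘ f) := by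
    refine @Measure.ext _ (MeasurableSpace.comap f mβ) _ _ fun s hs => ?_
    rw [withDensity_apply _ hs, restrict_trim hf.comap_le _ hs, lintegral_trim hf.comap_le hρf,
      trim_measurableSet_eq hf.comap_le hs]
    obtain ⟨S, hS, rfl⟩ := hs
    have h1 := setLIntegral_map (μ := ν) hS hρm hf
    simp only [Function.comp_def]
    rw [← h1, hρ, Measure.setLIntegral_rnDeriv hac, Measure.map_apply hf hS]
  have hac' : μ.trim hf.comap_le ≪ ν.trim hf.comap_le := by
    rw [htrim]; exact withDensity_absolutelyContinuous _ _
  have hrn : (μ.trim hf.comap_le).rnDeriv (ν.trim hf.comap_le) =ᵐ[ν.trim hf.comap_le] ρ ∘ f := by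
    rw [htrim]
    exact Measure.rnDeriv_withDensity _ hρf
  rw [klDiv_eq_lintegral_klFun_of_ac hac, klDiv_eq_lintegral_klFun_of_ac hac', ← hρ]
  have h2 : ∫⁻ a, ENNReal.ofReal
      (klFun (((μ.trim hf.comap_le).rnDeriv (ν.trim hf.comap_le) a).toReal)) ∂(ν.trim hf.comap_le)
      = ∫⁻ a, ENNReal.ofReal (klFun ((ρ (f a)).toReal)) ∂(ν.trim hf.comap_le) :=
    lintegral_congr_ae (hrn.mono fun a ha => by simp only [ha, Function.comp])
  have hk : Measurable fun b => ENNReal.ofReal (klFun ((ρ b).toReal)) := by fun_prop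
  have h3 : ∫⁻ a, ENNReal.ofReal (klFun ((ρ (f a)).toReal)) ∂(ν.trim hf.comap_le)
      = ∫⁻ a, ENNReal.ofReal (klFun ((ρ (f a)).toReal)) ∂ν :=
    lintegral_trim hf.comap_le (hk.comp (comap_measurable f))
  rw [h2, h3, lintegral_map hk hf]

/-- Information about an observation is approximated along an increasing sequence of statistics that
generates the σ-algebra of the observation. -/
lemma klDiv_le_of_generating {Ω E F : Type*} {mΩ : MeasurableSpace Ω} {mE : MeasurableSpace E}
    {mF : MeasurableSpace F} {P : Measure Ω} [IsProbabilityMeasure P] {X : Ω → E} {Y : Ω → F}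
    (hX : Measurable X) (hY : Measurable Y) {G : ℕ → Type*} [∀ n, MeasurableSpace (G n)]
    {g : ∀ n, F → G n} (hg : ∀ n, Measurable (g n))
    (hmono : Monotone fun n => MeasurableSpace.comap (g n) inferInstance)
    (hsup : mF ≤ ⨆ n, MeasurableSpace.comap (g n) inferInstance) {b : ℕ → ℝ} {c : ℝ}
    (hb : Tendsto b atTop (𝓝 c))
    (h : ∀ᶠ n in atTop, klDiv (P.map fun ω => (X ω, g n (Y ω)))
      ((P.map X).prod (P.map fun ω => g n (Y ω))) ≤ ENNReal.ofReal (b n)) :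
    klDiv (P.map fun ω => (X ω, Y ω)) ((P.map X).prod (P.map Y)) ≤ ENNReal.ofReal c := by
  have i1 := Measure.isProbabilityMeasure_map (μ := P) hX.aemeasurable
  have i2 := Measure.isProbabilityMeasure_map (μ := P) hY.aemeasurable
  have i3 := Measure.isProbabilityMeasure_map (μ := P) (hX.prodMk hY).aemeasurable
  have hG : ∀ n, Measurable (Prod.map (id : E → E) (g n)) := fun n => measurable_id.prodMap (hg n)
  have hcomap : ∀ n, MeasurableSpace.comap (Prod.map (id : E → E) (g n)) inferInstance
      = MeasurableSpace.comap Prod.fst mE ⊔ MeasurableSpace.comap Prod.snd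
        (MeasurableSpace.comap (g n) inferInstance) := by
    intro n
    rw [MeasurableSpace.comap_comp]
    exact MeasurableSpace.comap_prodMk (Prod.fst : E × F → E) (g n ∘ Prod.snd)
  -- The filtration keeps all information about the first coordinate and refines only that about the
  -- second.
  set ℱ : Filtration ℕ (Prod.instMeasurableSpace : MeasurableSpace (E × F)) :=
    { seq := fun n => MeasurableSpace.comap (Prod.map (id : E → E) (g n)) inferInstance
      mono' := fun n m hnm => by
        simp only [hcomap]
        exact sup_le_sup le_rfl (MeasurableSpace.comap_mono (hmono hnm))
      le' := fun n => (hG n).comap_le } with hℱ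
  have hℱn : ∀ n, ℱ n = MeasurableSpace.comap (Prod.map (id : E → E) (g n)) inferInstance :=
    fun _ => rfl
  refine klDiv_le_of_forall_trim_le ℱ ?_ ENNReal.ofReal_ne_top fun n => ?_
  · refine le_antisymm (iSup_le ℱ.le) ?_
    simp only [hℱn, hcomap]
    rw [← sup_iSup, ← MeasurableSpace.comap_iSup]
    exact sup_le_sup le_rfl (MeasurableSpace.comap_mono hsup)
  -- Level n is coarser than every later level m, so its divergence is at most b m for all large m,
  -- hence at most the limit c.
  · refine ge_of_tendsto ((ENNReal.continuous_ofReal.tendsto c).comp hb) ?_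
    filter_upwards [h, eventually_ge_atTop n] with m hm hnm
    have h1 : klDiv ((P.map fun ω => (X ω, Y ω)).trim (ℱ.le m))
        (((P.map X).prod (P.map Y)).trim (ℱ.le m)) ≤ ENNReal.ofReal (b m) := by
      refine (klDiv_trim_comap_le (hG m)).trans ?_
      rw [Measure.map_map (hG m) (hX.prodMk hY), ← Measure.map_prod_map _ _ measurable_id (hg m),
        Measure.map_id, Measure.map_map (hg m) hY]
      exact hm
    refine le_trans ?_ h1
    rw [← trim_trim (hm₁₂ := ℱ.mono hnm) (hm₂ := ℱ.le m),
      ← trim_trim (μ := (P.map X).prod (P.map Y)) (hm₁₂ := ℱ.mono hnm) (hm₂ := ℱ.le m),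
      trim_eq_map (ℱ.mono hnm), trim_eq_map (ℱ.mono hnm)]
    have j1 : IsProbabilityMeasure ((P.map fun ω => (X ω, Y ω)).trim (ℱ.le m)) :=
      ⟨by rw [trim_measurableSet_eq (ℱ.le m) MeasurableSet.univ, measure_univ]⟩
    have j2 : IsProbabilityMeasure (((P.map X).prod (P.map Y)).trim (ℱ.le m)) :=
      ⟨by rw [trim_measurableSet_eq (ℱ.le m) MeasurableSet.univ, measure_univ]⟩
    exact klDiv_map_le _ _ (measurable_id'' (ℱ.mono hnm))

end Generating

/-! ### Information in the sampled observations -/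

section GridInformation

variable {Ω : Type*} [MeasurableSpace Ω] {μ : Measure Ω} {A B : ℝ} {S0 : ℝ≥0}
  {x w v : ℝ≥0 → Ω → ℝ}

/-- The innovation is c δ times the filter error, up to the cell fluctuation. Its square over twice
the noise variance δ gives c² / 2 times δ times the error: a discrete counterpart of Duncan's
formula, as an inequality because the filter is suboptimal. -/
lemma IsModel.klDiv_grid_le [IsProbabilityMeasure μ] (h : IsModel μ A B S0 x w v) (hA : A < 0)
    (c L : ℝ) {δ : ℝ≥0} (hδ0 : 0 < δ) (hδ : δ ≤ 1) {η : ℝ} (hη : 0 < η)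
    {E : Type*} {mE : MeasurableSpace E} {X : Ω → E} (hX : Measurable X) {f : ℕ → E → ℝ}
    (hf : ∀ k, Measurable (f k)) (hfX : ∀ k ω, cellIntegral c x δ k ω = f k (X ω))
    (hXp : ∀ t, Measurable[MeasurableSpace.comap (noisePast x v t) inferInstance] X) (N : ℕ) :
    klDiv (μ.map fun ω => (X ω, fun i : Fin N => gridObs c x v δ i ω))
        ((μ.map X).prod (μ.map fun ω (i : Fin N) => gridObs c x v δ i ω))
      ≤ ENNReal.ofReal (c ^ 2 / 2 * ((1 + η) * (δ * ∑ k ∈ Finset.range N, gridError μ A c L x v δ k)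
          + (1 + 1 / η) * (modulusConst A B S0 * δ * (N * δ)))) := by
  obtain ⟨α, hα⟩ : ∃ α, α = Real.exp (A * δ) - L * c * δ := ⟨_, rfl⟩
  have hm' : ∀ k ω, c * δ * linFilter α L (extendZero fun i : Fin k => gridObs c x v δ i ω) k
      = c * δ * gridFilter A c L x v δ k ω := by
    intro k ω
    rw [gridFilter, ← hα]
    congr 1
    exact linFilter_congr fun i hi => extendZero_apply hi (fun i => gridObs c x v δ i ω)
  have key := klDiv_gaussianChannel_le (P := μ) hX (Y := gridObs c x v δ) (n := gridNoise v δ)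
    (fun k => h.measurable_gridNoise δ k) (m := fun k q => f k q.1)
    (fun k => (hf k).comp measurable_fst)
    (m' := fun k u => c * δ * linFilter α L (extendZero u) k)
    (fun k => (measurable_linFilter fun i _ => measurable_extendZero k i).const_mul _) hδ0.ne'
    (fun k ω => by rw [gridObs_eq h.continuous_x, hfX])
    (fun k => h.map_gridNoise δ k) (fun k => ?_) (fun k => ?_) N
  · refine key.trans (ENNReal.ofReal_le_ofReal ?_)
    have hδ' : (0 : ℝ) < δ := by exact_mod_cast hδ0
    have h1 : ∀ k, (∫ ω, (f k (X ω) - c * δ * linFilter α L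
        (extendZero fun i : Fin k => gridObs c x v δ i ω) k) ^ 2 ∂μ) / (2 * δ)
        ≤ c ^ 2 / 2 * ((1 + η) * (δ * gridError μ A c L x v δ k)
          + (1 + 1 / η) * (modulusConst A B S0 * δ * δ)) := by
      intro k
      simp_rw [hm', ← hfX]
      rw [div_le_iff₀ (by positivity)]
      refine (h.integral_innovation_le hA c L hδ hη k).trans (le_of_eq ?_)
      ring
    refine (Finset.sum_le_sum fun k _ => h1 k).trans (le_of_eq ?_)
    rw [← Finset.mul_sum, Finset.sum_add_distrib, ← Finset.mul_sum, ← Finset.mul_sum,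
      Finset.sum_const, Finset.card_range, nsmul_eq_mul]
    ring
  · have h1 := h.indepFun_gridNoise hA δ k
    rw [IndepFun_iff_Indep] at h1 ⊢
    refine indep_of_indep_of_le_left h1 (Measurable.comap_le ((hXp _).prodMk
      (measurable_pi_of_forall fun i => ?_)))
    refine (measurable_gridObs c (t := k * δ) ?_).mono (obsAlgebra_le_of_measurable
      measurable_const h.continuous_x (fun r _ => measurable_noisePast_source x v _ r)
      fun _ hr => measurable_noisePast_noise x v hr) le_rfl
    gcongr
    exact_mod_cast i.2
  · simp_rw [hm', ← hfX]
    exact h.memLp_innovation hA c L hδ k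

end GridInformation

/-! ### Nested grids generate the observation σ-algebra -/

section GridAlgebra

variable {Ω : Type*} {x v : ℝ≥0 → Ω → ℝ}

/-- Because the first increment is counted from zero, the sum telescopes to the observation itself
for every ω, with no exceptional null set. -/
lemma sum_gridObs (c : ℝ) (δ : ℝ≥0) (k : ℕ) (ω : Ω) :
    ∑ i ∈ Finset.range (k + 1), gridObs c x v δ i ω
      = obs (fun _ => c) x v ((k + 1 : ℕ) * δ) ω := by
  induction k with
  | zero => simp [gridObs]
  | succ k ih => rw [Finset.sum_range_succ, ih, gridObs, if_neg k.succ_ne_zero]; ring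

/-- The observations on the grid of step `T / 4 ^ n`. -/
noncomputable def gridStat (c : ℝ) (x v : ℝ≥0 → Ω → ℝ) (T : ℝ≥0) (n : ℕ) (ω : Ω)
    (i : Fin (4 ^ n)) : ℝ := gridObs c x v (T / 4 ^ n) i ω

lemma measurable_gridStat (c : ℝ) (T : ℝ≥0) (n : ℕ) :
    Measurable[obsAlgebra (fun _ => c) x v T] (gridStat c x v T n) := by
  refine measurable_pi_of_forall fun i => measurable_gridObs c ?_
  have h1 : ((i + 1 : ℕ) : ℝ≥0) ≤ 4 ^ n := by exact_mod_cast i.2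
  calc ((i + 1 : ℕ) : ℝ≥0) * (T / 4 ^ n) ≤ 4 ^ n * (T / 4 ^ n) := by gcongr
    _ = T := by field_simp

lemma measurable_obs_gridStat (c : ℝ) (T : ℝ≥0) {n k : ℕ} (hk : k ≠ 0) (hkn : k ≤ 4 ^ n) :
    Measurable[MeasurableSpace.comap (gridStat c x v T n) inferInstance]
      (obs (fun _ => c) x v (k * (T / 4 ^ n))) := by
  obtain ⟨j, rfl⟩ := Nat.exists_eq_succ_of_ne_zero hk
  have e : obs (fun _ => c) x v ((j + 1 : ℕ) * (T / 4 ^ n))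
      = fun ω => ∑ i ∈ Finset.range (j + 1), gridObs c x v (T / 4 ^ n) i ω := by
    funext ω; rw [sum_gridObs]
  rw [Nat.succ_eq_add_one, e]
  refine Finset.measurable_fun_sum _ fun i hi => ?_
  have hi' : i < 4 ^ n := lt_of_lt_of_le (Finset.mem_range.1 hi) hkn
  exact (measurable_pi_apply (⟨i, hi'⟩ : Fin (4 ^ n))).comp (comap_measurable (gridStat c x v T n))

lemma monotone_comap_gridStat (c : ℝ) (T : ℝ≥0) :
    Monotone fun n => MeasurableSpace.comap (gridStat c x v T n) inferInstance := by
  refine monotone_nat_of_le_succ fun n => ?_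
  have hobs : ∀ k : ℕ, k ≠ 0 → k ≤ 4 ^ n →
      Measurable[MeasurableSpace.comap (gridStat c x v T (n + 1)) inferInstance]
        (obs (fun _ => c) x v (k * (T / 4 ^ n))) := by
    intro k hk hkn
    have h1 := measurable_obs_gridStat (x := x) (v := v) c T (n := n + 1) (k := 4 * k)
      (by omega) (by rw [pow_succ]; omega)
    have h2 : ((4 * k : ℕ) : ℝ≥0) * (T / 4 ^ (n + 1)) = k * (T / 4 ^ n) := by
      push_cast
      field_simp
      ring
    rwa [h2] at h1
  refine Measurable.comap_le (measurable_pi_of_forall fun i => ?_)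
  refine (hobs (i + 1) (by omega) (by have := i.2; omega)).sub ?_
  split_ifs with hi
  · exact measurable_const
  · exact hobs i hi i.2.le

/-- Each time s is approached from the right by grid points, and the observation path is continuous.
-/
lemma obsAlgebra_le_iSup_gridStat (hx : ∀ ω, Continuous fun t => x t ω)
    (hv : ∀ ω, Continuous fun t => v t ω) (c : ℝ) {T : ℝ≥0} (hT : 0 < T) :
    obsAlgebra (fun _ => c) x v T
      ≤ ⨆ n, MeasurableSpace.comap (gridStat c x v T n) inferInstance := by
  refine iSup_le fun s => Measurable.comap_le ?_
  obtain ⟨s, hs⟩ := s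
  have hs' : s ≤ T := hs
  have hcont : ∀ ω, Continuous fun t => obs (fun _ => c) x v t ω := by
    intro ω
    have h1 : Continuous fun r : ℝ => c * x r.toNNReal ω :=
      continuous_const.mul ((hx ω).comp continuous_real_toNNReal)
    exact ((intervalIntegral.continuous_primitive (fun a b => h1.intervalIntegrable a b) 0).comp
      NNReal.continuous_coe).add (hv ω)
  obtain ⟨δ, hδ⟩ : ∃ δ : ℕ → ℝ≥0, δ = fun n => T / 4 ^ n := ⟨_, rfl⟩
  have hδ0 : ∀ n, 0 < δ n := fun n => by rw [hδ]; positivity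
  -- Partial sums of the grid increments recover the observation only at positive grid times; the
  -- maximum with 1 also reaches s = 0, as a limit.
  obtain ⟨k, hk⟩ : ∃ k : ℕ → ℕ, k = fun n => max 1 ⌈s / δ n⌉₊ := ⟨_, rfl⟩
  have hk1 : ∀ n, s ≤ k n * δ n := by
    intro n
    have h1 : s / δ n ≤ k n := (Nat.le_ceil _).trans (by rw [hk]; exact_mod_cast le_max_right _ _)
    rwa [div_le_iff₀ (hδ0 n)] at h1
  have hk2 : ∀ n, (k n : ℝ≥0) * δ n ≤ s + δ n := by
    intro n
    have h1 : (k n : ℝ≥0) ≤ s / δ n + 1 := by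
      rw [hk]
      push_cast
      exact max_le (le_add_of_nonneg_left zero_le) (Nat.ceil_lt_add_one zero_le).le
    calc (k n : ℝ≥0) * δ n ≤ (s / δ n + 1) * δ n := by gcongr
      _ = s + δ n := by have := (hδ0 n).ne'; field_simp
  have hk3 : ∀ n, k n ≤ 4 ^ n := by
    intro n
    rw [hk]
    refine max_le (Nat.one_le_pow _ _ (by norm_num)) (Nat.ceil_le.2 ?_)
    rw [div_le_iff₀ (hδ0 n)]
    push_cast
    rw [hδ]
    simp only
    rwa [mul_div_cancel₀ _ (by positivity)]
  have hδlim : Tendsto δ atTop (𝓝 0) := by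
    have h1 : Tendsto (fun n : ℕ => T * (1 / 4 : ℝ≥0) ^ n) atTop (𝓝 (T * 0)) :=
      (NNReal.tendsto_pow_atTop_nhds_zero_of_lt_one
        (by rw [div_lt_one (by norm_num)]; norm_num)).const_mul T
    rw [mul_zero] at h1
    refine h1.congr fun n => ?_
    rw [hδ, one_div, inv_pow]
    exact (div_eq_mul_inv _ _).symm
  have hlim : Tendsto (fun n => (k n : ℝ≥0) * δ n) atTop (𝓝 s) := by
    refine tendsto_of_tendsto_of_tendsto_of_le_of_le tendsto_const_nhds ?_ hk1 hk2
    simpa using tendsto_const_nhds.add hδlim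
  refine @measurable_of_tendsto_metrizable _ _
    (⨆ n, MeasurableSpace.comap (gridStat c x v T n) inferInstance) _ _ _ _ (fun n => obs (fun _ => c) x v (k n * δ n)) _
    (fun n => ?_) (tendsto_pi_nhds.2 fun ω => ((hcont ω).tendsto s).comp hlim)
  have h2 := measurable_obs_gridStat (x := x) (v := v) c T (n := n) (k := k n)
    (by rw [hk]; simp only; omega) (hk3 n)
  rw [hδ]
  exact h2.mono (le_iSup (fun n => MeasurableSpace.comap (gridStat c x v T n) inferInstance) n) le_rfl

end GridAlgebra

end GaussMarkov

namespace GaussMarkov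

open InformationTheory

/-! ### Limits of the error recursion -/

section GridLimit

/-- The contraction factor of the error recursion with step `r ^ 2`. -/
noncomputable def errFactor (A c L r : ℝ) : ℝ :=
  (1 + r ^ 3) * (Real.exp (A * r ^ 2) - L * c * r ^ 2) ^ 2

/-- The forcing term of the error recursion with step `r ^ 2`. -/
noncomputable def errForce (A B c L κ r : ℝ) : ℝ :=
  (1 + r ^ 3) * (L ^ 2 * r ^ 2 + B ^ 2 * Qd A (r ^ 2))
    + (1 + 1 / r ^ 3) * ((L * c) ^ 2 * (κ * (r ^ 2) ^ 3))

/-- The bound on the accumulated error of the recursive estimate with step `r ^ 2`. -/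
noncomputable def accBound (A B c L κ S T r : ℝ) : ℝ :=
  (S + T * (errForce A B c L κ r / r ^ 2)) / ((1 - errFactor A c L r) / r ^ 2)

lemma tendsto_sq_pos : Tendsto (fun r : ℝ => r ^ 2) (𝓝[>] 0) (𝓝[>] 0) := by
  refine tendsto_nhdsWithin_iff.2 ⟨by simpa using tendsto_id_pos.pow 2, ?_⟩
  filter_upwards [self_mem_nhdsWithin] with r hr
  exact pow_pos (Set.mem_Ioi.1 hr) 2

/-- With step δ = r² the Young weight is η = r³. Both η and the remainder δ³ / η = r³ are o(δ), so
neither affects the first-order coefficients of the recursion. -/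
lemma tendsto_errFactor (A c L : ℝ) :
    Tendsto (fun r => (1 - errFactor A c L r) / r ^ 2) (𝓝[>] 0) (𝓝 (2 * (L * c - A))) := by
  have h1 : HasDerivAt (fun δ : ℝ => (Real.exp (A * δ) - L * c * δ) ^ 2) (2 * (A - L * c)) 0 := by
    have h2 : HasDerivAt (fun δ : ℝ => Real.exp (A * δ) - L * c * δ) (A - L * c) 0 := by
      have h3 : HasDerivAt (fun δ : ℝ => Real.exp (A * δ) - L * c * δ)
          (Real.exp (A * 0) * (A * 1) - L * c * 1) 0 :=
        ((hasDerivAt_id (0 : ℝ)).const_mul A).exp.sub ((hasDerivAt_id (0 : ℝ)).const_mul (L * c))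
      simpa using h3
    have h4 : HasDerivAt (fun δ : ℝ => (Real.exp (A * δ) - L * c * δ) ^ 2)
        ((2 : ℕ) * (Real.exp (A * 0) - L * c * 0) ^ (2 - 1) * (A - L * c)) 0 := h2.pow 2
    simpa using h4
  have h3 := h1.tendsto_slope_zero_right
  simp only [zero_add, mul_zero, Real.exp_zero, sub_zero, one_pow, smul_eq_mul] at h3
  have h4 := h3.comp tendsto_sq_pos
  have h5 : Tendsto (fun r : ℝ => r * (Real.exp (A * r ^ 2) - L * c * r ^ 2) ^ 2) (𝓝[>] 0) (𝓝 0) := by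
    have : Continuous fun r : ℝ => r * (Real.exp (A * r ^ 2) - L * c * r ^ 2) ^ 2 := by fun_prop
    have h := this.tendsto 0
    rw [zero_mul] at h
    exact h.mono_left nhdsWithin_le_nhds
  have h6 := h4.neg.sub h5
  rw [sub_zero, show -(2 * (A - L * c)) = 2 * (L * c - A) by ring] at h6
  refine h6.congr' ?_
  filter_upwards [self_mem_nhdsWithin] with r hr
  have hr0 : r ≠ 0 := ne_of_gt hr
  simp only [Function.comp, errFactor]
  field_simp
  ring

lemma tendsto_errForce {A : ℝ} (hA : A < 0) (B c L κ : ℝ) :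
    Tendsto (fun r => errForce A B c L κ r / r ^ 2) (𝓝[>] 0) (𝓝 (L ^ 2 + B ^ 2)) := by
  have h1 := (tendsto_Qd_div hA).comp tendsto_sq_pos
  have h2 := ((tendsto_id_pos.pow 3).const_add 1).mul ((h1.const_mul (B ^ 2)).const_add (L ^ 2))
  have h3 := ((tendsto_id_pos.pow 4).add tendsto_id_pos).mul_const ((L * c) ^ 2 * κ)
  have h4 := h2.add h3
  have e : (1 + (0 : ℝ) ^ 3) * (L ^ 2 + B ^ 2 * 1) + ((0 : ℝ) ^ 4 + 0) * ((L * c) ^ 2 * κ)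
      = L ^ 2 + B ^ 2 := by ring
  rw [e] at h4
  refine h4.congr' ?_
  filter_upwards [self_mem_nhdsWithin] with r hr
  have hr0 : r ≠ 0 := ne_of_gt hr
  simp only [Function.comp, errForce]
  field_simp

/-- The limit is the integrated form of p' = -2 (L c - A) p + L² + B², the error equation of the
linear filter with gain L, after discarding the final value. -/
lemma tendsto_accBound {A : ℝ} (hA : A < 0) (B c L κ S T : ℝ) (hpos : 0 < L * c - A) :
    Tendsto (accBound A B c L κ S T) (𝓝[>] 0)
      (𝓝 ((S + T * (L ^ 2 + B ^ 2)) / (2 * (L * c - A)))) :=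
  (((tendsto_errForce hA B c L κ).const_mul T).const_add S).div (tendsto_errFactor A c L)
    (by positivity)

lemma eventually_errFactor_lt (A c L : ℝ) (hpos : 0 < L * c - A) :
    ∀ᶠ r in 𝓝[>] (0 : ℝ), errFactor A c L r < 1 := by
  filter_upwards [(tendsto_errFactor A c L).eventually_const_lt (by positivity : 0 < 2 * (L * c - A)),
    self_mem_nhdsWithin] with r h hr
  have : 0 < 1 - errFactor A c L r := (div_pos_iff_of_pos_right (pow_pos (Set.mem_Ioi.1 hr) 2)).1 h
  linarith

/-- Summation of a contracting recursion. -/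
lemma sum_le_of_recursion {p : ℕ → ℝ} (hp : ∀ k, 0 ≤ p k) {G H : ℝ} (hG : G < 1)
    (h : ∀ k, p (k + 1) ≤ G * p k + H) (N : ℕ) :
    ∑ k ∈ Finset.range N, p k ≤ (p 0 + N * H) / (1 - G) := by
  have h1 : ∑ k ∈ Finset.range N, p (k + 1) ≤ G * ∑ k ∈ Finset.range N, p k + N * H := by
    refine (Finset.sum_le_sum fun k _ => h k).trans (le_of_eq ?_)
    rw [Finset.sum_add_distrib, ← Finset.mul_sum, Finset.sum_const, Finset.card_range, nsmul_eq_mul]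
  have h2 : ∑ k ∈ Finset.range N, p k ≤ ∑ k ∈ Finset.range (N + 1), p k := by
    rw [Finset.sum_range_succ]; linarith [hp N]
  rw [Finset.sum_range_succ'] at h2
  rw [le_div_iff₀ (by linarith)]
  linarith

end GridLimit

/-! ### Continuous-time upper bound with a constant gain -/

section UpperBound

/-- The σ-algebra generated by the source. -/
abbrev sourceAlgebra {Ω : Type*} (x : ℝ≥0 → Ω → ℝ) : MeasurableSpace Ω :=
  ⨆ s, MeasurableSpace.comap (x s) inferInstance

lemma measurable_sourceAlgebra {Ω : Type*} (x : ℝ≥0 → Ω → ℝ) (s : ℝ≥0) :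
    Measurable[sourceAlgebra x] (x s) :=
  (comap_measurable (x s)).mono (le_iSup_of_le s le_rfl) le_rfl

variable {Ω : Type*} [MeasurableSpace Ω] {μ : Measure Ω} {A B : ℝ} {S0 : ℝ≥0}
  {x w v : ℝ≥0 → Ω → ℝ}

lemma IsModel.sum_gridError_le [IsProbabilityMeasure μ] (h : IsModel μ A B S0 x w v) (hA : A < 0)
    (c L : ℝ) {δ : ℝ≥0} (hδ : δ ≤ 1) {r : ℝ} (hr : 0 < r) (hrδ : r ^ 2 = δ)
    (hG : errFactor A c L r < 1) (N : ℕ) :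
    δ * ∑ k ∈ Finset.range N, gridError μ A c L x v δ k
      ≤ accBound A B c L (modulusConst A B S0) S0 (N * δ) r := by
  have h1 := sum_le_of_recursion (gridError_nonneg (μ := μ) (A := A) (x := x) (v := v) c L δ) hG
    (H := errForce A B c L (modulusConst A B S0) r) (fun k => ?_) N
  · rw [h.gridError_zero] at h1
    have hr2 : 0 < r ^ 2 := by positivity
    refine (mul_le_mul_of_nonneg_left h1 δ.coe_nonneg).trans (le_of_eq ?_)
    rw [accBound, ← hrδ]
    have : 1 - errFactor A c L r ≠ 0 := by linarith
    field_simp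
  · refine (h.gridError_succ_le hA c L hδ (pow_pos hr 3) k).trans (le_of_eq ?_)
    rw [errFactor, errForce, hrδ]
    ring

/-- At the left endpoint of a cell the conditional expectation is at least as good as the grid
filter, and within the cell the error grows by at most B² δ. -/
lemma IsModel.lintegral_error_le [IsProbabilityMeasure μ] (h : IsModel μ A B S0 x w v) (hA : A < 0)
    (c L : ℝ) {δ : ℝ≥0} (hδ : δ ≤ 1) (K : ℕ) :
    (∫⁻ t in Set.Ioc (0 : ℝ) ((K * δ : ℝ≥0) : ℝ), ∫⁻ ω, ENNReal.ofReal
        ((x t.toNNReal ω - estimate μ (fun _ => c) x v t.toNNReal ω) ^ 2) ∂μ)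
      ≤ ENNReal.ofReal (δ * ∑ k ∈ Finset.range K, gridError μ A c L x v δ k
          + K * (B ^ 2 * δ * δ)) := by
  induction K with
  | zero => simp
  | succ K ih =>
    have hle : ((K * δ : ℝ≥0) : ℝ) ≤ (((K + 1 : ℕ) * δ : ℝ≥0) : ℝ) := by
      push_cast; nlinarith [δ.coe_nonneg]
    have hsplit : Set.Ioc (0 : ℝ) (((K + 1 : ℕ) * δ : ℝ≥0) : ℝ)
        = Set.Ioc (0 : ℝ) ((K * δ : ℝ≥0) : ℝ)
          ∪ Set.Ioc ((K * δ : ℝ≥0) : ℝ) (((K + 1 : ℕ) * δ : ℝ≥0) : ℝ) :=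
      (Set.Ioc_union_Ioc_eq_Ioc (NNReal.coe_nonneg _) hle).symm
    rw [hsplit, lintegral_union measurableSet_Ioc
      (Set.disjoint_left.2 fun r h1 h2 => absurd h1.2 (not_le.2 h2.1))]
    have hcell : (∫⁻ t in Set.Ioc ((K * δ : ℝ≥0) : ℝ) (((K + 1 : ℕ) * δ : ℝ≥0) : ℝ),
        ∫⁻ ω, ENNReal.ofReal
          ((x t.toNNReal ω - estimate μ (fun _ => c) x v t.toNNReal ω) ^ 2) ∂μ)
        ≤ ENNReal.ofReal (δ * gridError μ A c L x v δ K + B ^ 2 * δ * δ) := by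
      have hvol : volume (Set.Ioc ((K * δ : ℝ≥0) : ℝ) (((K + 1 : ℕ) * δ : ℝ≥0) : ℝ))
          = ENNReal.ofReal δ := by
        rw [Real.volume_Ioc]; congr 1; push_cast; ring
      have hg0 : 0 ≤ gridError μ A c L x v δ K := gridError_nonneg c L δ K
      have hconst : ENNReal.ofReal (δ * gridError μ A c L x v δ K + B ^ 2 * δ * δ)
          = ∫⁻ _ in Set.Ioc ((K * δ : ℝ≥0) : ℝ) (((K + 1 : ℕ) * δ : ℝ≥0) : ℝ),
            ENNReal.ofReal (gridError μ A c L x v δ K + B ^ 2 * δ) := by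
        rw [lintegral_const, Measure.restrict_apply_univ, hvol, ← ENNReal.ofReal_mul (by positivity)]
        congr 1
        ring
      rw [hconst]
      refine setLIntegral_mono' measurableSet_Ioc fun t ht => ?_
      rw [h.lintegral_error hA]
      apply ENNReal.ofReal_le_ofReal
      have ht0 : 0 ≤ t := (NNReal.coe_nonneg _).trans ht.1.le
      have hle1 : K * δ ≤ t.toNNReal := NNReal.le_toNNReal_of_coe_le ht.1.le
      have hle2 : t.toNNReal ≤ (K + 1 : ℕ) * δ := Real.toNNReal_le_iff_le_coe.2 ht.2
      have h1 := h.error_le hA (C := fun _ => c) measurable_const (K * δ) (t.toNNReal - K * δ)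
      rw [add_tsub_cancel_of_le hle1] at h1
      have h2 : ((t.toNNReal - K * δ : ℝ≥0) : ℝ) ≤ δ := by
        have : t.toNNReal - K * δ ≤ δ := tsub_le_iff_left.2 (hle2.trans (le_of_eq (by push_cast; ring)))
        exact_mod_cast this
      have h3 := mul_le_mul_of_nonneg_left h2 (sq_nonneg B)
      have h4 : ∫ ω, (x (K * δ) ω - estimate μ (fun _ => c) x v (K * δ) ω) ^ 2 ∂μ
          ≤ gridError μ A c L x v δ K :=
        integral_sub_condExp_sq_le (h.obsAlgebra_le measurable_const _) (h.memLp hA _)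
          (h.memLp_gridFilter hA c L hδ K) (measurable_gridFilter A c L δ K).stronglyMeasurable
      linarith
    refine (add_le_add ih hcell).trans (le_of_eq ?_)
    rw [← ENNReal.ofReal_add (add_nonneg (mul_nonneg δ.coe_nonneg
      (Finset.sum_nonneg fun k _ => gridError_nonneg c L δ k)) (by positivity))
      (add_nonneg (mul_nonneg δ.coe_nonneg (gridError_nonneg c L δ K)) (by positivity)),
      Finset.sum_range_succ]
    congr 1
    push_cast
    ring

/-- The step of the grid of level `n`, as a square. -/
lemma sqrt_grid_sq (T : ℝ≥0) (n : ℕ) : (Real.sqrt T / 2 ^ n) ^ 2 = ((T / 4 ^ n : ℝ≥0) : ℝ) := by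
  push_cast
  rw [div_pow, Real.sq_sqrt T.coe_nonneg, ← pow_mul, mul_comm n 2, pow_mul]
  norm_num

lemma tendsto_sqrt_grid {T : ℝ≥0} (hT : 0 < T) :
    Tendsto (fun n : ℕ => Real.sqrt T / 2 ^ n) atTop (𝓝[>] 0) := by
  refine tendsto_nhdsWithin_iff.2 ⟨?_, Eventually.of_forall fun n => ?_⟩
  · exact tendsto_const_nhds.div_atTop (tendsto_pow_atTop_atTop_of_one_lt (by norm_num))
  · have : (0 : ℝ) < T := by exact_mod_cast hT
    exact Set.mem_Ioi.2 (by positivity)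

lemma eventually_grid_le_one (T : ℝ≥0) : ∀ᶠ n : ℕ in atTop, T / 4 ^ n ≤ 1 := by
  have h1 : Tendsto (fun n : ℕ => (T : ℝ) / 4 ^ n) atTop (𝓝 0) :=
    tendsto_const_nhds.div_atTop (tendsto_pow_atTop_atTop_of_one_lt (by norm_num))
  filter_upwards [h1.eventually_le_const (u := 1) one_pos] with n hn
  exact_mod_cast hn

lemma pow_mul_grid (T : ℝ≥0) (n : ℕ) : ((4 ^ n : ℕ) : ℝ≥0) * (T / 4 ^ n) = T := by
  push_cast
  field_simp

theorem IsModel.lintegral_error_le_of_const [IsProbabilityMeasure μ] (h : IsModel μ A B S0 x w v)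
    (hA : A < 0) (c L : ℝ) (hpos : 0 < L * c - A) {T : ℝ≥0} (hT : 0 < T) :
    (∫⁻ t in Set.Ioc (0 : ℝ) T, ∫⁻ ω, ENNReal.ofReal
        ((x t.toNNReal ω - estimate μ (fun _ => c) x v t.toNNReal ω) ^ 2) ∂μ)
      ≤ ENNReal.ofReal ((S0 + T * (L ^ 2 + B ^ 2)) / (2 * (L * c - A))) := by
  have hr := tendsto_sqrt_grid hT
  have h1 := (tendsto_accBound hA B c L (modulusConst A B S0) S0 T hpos).comp hr
  have h2 : Tendsto (fun n : ℕ => T * (B ^ 2 * (Real.sqrt T / 2 ^ n) ^ 2)) atTop (𝓝 0) := by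
    have := (((hr.mono_right nhdsWithin_le_nhds).pow 2).const_mul (B ^ 2)).const_mul (T : ℝ)
    simpa using this
  have h3 := h1.add h2
  rw [add_zero] at h3
  refine ge_of_tendsto ((ENNReal.continuous_ofReal.tendsto _).comp h3) ?_
  filter_upwards [eventually_grid_le_one T, hr.eventually (eventually_errFactor_lt A c L hpos)]
    with n hn hG
  have h4 := h.lintegral_error_le hA c L hn (4 ^ n)
  have hT0 : (0 : ℝ) < T := by exact_mod_cast hT
  have h5 := h.sum_gridError_le hA c L hn (r := Real.sqrt T / 2 ^ n) (by positivity)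
    (sqrt_grid_sq T n) hG (4 ^ n)
  have e : ((4 ^ n : ℕ) : ℝ) * ((T / 4 ^ n : ℝ≥0) : ℝ) = T := by exact_mod_cast pow_mul_grid T n
  rw [pow_mul_grid] at h4
  rw [e] at h5
  refine h4.trans (ENNReal.ofReal_le_ofReal ?_)
  simp only [Function.comp]
  rw [sqrt_grid_sq]
  have e2 : ((4 ^ n : ℕ) : ℝ) * (B ^ 2 * ((T / 4 ^ n : ℝ≥0) : ℝ) * ((T / 4 ^ n : ℝ≥0) : ℝ))
      = T * (B ^ 2 * ((T / 4 ^ n : ℝ≥0) : ℝ)) := by rw [← e]; ring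
  rw [e2]
  linarith

theorem IsModel.mutualInfo_le_of_const [IsProbabilityMeasure μ] (h : IsModel μ A B S0 x w v)
    (hA : A < 0) (c L : ℝ) (hpos : 0 < L * c - A) {T : ℝ≥0} (hT : 0 < T) :
    mutualInfo μ (fun ω (s : Set.Iic T) => x s ω)
        (fun ω (s : Set.Iic T) => estimate μ (fun _ => c) x v s ω)
      ≤ ENNReal.ofReal (c ^ 2 / 2 * ((S0 + T * (L ^ 2 + B ^ 2)) / (2 * (L * c - A))))
        / ENNReal.ofReal (Real.log 2) := by
  -- By data processing it suffices to bound the information between two σ-algebras, realized as the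
  -- identity map into Ω with the source σ-algebra and with the observation σ-algebra.
  have hmx : sourceAlgebra x ≤ ‹MeasurableSpace Ω› := iSup_le fun s => (h.measurable_x s).comap_le
  have hole := h.obsAlgebra_le (C := fun _ => c) measurable_const T
  have hX : Measurable[_, sourceAlgebra x] (id : Ω → Ω) := measurable_id'' hmx
  have hY : Measurable[_, obsAlgebra (fun _ => c) x v T] (id : Ω → Ω) := measurable_id'' hole
  refine (@mutualInfo_comp_le Ω Ω Ω (Set.Iic T → ℝ) (Set.Iic T → ℝ) _ (sourceAlgebra x)
    (obsAlgebra (fun _ => c) x v T) _ _ μ _ id id hX hY (fun ω s => x s ω)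
    (fun ω s => estimate μ (fun _ => c) x v s ω)
    (measurable_pi_of_forall fun s => measurable_sourceAlgebra x s)
    (measurable_pi_of_forall fun s =>
      (stronglyMeasurable_condExp.mono (obsAlgebra_mono _ x v s.2)).measurable)).trans ?_
  unfold mutualInfo
  refine ENNReal.div_le_div_right ?_ _
  have hr := tendsto_sqrt_grid hT
  have h1 := (tendsto_accBound hA B c L (modulusConst A B S0) S0 T hpos).comp hr
  have hr0 := hr.mono_right nhdsWithin_le_nhds
  have h2 := (((hr0.const_add 1).mul h1).add ((((hr0.pow 2).add hr0).const_mul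
    (modulusConst A B S0)).mul_const (T : ℝ))).const_mul (c ^ 2 / 2)
  simp only [add_zero, one_mul, ne_eq, OfNat.ofNat_ne_zero, not_false_eq_true, zero_pow, mul_zero,
    zero_mul] at h2
  refine @klDiv_le_of_generating Ω Ω Ω _ (sourceAlgebra x) (obsAlgebra (fun _ => c) x v T) μ _ id id hX hY
    (fun n => Fin (4 ^ n) → ℝ) _ (fun n => gridStat c x v T n) (measurable_gridStat c T)
    (monotone_comap_gridStat c T)
    (obsAlgebra_le_iSup_gridStat h.continuous_x h.continuous_v c hT) _ _ h2 ?_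
  filter_upwards [eventually_grid_le_one T, hr.eventually (eventually_errFactor_lt A c L hpos)]
    with n hn hG
  have hT0 : (0 : ℝ) < T := by exact_mod_cast hT
  have hr1 : 0 < Real.sqrt T / 2 ^ n := by positivity
  have h5 := h.sum_gridError_le hA c L hn hr1 (sqrt_grid_sq T n) hG (4 ^ n)
  have e : ((4 ^ n : ℕ) : ℝ) * ((T / 4 ^ n : ℝ≥0) : ℝ) = T := by exact_mod_cast pow_mul_grid T n
  -- Here the Young weight is r = √δ: then 1 + r → 1 and the fluctuation term is κ (r² + r) T → 0.
  -- Steps T / 4 ^ n make r = √T / 2 ^ n.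
  have h6 := h.klDiv_grid_le hA c L (δ := T / 4 ^ n) (by positivity) hn hr1 (mE := sourceAlgebra x) hX
    (f := cellIntegral c x (T / 4 ^ n))
    (fun k => measurable_integral_of_continuous measurable_const h.continuous_x
      (by gcongr; exact_mod_cast k.le_succ) fun r _ => measurable_sourceAlgebra x r) (fun _ _ => rfl)
    (fun t => measurable_id'' (iSup_le fun s =>
      (measurable_noisePast_source x v t s).comap_le)) (4 ^ n)
  refine h6.trans (ENNReal.ofReal_le_ofReal ?_)
  rw [e] at h5 ⊢
  simp only [Function.comp]
  have e3 : (1 + 1 / (Real.sqrt T / 2 ^ n)) * (modulusConst A B S0 * ((T / 4 ^ n : ℝ≥0) : ℝ) * T)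
      = modulusConst A B S0 * ((Real.sqrt T / 2 ^ n) ^ 2 + Real.sqrt T / 2 ^ n) * T := by
    rw [← sqrt_grid_sq]
    have := hr1.ne'
    generalize Real.sqrt T / 2 ^ n = r at this ⊢
    field_simp
  rw [e3]
  gcongr

lemma tendsto_ofReal_affine_div_nnreal (α β : ℝ) :
    Tendsto (fun T : ℝ≥0 => ENNReal.ofReal (T * α + β) / (T : ℝ≥0∞)) atTop
      (𝓝 (ENNReal.ofReal α)) := by
  have h1 : Tendsto (fun T : ℝ≥0 => ENNReal.ofReal (α + β / T)) atTop (𝓝 (ENNReal.ofReal α)) := by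
    refine (ENNReal.continuous_ofReal.tendsto _).comp ?_
    have : Tendsto (fun T : ℝ≥0 => β / (T : ℝ)) atTop (𝓝 0) :=
      tendsto_const_nhds.div_atTop (NNReal.tendsto_coe_atTop.2 tendsto_id)
    simpa using tendsto_const_nhds.add this
  refine h1.congr' ?_
  filter_upwards [eventually_gt_atTop 0] with T hT
  have hT0 : (0 : ℝ) < T := by exact_mod_cast hT
  rw [← ENNReal.ofReal_coe_nnreal (p := T), ← ENNReal.ofReal_div_of_pos hT0]
  congr 1
  field_simp

lemma limsup_le_of_le_affine_nnreal {u : ℝ≥0 → ℝ≥0∞} {α β : ℝ}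
    (h : ∀ T : ℝ≥0, 0 < T → u T ≤ ENNReal.ofReal (T * α + β)) :
    limsup (fun T : ℝ≥0 => u T / (T : ℝ≥0∞)) atTop ≤ ENNReal.ofReal α := by
  rw [← (tendsto_ofReal_affine_div_nnreal α β).limsup_eq]
  refine limsup_le_limsup ?_
  filter_upwards [eventually_gt_atTop 0] with T hT
  exact ENNReal.div_le_div_right (h T hT) _

variable {c D : ℝ}

/-- The hypothesis on c is the algebraic Riccati equation at D, and the filter gain is the
stationary Kalman gain L = c D. Then L² + B² = 2 (L c - A) D, so the accumulated error is at most D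
T plus a constant. -/
lemma IsModel.ctDistortion_le_of_const [IsProbabilityMeasure μ] (h : IsModel μ A B S0 x w v)
    (hA : A < 0) (hD : 0 ≤ D) (hc : c ^ 2 * D ^ 2 = 2 * A * D + B ^ 2) :
    ctDistortion μ (fun _ => c) x v ≤ ENNReal.ofReal D := by
  have hpos : 0 < c * D * c - A := by nlinarith [mul_nonneg hD (sq_nonneg c)]
  refine limsup_le_of_le_affine_nnreal (β := S0 / (2 * (c * D * c - A))) fun T hT => ?_
  refine (h.lintegral_error_le_of_const hA c (c * D) hpos hT).trans (le_of_eq ?_)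
  congr 1
  have e : (c * D) ^ 2 + B ^ 2 = 2 * (c * D * c - A) * D := by linarith [mul_pow c D 2]
  rw [e]
  obtain ⟨q, hq⟩ : ∃ q, q = c * D * c - A := ⟨_, rfl⟩
  rw [← hq] at hpos ⊢
  field_simp
  ring

lemma IsModel.ctInfoRate_le_of_const [IsProbabilityMeasure μ] (h : IsModel μ A B S0 x w v)
    (hA : A < 0) (hD : 0 ≤ D) (hc : c ^ 2 * D ^ 2 = 2 * A * D + B ^ 2) :
    ctInfoRate μ (fun _ => c) x v ≤ ENNReal.ofReal (c ^ 2 * D / 2 / Real.log 2) := by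
  have hpos : 0 < c * D * c - A := by nlinarith [mul_nonneg hD (sq_nonneg c)]
  refine limsup_le_of_le_affine_nnreal
    (β := c ^ 2 / 2 * (S0 / (2 * (c * D * c - A))) / Real.log 2) fun T hT => ?_
  refine (h.mutualInfo_le_of_const hA c (c * D) hpos hT).trans (le_of_eq ?_)
  rw [← ENNReal.ofReal_div_of_pos (Real.log_pos (by norm_num))]
  congr 1
  have e : (c * D) ^ 2 + B ^ 2 = 2 * (c * D * c - A) * D := by linarith [mul_pow c D 2]
  rw [e]
  obtain ⟨q, hq⟩ : ∃ q, q = c * D * c - A := ⟨_, rfl⟩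
  rw [← hq] at hpos ⊢
  field_simp
  ring

end UpperBound

end GaussMarkov

/-! ### Admissible gains and the resulting values -/

namespace GaussMarkov

/-- A constant gain is admissible once the Riccati equation has a smooth positive solution. -/
lemma isAdmissibleGain_const {A B c : ℝ} {S0 : ℝ≥0} {X : ℝ → ℝ} (h0 : X 0 = S0)
    (hpos : ∀ t, 0 ≤ t → 0 < X t) (hsm : ∀ t, 0 ≤ t → ContDiffAt ℝ 1 X t)
    (hX : ∀ t, 0 ≤ t → HasDerivAt X (2 * A * X t - c ^ 2 * X t ^ 2 + B ^ 2) t) :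
    IsAdmissibleGain A B S0 (fun _ => c) := by
  refine ⟨measurable_const, X, fun T hT => ?_, h0, hpos, ?_⟩
  · refine ContDiffOn.absolutelyContinuousOnInterval fun t ht => ?_
    rw [Set.uIcc_of_le hT] at ht
    exact (hsm t ht.1).contDiffWithinAt
  · refine ae_restrict_of_forall_mem measurableSet_Ici fun t ht => ?_
    exact (hX t ht).congr_deriv (by ring)

lemma isAdmissibleGain_zero {A B : ℝ} {S0 : ℝ≥0} (hA : A < 0) (hS0 : 0 < S0) :
    IsAdmissibleGain A B S0 (fun _ => 0) := by
  obtain ⟨V, hV⟩ : ∃ V : ℝ, V = -B ^ 2 / (2 * A) := ⟨_, rfl⟩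
  have hVA : 2 * A * V = -B ^ 2 := by rw [hV, mul_div_cancel₀ _ (mul_ne_zero two_ne_zero hA.ne)]
  have hV0 : 0 ≤ V := by
    rw [hV]; exact div_nonneg_of_nonpos (by nlinarith [sq_nonneg B]) (by linarith)
  have hS : (0 : ℝ) < S0 := hS0
  refine isAdmissibleGain_const (X := fun t => V + (S0 - V) * Real.exp (2 * A * t))
    (by simp) (fun t ht => ?_) (fun t _ => ?_) (fun t _ => ?_)
  · have h1 : Real.exp (2 * A * t) ≤ 1 := Real.exp_le_one_iff.2 (by nlinarith)
    have h2 := Real.exp_pos (2 * A * t)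
    have : V + (S0 - V) * Real.exp (2 * A * t)
        = V * (1 - Real.exp (2 * A * t)) + S0 * Real.exp (2 * A * t) := by ring
    rw [this]
    have := mul_nonneg hV0 (sub_nonneg.2 h1)
    positivity
  · fun_prop
  · have h := ((((hasDerivAt_id t).const_mul (2 * A)).exp).const_mul ((S0 : ℝ) - V)).const_add V
    refine h.congr_deriv ?_
    simp only [id_eq]
    linear_combination -hVA

lemma isAdmissibleGain_of_const {A B c D : ℝ} {S0 : ℝ≥0} (hA : A < 0) (hS0 : 0 < S0)
    (hD : 0 < D) (hc0 : c ≠ 0) (hc : c ^ 2 * D ^ 2 = 2 * A * D + B ^ 2) :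
    IsAdmissibleGain A B S0 (fun _ => c) := by
  have hS : (0 : ℝ) < S0 := hS0
  have hc2 : 0 < c ^ 2 := by positivity
  -- D and -E are the two equilibria of the Riccati equation.
  obtain ⟨E, hE⟩ : ∃ E : ℝ, E = D - 2 * A / c ^ 2 := ⟨_, rfl⟩
  have hEA : c ^ 2 * (D - E) = 2 * A := by rw [hE]; field_simp; ring
  have hE0 : 0 < E := by
    have : 2 * A / c ^ 2 < 0 := div_neg_of_neg_of_pos (by linarith) hc2
    linarith
  have hDE : c ^ 2 * (D * E) = B ^ 2 := by linear_combination hc - D * hEA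
  -- The cross ratio (X - D) / (X + E) starts at κ and decays like exp (γ t); solving for X gives
  -- the explicit solution below.
  obtain ⟨κ, hκ⟩ : ∃ κ : ℝ, κ = (S0 - D) / (S0 + E) := ⟨_, rfl⟩
  have hκS : κ * (S0 + E) = S0 - D := by rw [hκ]; field_simp
  have hκ1 : 0 < 1 - κ := by
    have : 1 - κ = (D + E) / (S0 + E) := by rw [hκ]; field_simp; ring
    rw [this]; positivity
  have hκ2 : 0 < D + E * κ := by
    have : D + E * κ = S0 * (D + E) / (S0 + E) := by rw [hκ]; field_simp; ring
    rw [this]; positivity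
  obtain ⟨γ, hγ⟩ : ∃ γ : ℝ, γ = -(c ^ 2 * (D + E)) := ⟨_, rfl⟩
  have hγ0 : γ < 0 := by rw [hγ]; simp only [Left.neg_neg_iff]; positivity
  have hden : ∀ t, 0 ≤ t → 0 < 1 - κ * Real.exp (γ * t) := fun t ht => by
    have h1 : Real.exp (γ * t) ≤ 1 := Real.exp_le_one_iff.2 (by nlinarith)
    have h2 := mul_pos (Real.exp_pos (γ * t)) hκ1
    nlinarith
  refine isAdmissibleGain_const
    (X := fun t => (D + E * (κ * Real.exp (γ * t))) / (1 - κ * Real.exp (γ * t)))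
    ?_ (fun t ht => div_pos ?_ (hden t ht)) (fun t ht => ?_) (fun t ht => ?_)
  · simp only [mul_zero, Real.exp_zero, mul_one]
    rw [div_eq_iff hκ1.ne']
    linear_combination hκS
  · have h1 : Real.exp (γ * t) ≤ 1 := Real.exp_le_one_iff.2 (by nlinarith)
    have h2 := mul_pos (Real.exp_pos (γ * t)) hκ2
    nlinarith
  · refine ContDiffAt.div ?_ ?_ (hden t ht).ne' <;> fun_prop
  · have hρ : HasDerivAt (fun t => κ * Real.exp (γ * t)) (γ * (κ * Real.exp (γ * t))) t :=
      ((((hasDerivAt_id t).const_mul γ).exp).const_mul κ).congr_deriv (by simp only [id_eq]; ring)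
    have h := ((hρ.const_mul E).const_add D).fun_div (hρ.const_sub 1) (hden t ht).ne'
    refine h.congr_deriv ?_
    have hd := (hden t ht).ne'
    rw [← hEA, ← hDE, hγ]
    rw [hγ] at hd
    generalize κ * Real.exp (-(c ^ 2 * (D + E)) * t) = ρ at hd ⊢
    field_simp
    ring

/-- The continuous-time information-distortion function. -/
theorem IsModel.ctInfoDistortion_eq {Ω : Type*} [MeasurableSpace Ω] {μ : Measure Ω}
    [IsProbabilityMeasure μ] {A B Dc : ℝ} {S0 : ℝ≥0} {x w v : ℝ≥0 → Ω → ℝ}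
    (h : IsModel μ A B S0 x w v) (hA : A < 0) (hDc : 0 < Dc) (hS0 : 0 < S0) :
    ctInfoDistortion μ A B S0 x v Dc = ENNReal.ofReal (limitRate A B Dc) := by
  apply le_antisymm
  · rcases le_or_gt (2 * A + B ^ 2 / Dc) 0 with hle | hgt
    -- Zero gain: the stationary variance of the source is already within the allowed distortion,
    -- and no information is transmitted.
    · have hV0 : 0 ≤ -B ^ 2 / (2 * A) :=
        div_nonneg_of_nonpos (by nlinarith [sq_nonneg B]) (by linarith)
      have hVD : -B ^ 2 / (2 * A) ≤ Dc := by
        have h1 : B ^ 2 / Dc ≤ -(2 * A) := by linarith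
        rw [div_le_iff₀ hDc] at h1
        rw [div_le_iff_of_neg (by linarith)]
        linarith
      have hc : (0 : ℝ) ^ 2 * (-B ^ 2 / (2 * A)) ^ 2 = 2 * A * (-B ^ 2 / (2 * A)) + B ^ 2 := by
        rw [mul_div_cancel₀ _ (mul_ne_zero two_ne_zero hA.ne)]; ring
      refine le_trans (sInf_le ⟨_, isAdmissibleGain_zero hA hS0,
        (h.ctDistortion_le_of_const hA hV0 hc).trans (ENNReal.ofReal_le_ofReal hVD), rfl⟩) ?_
      exact (h.ctInfoRate_le_of_const hA hV0 hc).trans (by simp)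
    · obtain ⟨c, hcdef⟩ : ∃ c, c = Real.sqrt ((2 * A + B ^ 2 / Dc) / Dc) := ⟨_, rfl⟩
      have hc0 : 0 < c := by rw [hcdef]; positivity
      have hcD : c ^ 2 * Dc = 2 * A + B ^ 2 / Dc := by
        rw [hcdef, Real.sq_sqrt (by positivity)]; field_simp
      have hc : c ^ 2 * Dc ^ 2 = 2 * A * Dc + B ^ 2 := by
        have : B ^ 2 / Dc * Dc = B ^ 2 := by field_simp
        linear_combination Dc * hcD + this
      refine le_trans (sInf_le ⟨_, isAdmissibleGain_of_const hA hS0 hDc hc0.ne' hc,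
        h.ctDistortion_le_of_const hA hDc.le hc, rfl⟩) ?_
      refine (h.ctInfoRate_le_of_const hA hDc.le hc).trans ?_
      rw [hcD, limitRate_eq_of_pos hgt.le]
  · refine le_sInf ?_
    rintro _ ⟨C, hC, hD, rfl⟩
    exact h.le_ctInfoRate hA hS0.ne' hC.1 hDc hD

/-- Rates that vanish linearly in the sampling period give vanishing bounds on the bitrate. -/
lemma tendsto_dtBound {A B Dc : ℝ} {S0 : ℝ≥0} (hA : A < 0) (hDc : 0 < Dc) (hS0 : S0 ≠ 0) :
    Tendsto (dtBound A B S0 Dc) (𝓝[>] 0) (𝓝 0) := by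
  refine tendsto_thetaInv_div (c := limitRate A B Dc + 1)
    (fun τ _ => ENNReal.toReal_nonneg) ?_
  have hlt : ENNReal.ofReal (limitRate A B Dc) < ENNReal.ofReal (limitRate A B Dc + 1) :=
    (ENNReal.ofReal_lt_ofReal_iff (by linarith [limitRate_nonneg A B Dc])).2 (by linarith)
  filter_upwards [(tendsto_normRate hA hDc hS0).eventually_lt_const hlt, self_mem_nhdsWithin]
    with τ hτ hτ0
  have hτ0' : 0 < τ := hτ0
  have h1 := (ENNReal.div_le_iff (by simpa using hτ0') ENNReal.ofReal_ne_top).1 hτ.le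
  rw [← ENNReal.ofReal_mul (by linarith [limitRate_nonneg A B Dc])] at h1
  exact ENNReal.toReal_le_of_le_ofReal
    (mul_nonneg (by linarith [limitRate_nonneg A B Dc]) hτ0'.le) h1

lemma tendsto_ctBound (r : ℝ≥0∞) : Tendsto (ctBound r) (𝓝[>] 0) (𝓝 0) :=
  tendsto_thetaInv_div (c := r.toReal) (fun _ hτ => mul_nonneg hτ.le ENNReal.toReal_nonneg)
    (Eventually.of_forall fun τ => (mul_comm τ r.toReal).le)

end GaussMarkov
theorem lemma6 {Ω : Type*} [MeasurableSpace Ω] (μ : Measure Ω) [IsProbabilityMeasure μ]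
    (A B Dc : ℝ) (hA : A < 0) (hDc : 0 < Dc) (S0 : ℝ≥0) (hS0 : 0 < S0)
    (x w v : ℝ≥0 → Ω → ℝ) (hmodel : GaussMarkov.IsModel μ A B S0 x w v) :
    -- the arguments of `R` are in its domain for all small `τ > 0`
    (∀ᶠ τ in 𝓝[>] (0 : ℝ), 0 < GaussMarkov.Dd A B Dc τ ∧ 0 < GaussMarkov.Qd A τ) ∧
    -- `f`, extended to `τ = 0` by its limit, has a local minimum there
    IsLocalMinOn
      (Function.update (GaussMarkov.normRate A B S0 Dc) 0
        (GaussMarkov.ctInfoDistortion μ A B S0 x v Dc))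
      (Set.Ici 0) 0 ∧
    -- the limit
    Tendsto (GaussMarkov.normRate A B S0 Dc) (𝓝[>] 0)
      (𝓝 (GaussMarkov.ctInfoDistortion μ A B S0 x v Dc)) ∧
    GaussMarkov.ctInfoDistortion μ A B S0 x v Dc
      = ENNReal.ofReal (Real.logb 2 (Real.exp 1) * max 0 (A + B ^ 2 / (2 * Dc))) ∧
    -- the two lower bounds coincide in the limit
    Tendsto (fun τ : ℝ => GaussMarkov.dtBound A B S0 Dc τ
        - GaussMarkov.ctBound (GaussMarkov.ctInfoDistortion μ A B S0 x v Dc) τ)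
      (𝓝[>] 0) (𝓝 0) := by
  have hS : S0 ≠ 0 := hS0.ne'
  have hct := hmodel.ctInfoDistortion_eq hA hDc hS0
  refine ⟨?_, ?_, ?_, hct, ?_⟩
  · filter_upwards [GaussMarkov.eventually_Dd_pos hA hDc, self_mem_nhdsWithin] with τ h1 hτ
    exact ⟨h1, GaussMarkov.Qd_pos hA hτ⟩
  · have h := GaussMarkov.eventually_limitRate_le_normRate hA hDc hS (B := B)
    rw [eventually_nhdsWithin_iff] at h
    refine eventually_nhdsWithin_iff.2 ?_
    filter_upwards [h] with τ hτ h0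
    rcases eq_or_lt_of_le (show (0 : ℝ) ≤ τ from h0) with rfl | hpos
    · exact le_rfl
    · rw [Function.update_self, Function.update_of_ne hpos.ne', hct]
      exact hτ hpos
  · rw [hct]
    exact GaussMarkov.tendsto_normRate hA hDc hS
  -- Each bound tends to zero on its own, since the rates are O(τ) and θ⁻¹(y) = o(y).
  · simpa using (GaussMarkov.tendsto_dtBound hA hDc hS).sub (GaussMarkov.tendsto_ctBound _)
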